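/- Let $k$ be a perfect field. Let $R$ be the representation ring of $k[x]$: as an abelian group it is generated by the classes $[V]$ of finite-dimensional $k[x]$-modules with relations $[V\oplus W]=[V]+[W]$ (equivalently, by Krull–Schmidt, it is free on the isomorphism classes of indecomposables), and $[V][W]=[V\otimes_k W]$, where $x$ acts on $V\otimes_k W$ by $v\otimes w\mapsto xv\otimes xw$. Let $\dim:R\to\mathbb Z$ be the ring homomorphism $[V]\mapsto\dim_k V$. For a quiver $Q$, the representation ring $R(Q)$ is defined in the same way from the finite-dimensional representations of $Q$ over $k$, with direct sums and tensor products taken pointwise and arrowwise. Let $R'\subseteq R$ be the $\mathbb Z$-span of all $[k[x]/(x-1)^s]$, $s\ge1$, and let $\bar R\subseteq R$ be the $\mathbb Z$-span of all $[k[x]/f(x)]$ with $f$ irreducible and $f(0)\neq0$. Let $n\ge0$ and let $Q$ be a quiver of type $\tilde{\mathbb A}_n$: it has vertices $a_0,\dots,a_n$ and arrows $\alpha_0,\dots,\alpha_n$, where $\alpha_m$ joins $a_m$ and $a_{m+1}$ (indices modulo $n+1$) and is oriented arbitrarily. For integers $i\le j$ the string $S(i,j)$ is the representation with basis $e_i,\dots,e_j$,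 where $e_s$ sits at the vertex $a_{s \bmod n+1}$ and an arrow $\alpha_m$ sends each basis vector $e_s$ at its tail to $e_{s+1}$ if $\alpha_m$ is directed from $a_m$ to $a_{m+1}$, and to $e_{s-1}$ otherwise (with $e_t=0$ for $t\notin[i,j]$). For $f$ irreducible and monic with $f(0)\ne0$ and $s\ge1$, the band $B_f(s)$ has the space $k[x]/f(x)^s$ at every vertex, $\alpha_n$ acts as multiplication by $x$, and the other arrows act as the identity. Then $R'$ and $\bar R$ are subrings of $R$, the $\mathbb Z$-span $I_n$ of all strings $[S(i,j)]$ is an ideal of $R(Q)$, the $\mathbb Z$-span of all bands $[B_f(s)]$ is a subring of $R(Q)$, and there is a ring isomorphism $$\Phi:\;R'\otimes_{\mathbb Z}\bar R\,\oplus\, I_n\;\longrightarrow\; R(Q),$$ where the ring structure on the left extends those of $R'\otimes_{\mathbb Z}\bar R$ and $I_n$ by $(a\otimes b)w=w(a\otimes b)=\dim(a)\dim(b)\,w$ for $a\in R'$, $b\in\bar R$, $w\in I_n$. The isomorphism $\Phi$ is the identity on $I_n$, maps $R'\otimes_{\mathbb Z}\bar R$ onto the $\mathbb Z$-span of the bands,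 and satisfies $\Phi([k[x]/(x-1)^s]\otimes[k[x]/f(x)])=[B_f(s)]$ for all $s \ge 1$ and all irreducible monic $f$ with $f(0)\neq0$. -/

import Mathlib

open Polynomial
open scoped TensorProduct

universe u

/-! ## The Grothendieck ring of a commutative semiring -/

/-- The Grothendieck ring of a commutative semiring `M`: the Grothendieck group of `(M, +)`, with
the unique biadditive multiplication extending the one of `M`. -/
def GrothendieckRing (M : Type*) [CommSemiring M] : Type _ := Algebra.GrothendieckAddGroup M

namespace GrothendieckRing

variable {M : Type*} [CommSemiring M]

noncomputable instance : AddCommGroup (GrothendieckRing M) :=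
  inferInstanceAs (AddCommGroup (Algebra.GrothendieckAddGroup M))

/-- The canonical additive map from a commutative semiring to its Grothendieck ring. -/
noncomputable def of : M →+ GrothendieckRing M := Algebra.GrothendieckAddGroup.of (M := M)

/-- The universal property of the underlying additive group. -/
noncomputable def liftAdd {G : Type*} [AddCommGroup G] (f : M →+ G) : GrothendieckRing M →+ G :=
  Algebra.GrothendieckAddGroup.lift f

@[simp] theorem liftAdd_of {G : Type*} [AddCommGroup G] (f : M →+ G) (m : M) :
    liftAdd f (of m) = f m :=
  DFunLike.congr_fun (Algebra.GrothendieckAddGroup.lift.symm_apply_apply f) m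

theorem exists_eq_of_sub_of (x : GrothendieckRing M) : ∃ a b : M, x = of a - of b := by
  have key (x : Algebra.GrothendieckAddGroup M) : ∃ a b : M,
      x = Algebra.GrothendieckAddGroup.of a - Algebra.GrothendieckAddGroup.of b := by
    induction x using AddLocalization.ind with
    | H y =>
      obtain ⟨a, b, hb⟩ := y
      refine ⟨a, b, eq_sub_of_add_eq ?_⟩
      change AddLocalization.mk a ⟨b, hb⟩ + AddLocalization.mk b 0 = AddLocalization.mk a 0
      rw [AddLocalization.mk_add, AddLocalization.mk_eq_mk_iff, AddLocalization.r_iff_exists]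
      exact ⟨0, by simp [add_comm]⟩
  exact key x

/-- Two additive maps out of the Grothendieck ring agree if they agree on `M`. -/
theorem addHom_ext {G : Type*} [AddCommGroup G] {f g : GrothendieckRing M →+ G}
    (h : ∀ m, f (of m) = g (of m)) : f = g := by
  ext x
  obtain ⟨a, b, rfl⟩ := exists_eq_of_sub_of x
  simp [h]

/-- The multiplication, as a biadditive map. -/
noncomputable def mulHom : GrothendieckRing M →+ GrothendieckRing M →+ GrothendieckRing M :=
  liftAdd
    { toFun := fun a => liftAdd (of.comp (AddMonoidHom.mulLeft a))
      map_zero' := addHom_ext fun m => by simp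
      map_add' := fun a b => addHom_ext fun m => by simp [add_mul] }

noncomputable instance : Mul (GrothendieckRing M) := ⟨fun x y => mulHom x y⟩

noncomputable instance : One (GrothendieckRing M) := ⟨of 1⟩

theorem of_one : of (1 : M) = 1 := rfl

theorem of_mul (a b : M) : of (a * b) = of a * of b := by
  change _ = mulHom (of a) (of b)
  simp [mulHom]

noncomputable instance : CommRing (GrothendieckRing M) :=
  have hl : ∀ x y z : GrothendieckRing M, x * (y + z) = x * y + x * z :=
    fun x y z => map_add (mulHom x) y z
  have hr : ∀ x y z : GrothendieckRing M, (x + y) * z = x * z + y * z := fun x y z => by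
    change mulHom (x + y) z = mulHom x z + mulHom y z
    simp
  have hls : ∀ x y z : GrothendieckRing M, x * (y - z) = x * y - x * z :=
    fun x y z => map_sub (mulHom x) y z
  have hrs : ∀ x y z : GrothendieckRing M, (x - y) * z = x * z - y * z := fun x y z => by
    change mulHom (x - y) z = mulHom x z - mulHom y z
    simp
  have hc : ∀ x y : GrothendieckRing M, x * y = y * x := fun x y => by
    obtain ⟨a, b, rfl⟩ := exists_eq_of_sub_of x
    obtain ⟨c, d, rfl⟩ := exists_eq_of_sub_of y
    simp only [hls, hrs, ← of_mul, mul_comm]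
    abel
  have h1 : ∀ x : GrothendieckRing M, 1 * x = x := fun x => by
    obtain ⟨a, b, rfl⟩ := exists_eq_of_sub_of x
    simp only [hls, ← of_one, ← of_mul, one_mul]
  { (inferInstance : AddCommGroup (GrothendieckRing M)) with
    mul := (· * ·)
    one := 1
    left_distrib := hl
    right_distrib := hr
    zero_mul := fun x => by
      change mulHom 0 x = 0
      simp
    mul_zero := fun x => map_zero (mulHom x)
    mul_assoc := fun x y z => by
      obtain ⟨a, b, rfl⟩ := exists_eq_of_sub_of x
      obtain ⟨c, d, rfl⟩ := exists_eq_of_sub_of y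
      obtain ⟨e, f, rfl⟩ := exists_eq_of_sub_of z
      simp only [hls, hrs, ← of_mul, mul_assoc]
    one_mul := h1
    mul_one := fun x => by rw [hc, h1]
    mul_comm := hc }

/-- A semiring homomorphism from `M` to a commutative ring extends to the Grothendieck ring. -/
noncomputable def lift {S : Type*} [CommRing S] (f : M →+* S) : GrothendieckRing M →+* S :=
  { liftAdd (f : M →+ S) with
    map_one' := by
      change liftAdd (f : M →+ S) (of 1) = 1
      simp
    map_mul' := fun x y => by
      change liftAdd (f : M →+ S) (x * y) = liftAdd (f : M →+ S) x * liftAdd (f : M →+ S) y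
      obtain ⟨a, b, rfl⟩ := exists_eq_of_sub_of x
      obtain ⟨c, d, rfl⟩ := exists_eq_of_sub_of y
      simp only [mul_sub, sub_mul, ← of_mul, map_sub, liftAdd_of]
      simp }

@[simp] theorem lift_of {S : Type*} [CommRing S] (f : M →+* S) (m : M) :
    lift f (of m) = f m := liftAdd_of (f : M →+ S) m

end GrothendieckRing

/-! ## Naturality of the standard isomorphisms between sums and tensor products -/

namespace TensorAux

variable {k : Type*} [Field k] {U V W U' V' W' : Type*}
  [AddCommGroup U] [AddCommGroup V] [AddCommGroup W]
  [AddCommGroup U'] [AddCommGroup V'] [AddCommGroup W']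
  [Module k U] [Module k V] [Module k W] [Module k U'] [Module k V'] [Module k W']

theorem congr_nat (e : V ≃ₗ[k] V') (e₂ : U ≃ₗ[k] U') (f : W ≃ₗ[k] W')
    {Z Z' : Type*} [AddCommGroup Z] [AddCommGroup Z'] [Module k Z] [Module k Z']
    (f₂ : Z ≃ₗ[k] Z')
    (S : V →ₗ[k] U) (S' : V' →ₗ[k] U') (T : W →ₗ[k] Z) (T' : W' →ₗ[k] Z')
    (he : ∀ v, e₂ (S v) = S' (e v)) (hf : ∀ v, f₂ (T v) = T' (f v)) (v : V ⊗[k] W) :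
    TensorProduct.congr e₂ f₂ (TensorProduct.map S T v) =
      TensorProduct.map S' T' (TensorProduct.congr e f v) := by
  induction v using TensorProduct.induction_on with
  | zero => simp
  | tmul a b => simp [he, hf]
  | add a b ha hb => simp only [map_add, ha, hb]

theorem assoc_nat (R : U →ₗ[k] U') (S : V →ₗ[k] V') (T : W →ₗ[k] W') (v : (U ⊗[k] V) ⊗[k] W) :
    TensorProduct.assoc k U' V' W' (TensorProduct.map (TensorProduct.map R S) T v) =
      TensorProduct.map R (TensorProduct.map S T) (TensorProduct.assoc k U V W v) :=
  (LinearMap.congr_fun (TensorProduct.map_map_comp_assoc_eq R S T) v).symm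

theorem comm_nat (S : V →ₗ[k] V') (T : W →ₗ[k] W') (v : V ⊗[k] W) :
    TensorProduct.comm k V' W' (TensorProduct.map S T v) =
      TensorProduct.map T S (TensorProduct.comm k V W v) := by
  induction v using TensorProduct.induction_on with
  | zero => simp
  | tmul a b => simp
  | add a b ha hb => simp only [map_add, ha, hb]

theorem lid_nat (S : V →ₗ[k] V') (v : k ⊗[k] V) :
    TensorProduct.lid k V' (TensorProduct.map LinearMap.id S v) =
      S (TensorProduct.lid k V v) := by
  induction v using TensorProduct.induction_on with
  | zero => simp
  | tmul a b => simp
  | add a b ha hb => simp only [map_add, ha, hb]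

theorem rid_nat (S : V →ₗ[k] V') (v : V ⊗[k] k) :
    TensorProduct.rid k V' (TensorProduct.map S LinearMap.id v) =
      S (TensorProduct.rid k V v) := by
  induction v using TensorProduct.induction_on with
  | zero => simp
  | tmul a b => simp
  | add a b ha hb => simp only [map_add, ha, hb]

theorem prodRight_nat (R : U →ₗ[k] U') (S : V →ₗ[k] V') (T : W →ₗ[k] W')
    (v : U ⊗[k] (V × W)) :
    TensorProduct.prodRight k k U' V' W' (TensorProduct.map R (S.prodMap T) v) =
      ((TensorProduct.map R S).prodMap (TensorProduct.map R T))
        (TensorProduct.prodRight k k U V W v) := by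
  induction v using TensorProduct.induction_on with
  | zero => simp only [map_zero]
  | tmul a b => simp
  | add a b ha hb => simp only [map_add, ha, hb]

theorem prodLeft_nat (R : U →ₗ[k] U') (S : V →ₗ[k] V') (T : W →ₗ[k] W')
    (v : (U × V) ⊗[k] W) :
    TensorProduct.prodLeft k k U' V' W' (TensorProduct.map (R.prodMap S) T v) =
      ((TensorProduct.map R T).prodMap (TensorProduct.map S T))
        (TensorProduct.prodLeft k k U V W v) := by
  induction v using TensorProduct.induction_on with
  | zero => simp only [map_zero]
  | tmul a b =>
    obtain ⟨a, a'⟩ := a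
    simp [TensorProduct.prodLeft_tmul]
  | add a b ha hb => simp only [map_add, ha, hb]

theorem subsingleton_left [Subsingleton V] : Subsingleton (V ⊗[k] W) :=
  subsingleton_of_forall_eq 0 fun v => by
    induction v using TensorProduct.induction_on with
    | zero => rfl
    | tmul a b => rw [Subsingleton.elim a 0, TensorProduct.zero_tmul]
    | add a b ha hb => rw [ha, hb, add_zero]

theorem subsingleton_right [Subsingleton W] : Subsingleton (V ⊗[k] W) :=
  have : Subsingleton (W ⊗[k] V) := subsingleton_left
  (TensorProduct.comm k V W).injective.subsingleton

end TensorAux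

/-! ## Finite-dimensional `k[X]`-modules and their representation ring -/

/-- A finite-dimensional `k[X]`-module: a finite-dimensional `k`-vector space together with the
linear operator by which `X` acts. -/
structure PolyModule (k : Type u) [Field k] where
  /-- the underlying vector space -/
  carrier : Type u
  [addCommGroup : AddCommGroup carrier]
  [module : Module k carrier]
  [finite : Module.Finite k carrier]
  /-- the action of `X` -/
  op : carrier →ₗ[k] carrier

namespace PolyModule

attribute [instance] addCommGroup module finite

variable {k : Type u} [Field k]

/-- Isomorphism of `k[X]`-modules: a linear bijection that commutes with the action of `X`. -/
def Iso (V W : PolyModule k) : Prop :=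
  ∃ e : V.carrier ≃ₗ[k] W.carrier, ∀ v, e (V.op v) = W.op (e v)

instance isoSetoid (k : Type u) [Field k] : Setoid (PolyModule k) where
  r := Iso
  iseqv :=
    { refl := fun V => ⟨LinearEquiv.refl k _, fun _ => rfl⟩
      symm := fun {V W} ⟨e, he⟩ => ⟨e.symm, fun v => by
        apply e.injective
        simp [he]⟩
      trans := fun {U V W} ⟨e, he⟩ ⟨f, hf⟩ => ⟨e.trans f, fun v => by simp [he, hf]⟩ }

/-- The direct sum `V ⊕ W`. -/
abbrev sum (V W : PolyModule k) : PolyModule k where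
  carrier := V.carrier × W.carrier
  op := V.op.prodMap W.op

/-- The tensor product `V ⊗ W` over `k`, where `X` acts by `v ⊗ w ↦ X v ⊗ X w`. -/
noncomputable abbrev tensor (V W : PolyModule k) : PolyModule k where
  carrier := V.carrier ⊗[k] W.carrier
  op := TensorProduct.map V.op W.op

/-- The zero module. -/
abbrev zero (k : Type u) [Field k] : PolyModule k where
  carrier := PUnit.{u + 1}
  op := 0

/-- The field `k`, on which `X` acts as the identity. -/
abbrev unit (k : Type u) [Field k] : PolyModule k where
  carrier := k
  op := LinearMap.id

/-- The cyclic module `k[X]/(f)`, for `f ≠ 0`. -/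
noncomputable abbrev quot (f : k[X]) (hf : f ≠ 0) : PolyModule k where
  carrier := AdjoinRoot f
  finite := (AdjoinRoot.powerBasis hf).finite
  op := LinearMap.mulLeft k (AdjoinRoot.root f)

/-- Isomorphism classes of finite-dimensional `k[X]`-modules. -/
def IsoClass (k : Type u) [Field k] : Type (u + 1) := Quotient (isoSetoid k)

/-- The isomorphism class of `V`. -/
def isoClass (V : PolyModule k) : IsoClass k := Quotient.mk (isoSetoid k) V

theorem sum_congr {V V' W W' : PolyModule k} (h : Iso V V') (h' : Iso W W') :
    Iso (sum V W) (sum V' W') := by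
  obtain ⟨e, he⟩ := h
  obtain ⟨f, hf⟩ := h'
  exact ⟨LinearEquiv.prodCongr e f, fun v => Prod.ext (he v.1) (hf v.2)⟩

theorem tensor_congr {V V' W W' : PolyModule k} (h : Iso V V') (h' : Iso W W') :
    Iso (tensor V W) (tensor V' W') := by
  obtain ⟨e, he⟩ := h
  obtain ⟨f, hf⟩ := h'
  exact ⟨TensorProduct.congr e f, fun v => TensorAux.congr_nat e e f f _ _ _ _ he hf v⟩

instance : Zero (IsoClass k) := ⟨Quotient.mk _ (zero k)⟩

instance : One (IsoClass k) := ⟨Quotient.mk _ (unit k)⟩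

instance : Add (IsoClass k) := ⟨Quotient.map₂ sum fun _ _ h _ _ h' => sum_congr h h'⟩

noncomputable instance : Mul (IsoClass k) :=
  ⟨Quotient.map₂ tensor fun _ _ h _ _ h' => tensor_congr h h'⟩

/-- The semiring of isomorphism classes: addition is the direct sum, multiplication the tensor
product. -/
noncomputable instance : CommSemiring (IsoClass k) where
  nsmul := nsmulRec
  npow := npowRec
  add_assoc := by
    rintro ⟨U⟩ ⟨V⟩ ⟨W⟩
    exact Quotient.sound ⟨LinearEquiv.prodAssoc k _ _ _, fun _ => rfl⟩
  zero_add := by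
    rintro ⟨V⟩
    exact Quotient.sound ⟨LinearEquiv.uniqueProd (M₂ := PUnit.{u + 1}), fun _ => rfl⟩
  add_zero := by
    rintro ⟨V⟩
    exact Quotient.sound ⟨LinearEquiv.prodUnique (M₂ := PUnit.{u + 1}), fun _ => rfl⟩
  add_comm := by
    rintro ⟨V⟩ ⟨W⟩
    exact Quotient.sound ⟨LinearEquiv.prodComm k _ _, fun _ => rfl⟩
  mul_assoc := by
    rintro ⟨U⟩ ⟨V⟩ ⟨W⟩
    exact Quotient.sound ⟨TensorProduct.assoc k _ _ _,
      fun v => TensorAux.assoc_nat U.op V.op W.op v⟩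
  mul_comm := by
    rintro ⟨V⟩ ⟨W⟩
    exact Quotient.sound ⟨TensorProduct.comm k _ _,
      fun v => TensorAux.comm_nat V.op W.op v⟩
  one_mul := by
    rintro ⟨V⟩
    exact Quotient.sound ⟨TensorProduct.lid k _,
      fun v => TensorAux.lid_nat V.op v⟩
  mul_one := by
    rintro ⟨V⟩
    exact Quotient.sound ⟨TensorProduct.rid k _,
      fun v => TensorAux.rid_nat V.op v⟩
  left_distrib := by
    rintro ⟨U⟩ ⟨V⟩ ⟨W⟩
    exact Quotient.sound ⟨TensorProduct.prodRight k k _ _ _,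
      fun v => TensorAux.prodRight_nat U.op V.op W.op v⟩
  right_distrib := by
    rintro ⟨U⟩ ⟨V⟩ ⟨W⟩
    exact Quotient.sound ⟨TensorProduct.prodLeft k k _ _ _,
      fun v => TensorAux.prodLeft_nat U.op V.op W.op v⟩
  zero_mul := by
    rintro ⟨V⟩
    have : Subsingleton (PUnit.{u + 1} ⊗[k] V.carrier) := TensorAux.subsingleton_left
    exact Quotient.sound ⟨(0 : (PUnit.{u + 1} ⊗[k] V.carrier) ≃ₗ[k] PUnit.{u + 1}), fun _ => rfl⟩
  mul_zero := by
    rintro ⟨V⟩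
    have : Subsingleton (V.carrier ⊗[k] PUnit.{u + 1}) := TensorAux.subsingleton_right
    exact Quotient.sound ⟨(0 : (V.carrier ⊗[k] PUnit.{u + 1}) ≃ₗ[k] PUnit.{u + 1}), fun _ => rfl⟩

/-- The dimension of an isomorphism class. -/
noncomputable def dimIso (k : Type u) [Field k] : IsoClass k →+* ℤ where
  toFun := Quotient.lift (fun V : PolyModule k => (Module.finrank k V.carrier : ℤ))
    fun _ _ ⟨e, _⟩ => by simp [e.finrank_eq]
  map_zero' := by
    change ((Module.finrank k PUnit.{u + 1} : ℕ) : ℤ) = 0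
    rw [Module.finrank_zero_of_subsingleton, Nat.cast_zero]
  map_one' := by
    change ((Module.finrank k k : ℕ) : ℤ) = 1
    simp
  map_add' := by
    rintro ⟨V⟩ ⟨W⟩
    change ((Module.finrank k (V.carrier × W.carrier) : ℕ) : ℤ) =
      (Module.finrank k V.carrier : ℤ) + (Module.finrank k W.carrier : ℤ)
    simp
  map_mul' := by
    rintro ⟨V⟩ ⟨W⟩
    change ((Module.finrank k (V.carrier ⊗[k] W.carrier) : ℕ) : ℤ) =
      (Module.finrank k V.carrier : ℤ) * (Module.finrank k W.carrier : ℤ)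
    simp

end PolyModule

/-- The representation ring `R` of `k[X]`. -/
abbrev PolyRepRing (k : Type u) [Field k] : Type (u + 1) :=
  GrothendieckRing (PolyModule.IsoClass k)

namespace PolyRepRing

variable {k : Type u} [Field k]

/-- The element `[V]` of `R`. -/
noncomputable def cls (V : PolyModule k) : PolyRepRing k :=
  GrothendieckRing.of V.isoClass

theorem cls_sum (V W : PolyModule k) : cls (V.sum W) = cls V + cls W :=
  map_add GrothendieckRing.of V.isoClass W.isoClass

theorem cls_tensor (V W : PolyModule k) : cls (V.tensor W) = cls V * cls W :=
  GrothendieckRing.of_mul V.isoClass W.isoClass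

/-- The ring homomorphism `dim : R → ℤ` with `dim [V] = dim V`. -/
noncomputable def dim (k : Type u) [Field k] : PolyRepRing k →+* ℤ :=
  GrothendieckRing.lift (PolyModule.dimIso k)

theorem dim_cls (V : PolyModule k) : dim k (cls V) = (Module.finrank k V.carrier : ℤ) :=
  GrothendieckRing.lift_of _ _

/-- The element `[k[X]/(X - 1)^s]` of `R`. -/
noncomputable def unipotent (k : Type u) [Field k] (s : ℕ) : PolyRepRing k :=
  cls (PolyModule.quot ((X - C (1 : k)) ^ s) (pow_ne_zero s (X_sub_C_ne_zero 1)))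

/-- The element `[k[X]/(f)]` of `R`, for `f` irreducible. -/
noncomputable def simple (f : k[X]) (hf : Irreducible f) : PolyRepRing k :=
  cls (PolyModule.quot f hf.ne_zero)

/-- The `ℤ`-span `R'` of all `[k[X]/(X - 1)^s]`, `s ≥ 1`. -/
noncomputable def unipotentSpan (k : Type u) [Field k] : Submodule ℤ (PolyRepRing k) :=
  Submodule.span ℤ {r | ∃ s : ℕ, 0 < s ∧ r = unipotent k s}

/-- The `ℤ`-span of all `[k[X]/(f)]` with `f` irreducible and `f(0) ≠ 0`. -/
noncomputable def simpleSpan (k : Type u) [Field k] : Submodule ℤ (PolyRepRing k) :=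
  Submodule.span ℤ {r | ∃ (f : k[X]) (hf : Irreducible f), f.eval 0 ≠ 0 ∧ r = simple f hf}

end PolyRepRing

/-! ## Representations of quivers and their representation rings -/

/-- A (finite-dimensional) representation of the quiver `Q` over `k`. -/
structure QuiverRep (k : Type u) [Field k] (Q : Type*) [Quiver Q] where
  /-- the vector space at a vertex -/
  obj : Q → Type u
  [addCommGroup : ∀ x, AddCommGroup (obj x)]
  [module : ∀ x, Module k (obj x)]
  [finite : ∀ x, Module.Finite k (obj x)]
  /-- the linear map of an arrow -/
  map : ∀ {x y : Q}, (x ⟶ y) → (obj x →ₗ[k] obj y)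

namespace QuiverRep

attribute [instance] addCommGroup module finite

variable {k : Type u} [Field k] {Q : Type*} [Quiver Q]

/-- Isomorphism of representations. -/
def Iso (V W : QuiverRep k Q) : Prop :=
  ∃ e : ∀ x, V.obj x ≃ₗ[k] W.obj x,
    ∀ (x y : Q) (a : x ⟶ y) (v : V.obj x), e y (V.map a v) = W.map a (e x v)

instance isoSetoid (k : Type u) [Field k] (Q : Type*) [Quiver Q] : Setoid (QuiverRep k Q) where
  r := Iso
  iseqv :=
    { refl := fun V => ⟨fun _ => LinearEquiv.refl k _, fun _ _ _ _ => rfl⟩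
      symm := fun {V W} ⟨e, he⟩ => ⟨fun x => (e x).symm, fun x y a v => by
        apply (e y).injective
        simp [he]⟩
      trans := fun {U V W} ⟨e, he⟩ ⟨f, hf⟩ =>
        ⟨fun x => (e x).trans (f x), fun x y a v => by simp [he, hf]⟩ }

/-- The direct sum, pointwise and arrowwise. -/
abbrev sum (V W : QuiverRep k Q) : QuiverRep k Q where
  obj x := V.obj x × W.obj x
  map a := (V.map a).prodMap (W.map a)

/-- The tensor product, pointwise and arrowwise. -/
noncomputable abbrev tensor (V W : QuiverRep k Q) : QuiverRep k Q where
  obj x := V.obj x ⊗[k] W.obj x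
  map a := TensorProduct.map (V.map a) (W.map a)

/-- The zero representation. -/
abbrev zero (k : Type u) [Field k] (Q : Type*) [Quiver Q] : QuiverRep k Q where
  obj _ := PUnit.{u + 1}
  map _ := 0

/-- The representation with `k` at every vertex and the identity on every arrow. -/
abbrev unit (k : Type u) [Field k] (Q : Type*) [Quiver Q] : QuiverRep k Q where
  obj _ := k
  map _ := LinearMap.id

/-- Isomorphism classes of representations. -/
def IsoClass (k : Type u) [Field k] (Q : Type*) [Quiver Q] : Type _ := Quotient (isoSetoid k Q)

/-- The isomorphism class of `V`. -/
def isoClass (V : QuiverRep k Q) : IsoClass k Q := Quotient.mk (isoSetoid k Q) V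

theorem sum_congr {V V' W W' : QuiverRep k Q} (h : Iso V V') (h' : Iso W W') :
    Iso (sum V W) (sum V' W') := by
  obtain ⟨e, he⟩ := h
  obtain ⟨f, hf⟩ := h'
  exact ⟨fun x => LinearEquiv.prodCongr (e x) (f x),
    fun x y a v => Prod.ext (he x y a v.1) (hf x y a v.2)⟩

theorem tensor_congr {V V' W W' : QuiverRep k Q} (h : Iso V V') (h' : Iso W W') :
    Iso (tensor V W) (tensor V' W') := by
  obtain ⟨e, he⟩ := h
  obtain ⟨f, hf⟩ := h'
  exact ⟨fun x => TensorProduct.congr (e x) (f x), fun x y a v =>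
    TensorAux.congr_nat (e x) (e y) (f x) (f y) _ _ _ _ (he x y a) (hf x y a) v⟩

instance : Zero (IsoClass k Q) := ⟨Quotient.mk _ (zero k Q)⟩

instance : One (IsoClass k Q) := ⟨Quotient.mk _ (unit k Q)⟩

instance : Add (IsoClass k Q) := ⟨Quotient.map₂ sum fun _ _ h _ _ h' => sum_congr h h'⟩

noncomputable instance : Mul (IsoClass k Q) :=
  ⟨Quotient.map₂ tensor fun _ _ h _ _ h' => tensor_congr h h'⟩

/-- The semiring of isomorphism classes: addition is the direct sum, multiplication the tensor
product. -/
noncomputable instance : CommSemiring (IsoClass k Q) where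
  nsmul := nsmulRec
  npow := npowRec
  add_assoc := by
    rintro ⟨U⟩ ⟨V⟩ ⟨W⟩
    exact Quotient.sound ⟨fun _ => LinearEquiv.prodAssoc k _ _ _, fun _ _ _ _ => rfl⟩
  zero_add := by
    rintro ⟨V⟩
    exact Quotient.sound ⟨fun _ => LinearEquiv.uniqueProd (M₂ := PUnit.{u + 1}), fun _ _ _ _ => rfl⟩
  add_zero := by
    rintro ⟨V⟩
    exact Quotient.sound ⟨fun _ => LinearEquiv.prodUnique (M₂ := PUnit.{u + 1}), fun _ _ _ _ => rfl⟩
  add_comm := by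
    rintro ⟨V⟩ ⟨W⟩
    exact Quotient.sound ⟨fun _ => LinearEquiv.prodComm k _ _, fun _ _ _ _ => rfl⟩
  mul_assoc := by
    rintro ⟨U⟩ ⟨V⟩ ⟨W⟩
    exact Quotient.sound ⟨fun _ => TensorProduct.assoc k _ _ _,
      fun _ _ a v => TensorAux.assoc_nat (U.map a) (V.map a) (W.map a) v⟩
  mul_comm := by
    rintro ⟨V⟩ ⟨W⟩
    exact Quotient.sound ⟨fun _ => TensorProduct.comm k _ _,
      fun _ _ a v => TensorAux.comm_nat (V.map a) (W.map a) v⟩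
  one_mul := by
    rintro ⟨V⟩
    exact Quotient.sound ⟨fun _ => TensorProduct.lid k _,
      fun _ _ a v => TensorAux.lid_nat (V.map a) v⟩
  mul_one := by
    rintro ⟨V⟩
    exact Quotient.sound ⟨fun _ => TensorProduct.rid k _,
      fun _ _ a v => TensorAux.rid_nat (V.map a) v⟩
  left_distrib := by
    rintro ⟨U⟩ ⟨V⟩ ⟨W⟩
    exact Quotient.sound ⟨fun _ => TensorProduct.prodRight k k _ _ _,
      fun _ _ a v => TensorAux.prodRight_nat (U.map a) (V.map a) (W.map a) v⟩
  right_distrib := by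
    rintro ⟨U⟩ ⟨V⟩ ⟨W⟩
    exact Quotient.sound ⟨fun _ => TensorProduct.prodLeft k k _ _ _,
      fun _ _ a v => TensorAux.prodLeft_nat (U.map a) (V.map a) (W.map a) v⟩
  zero_mul := by
    rintro ⟨V⟩
    have (x : Q) : Subsingleton (PUnit.{u + 1} ⊗[k] V.obj x) := TensorAux.subsingleton_left
    exact Quotient.sound
      ⟨fun x => (0 : (PUnit.{u + 1} ⊗[k] V.obj x) ≃ₗ[k] PUnit.{u + 1}), fun _ _ _ _ => rfl⟩
  mul_zero := by
    rintro ⟨V⟩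
    have (x : Q) : Subsingleton (V.obj x ⊗[k] PUnit.{u + 1}) := TensorAux.subsingleton_right
    exact Quotient.sound
      ⟨fun x => (0 : (V.obj x ⊗[k] PUnit.{u + 1}) ≃ₗ[k] PUnit.{u + 1}), fun _ _ _ _ => rfl⟩

end QuiverRep

/-- The representation ring `R(Q)` of the quiver `Q` over `k`. -/
abbrev QuiverRepRing (k : Type u) [Field k] (Q : Type*) [Quiver Q] : Type _ :=
  GrothendieckRing (QuiverRep.IsoClass k Q)

namespace QuiverRepRing

variable {k : Type u} [Field k] {Q : Type*} [Quiver Q]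

/-- The element `[V]` of `R(Q)`. -/
noncomputable def cls (V : QuiverRep k Q) : QuiverRepRing k Q :=
  GrothendieckRing.of V.isoClass

theorem cls_sum (V W : QuiverRep k Q) : cls (V.sum W) = cls V + cls W :=
  map_add GrothendieckRing.of V.isoClass W.isoClass

theorem cls_tensor (V W : QuiverRep k Q) : cls (V.tensor W) = cls V * cls W :=
  GrothendieckRing.of_mul V.isoClass W.isoClass

end QuiverRepRing

/-! ## Quivers of extended Dynkin type `A`, strings and bands -/

/-- The vertices `a_0, …, a_n` of the quiver of type `Ã_n` with orientation `o`. There is one arrow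
`α_m` for each `m` modulo `n + 1`; it joins `a_m` and `a_{m+1}`, and is directed from `a_m` to
`a_{m+1}` if `o m = true`, from `a_{m+1}` to `a_m` if `o m = false`. -/
@[ext]
structure TypeATilde (n : ℕ) (o : ZMod (n + 1) → Bool) where
  /-- the index of the vertex, modulo `n + 1` -/
  idx : ZMod (n + 1)

namespace TypeATilde

variable {n : ℕ} (o : ZMod (n + 1) → Bool)

/-- The tail of the arrow `α_m`. -/
def tail (m : ZMod (n + 1)) : ZMod (n + 1) := if o m then m else m + 1

/-- The head of the arrow `α_m`. -/
def head (m : ZMod (n + 1)) : ZMod (n + 1) := if o m then m + 1 else m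

instance : Quiver (TypeATilde n o) where
  Hom x y := {m : ZMod (n + 1) // tail o m = x.idx ∧ head o m = y.idx}

/-- The index of the basis vector to which the arrow `α_m` sends `e_s`. -/
def next (m : ZMod (n + 1)) (s : ℤ) : ℤ := if o m then s + 1 else s - 1

theorem next_cast {m x y : ZMod (n + 1)} (h : tail o m = x ∧ head o m = y) {s : ℤ}
    (hs : (s : ZMod (n + 1)) = x) : ((next o m s : ℤ) : ZMod (n + 1)) = y := by
  obtain ⟨rfl, rfl⟩ := h
  unfold tail at hs
  unfold next head
  split_ifs at hs ⊢ <;> simp [hs]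

/-- The indices `s` with `i ≤ s ≤ j` and `s ≡ x` modulo `n + 1`. -/
abbrev StringIndex (n : ℕ) (i j : ℤ) (x : ZMod (n + 1)) : Type :=
  {s : ℤ // (i ≤ s ∧ s ≤ j) ∧ (s : ZMod (n + 1)) = x}

instance finite_stringIndex (n : ℕ) (i j : ℤ) (x : ZMod (n + 1)) : Finite (StringIndex n i j x) :=
  Set.Finite.subset (Set.finite_Icc i j) fun _ hs => hs.1

/-- The string `S(i,j)`: it has basis `e_i, …, e_j`, where `e_s` sits at the vertex `a_{s mod n+1}`,
and an arrow sends `e_s` to `e_{s+1}` or `e_{s-1}` according to its orientation (and to zero if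
this index does not lie between `i` and `j`). -/
noncomputable abbrev string (k : Type u) [Field k] (i j : ℤ) : QuiverRep k (TypeATilde n o) where
  obj x := StringIndex n i j x.idx →₀ k
  finite x :=
    have := finite_stringIndex n i j x.idx
    Module.Finite.of_basis (Finsupp.basisSingleOne (R := k) (ι := StringIndex n i j x.idx))
  map {x y} a := Finsupp.linearCombination k fun s : StringIndex n i j x.idx =>
    if h : i ≤ next o a.1 s ∧ next o a.1 s ≤ j then
      (Finsupp.single ⟨next o a.1 s, h, next_cast o a.2 s.2.2⟩ 1 : StringIndex n i j y.idx →₀ k)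
    else 0

theorem string_map_single (k : Type u) [Field k] (i j : ℤ) {x y : TypeATilde n o} (a : x ⟶ y)
    (s : StringIndex n i j x.idx) (h : i ≤ next o a.1 s ∧ next o a.1 s ≤ j) :
    (string o k i j).map a (Finsupp.single s 1) =
      Finsupp.single ⟨next o a.1 s, h, next_cast o a.2 s.2.2⟩ 1 := by
  simp [h]

/-- The band `B_f(s)`, for `f ≠ 0`: it has `k[X]/(f^s)` at every vertex, the arrow `α_n` acts as
multiplication by `X`, and all other arrows act as the identity. -/
noncomputable abbrev band {k : Type u} [Field k] (f : k[X]) (hf : f ≠ 0) (s : ℕ) :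
    QuiverRep k (TypeATilde n o) where
  obj _ := AdjoinRoot (f ^ s)
  finite _ := (AdjoinRoot.powerBasis (pow_ne_zero s hf)).finite
  map a := if a.1 = (n : ZMod (n + 1)) then LinearMap.mulLeft k (AdjoinRoot.root (f ^ s))
    else LinearMap.id

/-- The `ℤ`-span `I_n` of all strings `[S(i,j)]`, `i ≤ j`, in `R(Q)`. -/
noncomputable abbrev stringSpan (k : Type u) [Field k] :
    Submodule ℤ (QuiverRepRing k (TypeATilde n o)) :=
  Submodule.span ℤ {r | ∃ i j : ℤ, i ≤ j ∧ r = QuiverRepRing.cls (string o k i j)}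

/-- The `ℤ`-span of all bands `[B_f(s)]`, `s ≥ 1`, `f` irreducible and monic, `f(0) ≠ 0`. -/
noncomputable def bandSpan (k : Type u) [Field k] :
    Submodule ℤ (QuiverRepRing k (TypeATilde n o)) :=
  Submodule.span ℤ {r | ∃ (f : k[X]) (hf : Irreducible f) (s : ℕ), f.Monic ∧ f.eval 0 ≠ 0 ∧
    0 < s ∧ r = QuiverRepRing.cls (band o f hf.ne_zero s)}

end TypeATilde

/-! ## The ring `A ⊕ I` -/

/-- For an ideal `I` of a commutative ring `S` and a ring homomorphism `ε : A → ℤ`, the abelian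
group `A ⊕ I`, with the ring structure for which `A` is a subring, `I` is an ideal with the
multiplication of `S`, and `a * w = ε(a) w` for `a ∈ A`, `w ∈ I`. -/
@[nolint unusedArguments]
def RingPlusIdeal {A S : Type*} [CommRing A] [CommRing S] (_ε : A →+* ℤ) (I : Ideal S) : Type _ :=
  A × I

namespace RingPlusIdeal

variable {A S : Type*} [CommRing A] [CommRing S] {ε : A →+* ℤ} {I : Ideal S}

/-- The element `a + w` of `A ⊕ I`. -/
def mk (ε : A →+* ℤ) (a : A) (w : I) : RingPlusIdeal ε I := (a, w)

instance : AddCommGroup (RingPlusIdeal ε I) := inferInstanceAs (AddCommGroup (A × I))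

/-- The product `(a + w)(b + v) = ab + (ε(a) v + ε(b) w + w v)`. -/
instance : Mul (RingPlusIdeal ε I) :=
  ⟨fun x y => mk ε (x.1 * y.1) (ε x.1 • y.2 + ε y.1 • x.2 + (x.2 : S) • y.2)⟩

instance : One (RingPlusIdeal ε I) := ⟨mk ε 1 0⟩

theorem mk_mul_mk (a b : A) (w v : I) :
    mk ε a w * mk ε b v = mk ε (a * b) (ε a • v + ε b • w + (w : S) • v) := rfl

theorem ext' {x y : RingPlusIdeal ε I} (h1 : x.1 = y.1) (h2 : (x.2 : S) = y.2) : x = y :=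
  Prod.ext h1 (Subtype.ext h2)

instance : CommRing (RingPlusIdeal ε I) :=
  have add1 : ∀ x y : RingPlusIdeal ε I, (x + y).1 = x.1 + y.1 := fun _ _ => rfl
  have add2 : ∀ x y : RingPlusIdeal ε I, ((x + y).2 : S) = x.2 + y.2 := fun _ _ => rfl
  have mul1 : ∀ x y : RingPlusIdeal ε I, (x * y).1 = x.1 * y.1 := fun _ _ => rfl
  have mul2 : ∀ x y : RingPlusIdeal ε I, ((x * y).2 : S) =
      (ε x.1 : S) * y.2 + (ε y.1 : S) * x.2 + x.2 * y.2 := fun x y => by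
    change ((ε x.1 • y.2 + ε y.1 • x.2 + (x.2 : S) • y.2 : I) : S) = _
    simp
  have one1 : (1 : RingPlusIdeal ε I).1 = 1 := rfl
  have one2 : ((1 : RingPlusIdeal ε I).2 : S) = 0 := rfl
  have zero1 : (0 : RingPlusIdeal ε I).1 = 0 := rfl
  have zero2 : ((0 : RingPlusIdeal ε I).2 : S) = 0 := rfl
  { (inferInstance : AddCommGroup (RingPlusIdeal ε I)) with
    mul := (· * ·)
    one := 1
    left_distrib := fun x y z => ext' (by simp only [add1, mul1]; ring)
      (by simp only [add1, add2, mul2, map_add, Int.cast_add]; ring)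
    right_distrib := fun x y z => ext' (by simp only [add1, mul1]; ring)
      (by simp only [add1, add2, mul2, map_add, Int.cast_add]; ring)
    zero_mul := fun x => ext' (by simp [mul1, zero1]) (by simp [mul2, zero1, zero2])
    mul_zero := fun x => ext' (by simp [mul1, zero1]) (by simp [mul2, zero1, zero2])
    mul_assoc := fun x y z => ext' (by simp only [mul1]; ring)
      (by simp only [mul1, mul2, map_mul, Int.cast_mul]; ring)
    one_mul := fun x => ext' (by simp [mul1, one1]) (by simp [mul2, one1, one2])
    mul_one := fun x => ext' (by simp [mul1, one1]) (by simp [mul2, one1, one2])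
    mul_comm := fun x y => ext' (by simp only [mul1]; ring) (by simp only [mul2]; ring) }

end RingPlusIdeal

/-- For subrings `P`, `P'` of a ring `R` with a homomorphism `d : R → ℤ`, the ring homomorphism
`P ⊗ P' → ℤ`, `a ⊗ b ↦ d(a) d(b)`. -/
noncomputable def tensorDim {R : Type*} [CommRing R] (d : R →+* ℤ) (P P' : Subring R) :
    P ⊗[ℤ] P' →+* ℤ :=
  (Algebra.TensorProduct.lift (d.comp P.subtype).toIntAlgHom (d.comp P'.subtype).toIntAlgHom
    fun _ _ => Commute.all _ _).toRingHom

theorem tensorDim_tmul {R : Type*} [CommRing R] (d : R →+* ℤ) (P P' : Subring R) (a : P)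
    (b : P') : tensorDim d P P' (a ⊗ₜ b) = d a * d b := by
  simp [tensorDim]

/-!
The functor that sends a `k[X]`-module `A` to the representation of `Q` with the space `A` at every
vertex, on which `α_n` acts as `X` and all other arrows act as the identity, respects direct sums
and tensor products. It gives a ring homomorphism `ofPolyHom : R → R(Q)` that sends `[k[X]/(f^s)]` to
the band `B_f(s)`. The isomorphism is `(x, w) ↦ ofPolyHom (mulMap x) + w`, where `mulMap` is the
multiplication map `R' ⊗ R̄ → R`. Three things have to be known.

*The map `mulMap` is injective, with image the span of the classes `[k[X]/(f^s)]`, `f(0) ≠ 0`.* Over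
a perfect field `k[X]/(X-1)^s ⊗ k[X]/(f) ≅ k[X]/(f^s)` (`PolyModule.unipotent_tensor_simple`), since
Taylor expansion at a simple root of `f` shows that the minimal polynomial of the tensor product is
`f^s`. So `mulMap` sends generators of `R' ⊗ R̄` to the classes `[k[X]/(f^s)]`, which are linearly
independent because the functionals `V ↦ rank f^t` separate them. That `R'` and `R̄` are subrings
holds because unipotent operators are closed under tensor products, and so are semisimple ones over
a perfect field.

*Every representation is the direct sum of an invertible one, on which all arrows are bijective, and
of strings* (`exists_decomposition`). An invertible representation is determined by its monodromy,
hence comes from a `k[X]`-module (`exists_iso_ofPoly`). If some arrow is not bijective, a string can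
be split off: on the universal cover, the line with positions in `ℤ`, the arrows are linear relations
between neighbouring spaces. By duality of such relations, a jump in the filtration by the vectors
that extend to the left gives a string `S` with morphisms `S → V → S` whose composite is unitriangular.
Without any jump, finite dimension and periodicity force all arrows to be bijective
(`endKer_le_endIm`, `exists_stringPair`).

*The invertible summand is unique, and strings form an ideal on which bands act through their
dimension.* Strings, and their tensor products with arbitrary representations, are graded by the
positions on the universal cover (`Grading`). A composite `U → P → U` with `U` invertible and `P`
graded is zero, as its homogeneous components are conjugate to each other and almost all of them
vanish (`Grading.avoidsInvertible`). Consequently a graded representation is a sum of strings, which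
gives the ideal property, and in `U ⊕ P ≅ U' ⊕ P'` one has `U ≅ U'`
(`QuiverRep.iso_of_sum_iso`), which makes the invertible summand an additive invariant
`invertiblePart : R(Q) → R` and so proves injectivity. Finally, on a graded representation the
monodromy of an invertible factor can be trivialized (`Grading.tensor_ofPoly_iso`), so that only the
dimension of the factor matters.
-/

namespace PolyModule

variable {k : Type u} [Field k]

theorem isoClass_eq {V W : PolyModule k} (h : Iso V W) : V.isoClass = W.isoClass :=
  Quotient.sound h

theorem iso_of_isoClass_eq {V W : PolyModule k} (h : V.isoClass = W.isoClass) : Iso V W :=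
  Quotient.exact h

/-! ### Decomposition of `k[X]`-modules into cyclic modules -/

/-- The direct sum of a finite family of modules. -/
abbrev pi {m : ℕ} (A : Fin m → PolyModule k) : PolyModule k where
  carrier := ∀ i, (A i).carrier
  op := LinearMap.pi fun i => (A i).op ∘ₗ LinearMap.proj i

theorem isoClass_pi {m : ℕ} (A : Fin m → PolyModule k) :
    (pi A).isoClass = ∑ i, (A i).isoClass := by
  induction m with
  | zero =>
    rw [Fin.sum_univ_zero]
    exact Quotient.sound ⟨(0 : (∀ i, (A i).carrier) ≃ₗ[k] PUnit.{u + 1}), fun _ => rfl⟩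
  | succ m ih =>
    rw [Fin.sum_univ_succ, ← ih]
    exact Quotient.sound ⟨(Fin.consLinearEquiv k fun i => (A i).carrier).symm, fun _ => rfl⟩

theorem quot_congr {f g : k[X]} (hf : f ≠ 0) (hg : g ≠ 0) (h : f = g) :
    (quot f hf).isoClass = (quot g hg).isoClass := by
  subst h
  rfl

theorem quot_congr_associated {f g : k[X]} (hf : f ≠ 0) (hg : g ≠ 0) (h : Associated f g) :
    (quot f hf).isoClass = (quot g hg).isoClass :=
  isoClass_eq ⟨(AdjoinRoot.algEquivOfAssociated k f g h).toLinearEquiv, fun v => by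
    simp⟩

theorem iso_pi_of_aeval_equiv (A : PolyModule k) {m : ℕ} (g : Fin m → k[X]) (hg : ∀ i, g i ≠ 0)
    (e : Module.AEval' A.op ≃ₗ[k[X]] (∀ i, k[X] ⧸ Submodule.span k[X] {g i})) :
    Iso A (pi fun i => quot (g i) (hg i)) := by
  have hsmul (r : k[X]) (i : Fin m) (x : k[X] ⧸ Submodule.span k[X] {g i}) :
      r • x = (AdjoinRoot.mk (g i) r * (show AdjoinRoot (g i) from x) : AdjoinRoot (g i)) := by
    obtain ⟨y, rfl⟩ := Submodule.Quotient.mk_surjective _ x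
    exact (map_mul (AdjoinRoot.mk (g i)) r y)
  refine ⟨LinearEquiv.ofBijective
    { toFun := fun v i => (e (Module.AEval'.of A.op v) i : k[X] ⧸ Submodule.span k[X] {g i})
      map_add' := fun v w => by
        rw [map_add, map_add]
      map_smul' := fun c v => ?_ } ⟨?_, ?_⟩, fun v => ?_⟩
  · funext i
    have : Module.AEval'.of A.op (c • v) = (C c : k[X]) • Module.AEval'.of A.op v := by
      rw [Module.AEval.C_smul, map_smul]
    rw [this, map_smul]
    refine (hsmul (C c) i _).trans ?_
    rw [AdjoinRoot.mk_C, ← AdjoinRoot.algebraMap_eq, ← Algebra.smul_def]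
    rfl
  · intro v w h
    exact (Module.AEval'.of A.op).injective (e.injective h)
  · intro w
    refine ⟨(Module.AEval'.of A.op).symm (e.symm w), ?_⟩
    funext i
    change e (Module.AEval'.of A.op ((Module.AEval'.of A.op).symm (e.symm w))) i = w i
    rw [LinearEquiv.apply_symm_apply, LinearEquiv.apply_symm_apply]
  · funext i
    change e (Module.AEval'.of A.op (A.op v)) i = _
    rw [← Module.AEval'.X_smul_of, map_smul]
    exact hsmul X i _

theorem aeval_op_quot (f : k[X]) (hf : f ≠ 0) (q : k[X]) :
    aeval (quot f hf).op q = LinearMap.mulLeft k (AdjoinRoot.mk f q) := by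
  have : (quot f hf).op = Algebra.lmul k (AdjoinRoot f) (AdjoinRoot.root f) := rfl
  rw [this, aeval_algHom_apply, AdjoinRoot.aeval_eq]
  rfl

theorem aeval_op_comm {V W : PolyModule k} (φ : V.carrier →ₗ[k] W.carrier)
    (h : ∀ v, φ (V.op v) = W.op (φ v)) (q : k[X]) (v : V.carrier) :
    φ (aeval V.op q v) = aeval W.op q (φ v) := by
  induction q using Polynomial.induction_on' generalizing v with
  | add p q hp hq => simp only [map_add, LinearMap.add_apply, hp, hq]
  | monomial n a =>
    have key (v) : φ ((V.op ^ n) v) = (W.op ^ n) (φ v) := by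
      induction n generalizing v with
      | zero => simp
      | succ n ih => simp [pow_succ, ih, h]
    simp [aeval_monomial, Module.algebraMap_end_apply, key]

/-- A module annihilated by `q` is a direct sum of modules `k[X]/(p^e)` with `p^e ∣ q`. This single
statement decomposes invertible, unipotent and semisimple modules, through the choice of `q`. -/
theorem isoClass_mem_closure (A : PolyModule k) (q : k[X]) (hq : aeval A.op q = 0) :
    A.isoClass ∈ AddSubmonoid.closure {c : IsoClass k | ∃ (p : k[X]) (hp : Irreducible p) (e : ℕ),
      p.Monic ∧ 0 < e ∧ p ^ e ∣ q ∧ c = (quot (p ^ e) (pow_ne_zero e hp.ne_zero)).isoClass} := by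
  classical
  obtain ⟨ι, _, p, hp, e, ⟨φ⟩⟩ := Module.equiv_directSum_of_isTorsion
    (Module.AEval.isTorsion_of_finiteDimensional k A.carrier A.op)
  let σ := (Fintype.equivFin ι).symm
  have hne : ∀ i, p i ^ e i ≠ 0 := fun i => pow_ne_zero _ (hp i).ne_zero
  let φ' := φ ≪≫ₗ DirectSum.linearEquivFunOnFintype k[X] ι _ ≪≫ₗ
    (LinearEquiv.piCongrLeft k[X] (fun i => k[X] ⧸ Submodule.span k[X] {p i ^ e i}) σ).symm
  have hiso := iso_pi_of_aeval_equiv A (fun j => p (σ j) ^ e (σ j)) (fun j => hne _) φ'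
  rw [isoClass_eq hiso, isoClass_pi]
  refine AddSubmonoid.sum_mem _ fun j _ => ?_
  have hdvd : p (σ j) ^ e (σ j) ∣ q := by
    obtain ⟨ψ, hψ⟩ := hiso
    let w : ∀ j, (quot (p (σ j) ^ e (σ j)) (hne _)).carrier :=
      Pi.single j (1 : AdjoinRoot (p (σ j) ^ e (σ j)))
    have h1 := aeval_op_comm (V := A) (W := quot (p (σ j) ^ e (σ j)) (hne _))
      (LinearMap.proj j ∘ₗ ψ.toLinearMap) (fun v => congr_fun (hψ v) j) q (ψ.symm w)
    rw [hq, aeval_op_quot] at h1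
    simpa [w, AdjoinRoot.mk_eq_zero] using h1.symm
  rcases Nat.eq_zero_or_pos (e (σ j)) with h0 | h0
  · convert AddSubmonoid.zero_mem _
    have : Subsingleton (AdjoinRoot (p (σ j) ^ e (σ j))) := by
      rw [h0, pow_zero]
      exact Ideal.Quotient.subsingleton_iff.mpr Ideal.span_singleton_one
    exact Quotient.sound ⟨(0 : AdjoinRoot (p (σ j) ^ e (σ j)) ≃ₗ[k] PUnit.{u + 1}), fun _ => rfl⟩
  · have hass : Associated (p (σ j)) (normalize (p (σ j))) := (normalize_associated _).symm
    have hirr := hass.irreducible (hp _)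
    refine AddSubmonoid.subset_closure ⟨normalize (p (σ j)), hirr, e (σ j),
      monic_normalize (hp _).ne_zero, h0, ?_, ?_⟩
    · exact (hass.pow_pow.dvd_iff_dvd_left).mp hdvd
    · exact quot_congr_associated _ _ hass.pow_pow

/-! ### Tensor products of cyclic modules -/

theorem aeval_mulLeft {B : Type*} [CommRing B] [Algebra k B] (z : B) (q : k[X]) :
    aeval (LinearMap.mulLeft k z) q = LinearMap.mulLeft k (aeval z q) :=
  aeval_algHom_apply (Algebra.lmul k B) z q

theorem tensor_quot_op (f g : k[X]) (hf : f ≠ 0) (hg : g ≠ 0) :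
    (tensor (quot f hf) (quot g hg)).op =
      LinearMap.mulLeft k (AdjoinRoot.root f ⊗ₜ[k] AdjoinRoot.root g) := by
  refine TensorProduct.ext' fun a b => ?_
  exact (Algebra.TensorProduct.tmul_mul_tmul ..).symm

/-- If multiplication by `z` on a finite-dimensional algebra `V` has minimal polynomial `q` of the
maximal degree `dim V`, then `V` is the cyclic module `k[X]/(q)`. -/
theorem iso_quot_of_mulLeft {B : Type u} [CommRing B] [Algebra k B] [Module.Finite k B] (z : B)
    (q : k[X]) (hq : q ≠ 0) (h0 : aeval z q = 0) (hdvd : ∀ r : k[X], aeval z r = 0 → q ∣ r)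
    (hrank : Module.finrank k B = q.natDegree) :
    Iso (quot q hq) { carrier := B, op := LinearMap.mulLeft k z } := by
  let φ : AdjoinRoot q →ₐ[k] B := AdjoinRoot.liftAlgHom q (Algebra.ofId k B) z h0
  have hφ : Function.Injective φ := by
    rw [injective_iff_map_eq_zero]
    intro a ha
    obtain ⟨r, rfl⟩ := AdjoinRoot.mk_surjective a
    exact AdjoinRoot.mk_eq_zero.mpr (hdvd r ha)
  have hfin : Module.Finite k (AdjoinRoot q) := (AdjoinRoot.powerBasis hq).finite
  have hr : Module.finrank k (AdjoinRoot q) = Module.finrank k B := by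
    rw [hrank, (AdjoinRoot.powerBasis hq).finrank, AdjoinRoot.powerBasis_dim]
  refine ⟨LinearEquiv.ofBijective φ.toLinearMap
    ⟨hφ, (LinearMap.injective_iff_surjective_of_finrank_eq_finrank hr).mp hφ⟩, fun v => ?_⟩
  change φ (AdjoinRoot.root q * v) = z * φ v
  rw [map_mul]
  congr 1
  exact AdjoinRoot.liftAlgHom_root ..

theorem finrank_quot (q : k[X]) (hq : q ≠ 0) :
    Module.finrank k (AdjoinRoot q) = q.natDegree := by
  rw [(AdjoinRoot.powerBasis hq).finrank, AdjoinRoot.powerBasis_dim]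

theorem root_ne_zero {f : k[X]} (hf : Irreducible f) (h0 : f.eval 0 ≠ 0) :
    AdjoinRoot.root f ≠ 0 := by
  intro h
  have : f ∣ X := AdjoinRoot.mk_eq_zero.mp h
  have h2 := (hf.dvd_irreducible_iff_associated irreducible_X).mp this
  exact h0 (by
    obtain ⟨g, hg⟩ := h2.dvd'
    simp [hg])

/-- In `A ⊗ K` put `z = x ⊗ y` and `ν = (x - 1) ⊗ y`, which is nilpotent of order exactly `s`. If `y`
is a simple root of `f`, Taylor expansion at `1 ⊗ y = z - ν` gives `f(z) = ν * unit`. -/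
theorem aeval_tmul_pow_eq_zero_iff {A K : Type*} [CommRing A] [CommRing K] [Algebra k A]
    [Algebra k K] [Nontrivial K] (x : A) (y : K) (s : ℕ) (f : k[X])
    (hx : ∀ t, (x - 1) ^ t = 0 ↔ s ≤ t) (hy : IsUnit y) (hy0 : aeval y f = 0)
    (hy1 : IsUnit (aeval y (derivative f))) (t : ℕ) :
    aeval (x ⊗ₜ[k] y) (f ^ t) = 0 ↔ s ≤ t := by
  have hν (t : ℕ) : ((x - 1) ⊗ₜ[k] y) ^ t = 0 ↔ s ≤ t := by
    rw [Algebra.TensorProduct.tmul_pow, ← hx]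
    constructor
    · intro h
      obtain ⟨c, hc⟩ := (hy.pow t).exists_right_inv
      have h2 : ((x - 1) ^ t) ⊗ₜ[k] (1 : K) = 0 := by
        rw [← hc, ← mul_one ((x - 1) ^ t), ← Algebra.TensorProduct.tmul_mul_tmul, h, zero_mul]
      exact Algebra.TensorProduct.includeLeft_injective (S := k)
        (algebraMap k K).injective (h2.trans (map_zero _).symm)
    · intro h
      rw [h, TensorProduct.zero_tmul]
  have hunit : ∃ w : A ⊗[k] K, IsUnit w ∧ aeval (x ⊗ₜ[k] y) f = ((x - 1) ⊗ₜ[k] y) * w := by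
    have hι (q : k[X]) : aeval ((1 : A) ⊗ₜ[k] y) q = (1 : A) ⊗ₜ[k] aeval y q :=
      aeval_algHom_apply (Algebra.TensorProduct.includeRight : K →ₐ[k] A ⊗[k] K) y q
    have hz : x ⊗ₜ[k] y = (1 : A) ⊗ₜ[k] y + (x - 1) ⊗ₜ[k] y := by
      rw [← TensorProduct.add_tmul, add_sub_cancel]
    obtain ⟨c, hc⟩ := (f.map (algebraMap k (A ⊗[k] K))).binomExpansion ((1 : A) ⊗ₜ[k] y)
      ((x - 1) ⊗ₜ[k] y)
    have hu : IsUnit (aeval ((1 : A) ⊗ₜ[k] y) (derivative f)) := by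
      rw [hι]
      exact hy1.map (Algebra.TensorProduct.includeRight : K →ₐ[k] A ⊗[k] K)
    have hnil : IsNilpotent (c * ((x - 1) ⊗ₜ[k] y)) :=
      (Commute.all c _).isNilpotent_mul_left ⟨s, (hν s).mpr le_rfl⟩
    refine ⟨aeval ((1 : A) ⊗ₜ[k] y) (derivative f) + c * ((x - 1) ⊗ₜ[k] y),
      hnil.isUnit_add_left_of_commute hu (Commute.all _ _), ?_⟩
    have h2 : aeval ((1 : A) ⊗ₜ[k] y) f = 0 := by
      rw [hι, hy0, TensorProduct.tmul_zero]
    rw [hz, aeval_def, ← eval_map, hc, derivative_map, eval_map, eval_map, ← aeval_def, ← aeval_def,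
      h2]
    ring
  obtain ⟨w, hw, hfz⟩ := hunit
  rw [map_pow, hfz, mul_pow, (hw.pow t).mul_left_eq_zero, hν]

theorem root_sub_one_pow (s t : ℕ) :
    (AdjoinRoot.root ((X - C (1 : k)) ^ s) - 1) ^ t = 0 ↔ s ≤ t := by
  have : (AdjoinRoot.root ((X - C (1 : k)) ^ s) - 1) ^ t =
      AdjoinRoot.mk ((X - C (1 : k)) ^ s) ((X - C 1) ^ t) := by simp [AdjoinRoot.mk_X]
  rw [this, AdjoinRoot.mk_eq_zero]
  exact pow_dvd_pow_iff (X_sub_C_ne_zero 1) (not_isUnit_X_sub_C 1)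

/-- Over a perfect field `k[X]/(X-1)^s ⊗ k[X]/(f) ≅ k[X]/(f^s)`: the minimal polynomial of
`x ⊗ y` divides `f^s` but not `f^(s-1)`. -/
theorem unipotent_tensor_simple [PerfectField k] (f : k[X]) (hf : Irreducible f)
    (h0 : f.eval 0 ≠ 0) (s : ℕ) :
    Iso (quot (f ^ s) (pow_ne_zero s hf.ne_zero))
      (tensor (quot ((X - C (1 : k)) ^ s) (pow_ne_zero s (X_sub_C_ne_zero 1)))
        (quot f hf.ne_zero)) := by
  have hg : (X - C (1 : k)) ^ s ≠ 0 := pow_ne_zero s (X_sub_C_ne_zero 1)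
  have fin1 : Module.Finite k (AdjoinRoot ((X - C (1 : k)) ^ s)) := (AdjoinRoot.powerBasis hg).finite
  have fin2 : Module.Finite k (AdjoinRoot f) := (AdjoinRoot.powerBasis hf.ne_zero).finite
  have hunits : IsUnit (AdjoinRoot.root f) ∧ IsUnit (aeval (AdjoinRoot.root f) (derivative f)) := by
    have : Fact (Irreducible f) := ⟨hf⟩
    refine ⟨(root_ne_zero hf h0).isUnit, IsUnit.mk0 _ ?_⟩
    exact (PerfectField.separable_of_irreducible hf).aeval_derivative_ne_zero
      (x := AdjoinRoot.root f) (by rw [AdjoinRoot.aeval_eq, AdjoinRoot.mk_self])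
  have : Nontrivial (AdjoinRoot f) := AdjoinRoot.nontrivial f (degree_pos_of_irreducible hf).ne'
  have hpow := aeval_tmul_pow_eq_zero_iff (k := k) (AdjoinRoot.root ((X - C (1 : k)) ^ s))
    (AdjoinRoot.root f) s f (root_sub_one_pow s) hunits.1
    (by rw [AdjoinRoot.aeval_eq, AdjoinRoot.mk_self]) hunits.2
  have key : ∀ r : k[X], aeval (AdjoinRoot.root ((X - C (1 : k)) ^ s) ⊗ₜ[k] AdjoinRoot.root f) r = 0 →
      f ^ s ∣ r := by
    intro r hr
    have hm := minpoly.dvd k _ ((hpow s).mpr le_rfl)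
    obtain ⟨i, hi, hass⟩ := (dvd_prime_pow hf.prime s).mp hm
    have : s ≤ i := (hpow i).mp (by
      obtain ⟨c, hc⟩ := hass.dvd
      rw [hc, map_mul, minpoly.aeval, zero_mul])
    exact ((pow_dvd_pow f this).trans hass.dvd').trans (minpoly.dvd k _ hr)
  have hrank : Module.finrank k (AdjoinRoot ((X - C (1 : k)) ^ s) ⊗[k] AdjoinRoot f) =
      (f ^ s).natDegree := by
    rw [Module.finrank_tensorProduct, finrank_quot _ hg, finrank_quot f hf.ne_zero,
      natDegree_pow, natDegree_pow, natDegree_X_sub_C, mul_one]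
  obtain ⟨e, he⟩ := iso_quot_of_mulLeft _ (f ^ s) (pow_ne_zero s hf.ne_zero)
    ((hpow s).mpr le_rfl) key hrank
  refine ⟨e, fun v => ?_⟩
  rw [tensor_quot_op]
  exact he v

theorem tmul_sub_one_pow {A K : Type*} [CommRing A] [CommRing K] [Algebra k A] [Algebra k K]
    (x : A) (y : K) (s t : ℕ) (hx : (x - 1) ^ s = 0) (hy : (y - 1) ^ t = 0) :
    (x ⊗ₜ[k] y - 1) ^ (s + t) = 0 := by
  have hsum : x ⊗ₜ[k] y - 1 = (x - 1) ⊗ₜ[k] y + (1 : A) ⊗ₜ[k] (y - 1) := by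
    rw [TensorProduct.sub_tmul, TensorProduct.tmul_sub, Algebra.TensorProduct.one_def]
    abel
  rw [hsum]
  refine (Commute.all _ _).add_pow_eq_zero_of_add_le_succ_of_pow_eq_zero (m := s) (n := t)
    ?_ ?_ (by omega)
  · rw [Algebra.TensorProduct.tmul_pow, hx, TensorProduct.zero_tmul]
  · rw [Algebra.TensorProduct.tmul_pow, hy, TensorProduct.tmul_zero]

theorem unipotent_tensor_unipotent (s t : ℕ) :
    aeval (tensor (quot ((X - C (1 : k)) ^ s) (pow_ne_zero s (X_sub_C_ne_zero 1)))
      (quot ((X - C (1 : k)) ^ t) (pow_ne_zero t (X_sub_C_ne_zero 1)))).op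
      ((X - C (1 : k)) ^ (s + t)) = 0 := by
  rw [tensor_quot_op]
  refine (aeval_mulLeft _ _).trans ?_
  have := tmul_sub_one_pow (k := k) _ _ s t ((root_sub_one_pow (k := k) s s).mpr le_rfl)
    ((root_sub_one_pow (k := k) t t).mpr le_rfl)
  rw [map_pow, map_sub, aeval_X, aeval_C]
  simp only [map_one] at this ⊢
  erw [this]
  exact LinearMap.mulLeft_zero_eq_zero ..

theorem isSemisimple_quot [PerfectField k] (f : k[X]) (hf : Irreducible f) :
    Module.End.IsSemisimple (quot f hf.ne_zero).op := by
  refine Module.End.isSemisimple_of_squarefree_aeval_eq_zero (p := f) hf.squarefree ?_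
  rw [aeval_op_quot, AdjoinRoot.mk_self]
  exact LinearMap.mulLeft_zero_eq_zero ..

theorem aeval_map_left {V W : Type*} [AddCommGroup V] [AddCommGroup W] [Module k V] [Module k W]
    (S : Module.End k V) (q : k[X]) :
    aeval (TensorProduct.map S (LinearMap.id : W →ₗ[k] W) : Module.End k (V ⊗[k] W)) q =
      TensorProduct.map (aeval S q) LinearMap.id :=
  aeval_algHom_apply (Module.End.rTensorAlgHom (R := k) (M := V) (N := W)) S q

theorem aeval_map_right {V W : Type*} [AddCommGroup V] [AddCommGroup W] [Module k V] [Module k W]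
    (S : Module.End k W) (q : k[X]) :
    aeval (TensorProduct.map (LinearMap.id : V →ₗ[k] V) S : Module.End k (V ⊗[k] W)) q =
      TensorProduct.map LinearMap.id (aeval S q) :=
  aeval_algHom_apply (Module.End.lTensorAlgHom (R := k) (M := W) (N := V)) S q

/-- Over a perfect field the tensor product of two semisimple modules is semisimple, being given by
a product of two commuting semisimple operators. -/
theorem isSemisimple_tensor [PerfectField k] (V W : PolyModule k)
    (hV : Module.End.IsSemisimple V.op) (hW : Module.End.IsSemisimple W.op) :
    Module.End.IsSemisimple (tensor V W).op := by
  have h1 : Module.End.IsSemisimple (TensorProduct.map V.op (LinearMap.id : W.carrier →ₗ[k] _) :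
      Module.End k (V.carrier ⊗[k] W.carrier)) := by
    refine Module.End.isSemisimple_of_squarefree_aeval_eq_zero hV.minpoly_squarefree ?_
    rw [aeval_map_left, minpoly.aeval, TensorProduct.map_zero_left]
  have h2 : Module.End.IsSemisimple (TensorProduct.map (LinearMap.id : V.carrier →ₗ[k] _) W.op :
      Module.End k (V.carrier ⊗[k] W.carrier)) := by
    refine Module.End.isSemisimple_of_squarefree_aeval_eq_zero hW.minpoly_squarefree ?_
    rw [aeval_map_right, minpoly.aeval, TensorProduct.map_zero_right]
  have hmul : (tensor V W).op = (TensorProduct.map V.op (LinearMap.id : W.carrier →ₗ[k] _) :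
      Module.End k (V.carrier ⊗[k] W.carrier)) *
      TensorProduct.map (LinearMap.id : V.carrier →ₗ[k] _) W.op := by
    ext a b
    rfl
  have hcomm : Commute (TensorProduct.map V.op (LinearMap.id : W.carrier →ₗ[k] _) :
      Module.End k (V.carrier ⊗[k] W.carrier))
      (TensorProduct.map (LinearMap.id : V.carrier →ₗ[k] _) W.op) := by
    ext a b
    rfl
  rw [hmul]
  exact h1.mul_of_commute hcomm h2

/-- The minimal polynomial of an injective operator has nonzero constant term. -/
theorem minpoly_eval_zero_ne_zero {V : Type*} [AddCommGroup V] [Module k V] [Module.Finite k V]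
    (T : Module.End k V) (hT : Function.Injective T) : (minpoly k T).eval 0 ≠ 0 := by
  intro h
  have hX : X ∣ minpoly k T := by
    rw [X_dvd_iff, coeff_zero_eq_eval_zero, h]
  obtain ⟨g, hg⟩ := hX
  have hg0 : g ≠ 0 := by
    rintro rfl
    exact minpoly.ne_zero (Algebra.IsIntegral.isIntegral (R := k) T) (by simpa using hg)
  have h1 : aeval T g = 0 := by
    ext v
    apply hT
    have := minpoly.aeval k T
    rw [hg, map_mul, aeval_X] at this
    simpa using LinearMap.congr_fun this v
  classical
  have h2 := minpoly.min k T (monic_normalize hg0) (by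
    have := (normalize_associated g).dvd'
    obtain ⟨c, hc⟩ := this
    rw [hc, map_mul, h1, zero_mul])
  rw [hg, mul_comm, degree_mul_X, degree_normalize, degree_eq_natDegree hg0] at h2
  exact absurd h2 (by exact_mod_cast Nat.not_succ_le_self _)

theorem injective_tensor (V W : PolyModule k) (hV : Function.Injective V.op)
    (hW : Function.Injective W.op) : Function.Injective (tensor V W).op :=
  TensorProduct.map_injective_of_flat_flat _ _ hV hW

end PolyModule

/-! ### The subrings of unipotent and of semisimple classes -/

namespace GrothendieckRing

theorem of_mem_of_closure {M : Type*} [CommSemiring M] (N : Submodule ℤ (GrothendieckRing M))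
    {S : Set M} (h : ∀ c ∈ S, of c ∈ N) {c : M} (hc : c ∈ AddSubmonoid.closure S) : of c ∈ N := by
  induction hc using AddSubmonoid.closure_induction with
  | mem c hc => exact h c hc
  | zero => rw [map_zero]; exact N.zero_mem
  | add a b _ _ ha hb => rw [map_add]; exact N.add_mem ha hb

end GrothendieckRing

/-- A `ℤ`-span that contains `1` and the products of its generators, as a subring. -/
def spanSubring {R : Type*} [CommRing R] (G : Set R) (h1 : (1 : R) ∈ Submodule.span ℤ G)
    (hmul : ∀ a ∈ G, ∀ b ∈ G, a * b ∈ Submodule.span ℤ G) : Subring R where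
  carrier := Submodule.span ℤ G
  one_mem' := h1
  zero_mem' := Submodule.zero_mem _
  add_mem' := Submodule.add_mem _
  neg_mem' := Submodule.neg_mem _
  mul_mem' {a b} ha hb := by
    have h : Submodule.span ℤ G * Submodule.span ℤ G ≤ Submodule.span ℤ G := by
      rw [Submodule.span_mul_span, Submodule.span_le]
      rintro _ ⟨a, ha, b, hb, rfl⟩
      exact hmul a ha b hb
    exact h (Submodule.mul_mem_mul ha hb)

namespace PolyRepRing

variable {k : Type u} [Field k]

theorem cls_eq {V W : PolyModule k} (h : PolyModule.Iso V W) : cls V = cls W :=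
  congrArg GrothendieckRing.of (PolyModule.isoClass_eq h)

theorem one_eq_cls_quot : (1 : PolyRepRing k) = cls (PolyModule.quot (X - C (1 : k))
    (X_sub_C_ne_zero 1)) := by
  refine (cls_eq ?_).symm
  obtain ⟨e, he⟩ := PolyModule.iso_quot_of_mulLeft (1 : k) (X - C (1 : k)) (X_sub_C_ne_zero 1)
    (by simp) (fun r hr => by
      rw [dvd_iff_isRoot, IsRoot.def, ← coe_aeval_eq_eval]
      exact hr) (by rw [natDegree_X_sub_C, Module.finrank_self])
  exact ⟨e, fun v => (he v).trans (one_mul _)⟩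

theorem one_eq_unipotent : (1 : PolyRepRing k) = unipotent k 1 :=
  one_eq_cls_quot.trans
    (congrArg GrothendieckRing.of (PolyModule.quot_congr _ _ (pow_one _).symm))

theorem one_eq_simple : (1 : PolyRepRing k) = simple (X - C (1 : k)) (irreducible_X_sub_C 1) :=
  one_eq_cls_quot

theorem eq_X_sub_one_of_pow_dvd {p : k[X]} (hp : Irreducible p) (hm : p.Monic) {e t : ℕ}
    (he : 0 < e) (h : p ^ e ∣ (X - C (1 : k)) ^ t) : p = X - C (1 : k) := by
  have h1 : p ∣ X - C (1 : k) := hp.prime.dvd_of_dvd_pow ((dvd_pow_self p he.ne').trans h)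
  exact eq_of_monic_of_associated hm (monic_X_sub_C 1)
    ((hp.dvd_irreducible_iff_associated (irreducible_X_sub_C 1)).mp h1)

/-- The subring `R'` of unipotent classes. -/
noncomputable def unipotentSubring (k : Type u) [Field k] : Subring (PolyRepRing k) :=
  spanSubring {r | ∃ s : ℕ, 0 < s ∧ r = unipotent k s}
    (Submodule.subset_span ⟨1, one_pos, one_eq_unipotent⟩) (by
      rintro _ ⟨s, hs, rfl⟩ _ ⟨t, ht, rfl⟩
      rw [unipotent, unipotent, ← cls_tensor]
      refine GrothendieckRing.of_mem_of_closure _ ?_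
        (PolyModule.isoClass_mem_closure _ _ (PolyModule.unipotent_tensor_unipotent s t))
      rintro _ ⟨p, hp, e, hm, he, hdvd, rfl⟩
      obtain rfl := eq_X_sub_one_of_pow_dvd hp hm he hdvd
      exact Submodule.subset_span ⟨e, he, rfl⟩)

theorem cls_mem_simpleSpan (V : PolyModule k) (hss : Module.End.IsSemisimple V.op)
    (hinj : Function.Injective V.op) : cls V ∈ simpleSpan k := by
  refine GrothendieckRing.of_mem_of_closure _ ?_
    (PolyModule.isoClass_mem_closure _ _ (minpoly.aeval k V.op))
  have h0 := PolyModule.minpoly_eval_zero_ne_zero _ hinj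
  rintro _ ⟨p, hp, e, hm, he, hdvd, rfl⟩
  -- The minimal polynomial of a semisimple operator is squarefree.
  have he1 : e = 1 := by
    by_contra hne
    refine hp.not_isUnit (hss.minpoly_squarefree p ?_)
    rw [← pow_two]
    exact (pow_dvd_pow p (by omega)).trans hdvd
  subst he1
  refine Submodule.subset_span ⟨p, hp, fun hp0 => h0 ?_,
    congrArg GrothendieckRing.of (PolyModule.quot_congr _ _ (pow_one _))⟩
  obtain ⟨c, hc⟩ := hdvd
  rw [hc, eval_mul, pow_one, hp0, zero_mul]

/-- The subring `R̄` of classes of invertible semisimple modules, over a perfect field. -/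
noncomputable def simpleSubring (k : Type u) [Field k] [PerfectField k] :
    Subring (PolyRepRing k) :=
  spanSubring {r | ∃ (f : k[X]) (hf : Irreducible f), f.eval 0 ≠ 0 ∧ r = simple f hf}
    (Submodule.subset_span ⟨_, irreducible_X_sub_C 1, by simp, one_eq_simple⟩) (by
      rintro _ ⟨f, hf, hf0, rfl⟩ _ ⟨g, hg, hg0, rfl⟩
      have hinj (f : k[X]) (hf : Irreducible f) (h0 : f.eval 0 ≠ 0) :
          Function.Injective (PolyModule.quot f hf.ne_zero).op := by
        have h1 : AdjoinRoot.root f ≠ 0 := PolyModule.root_ne_zero hf h0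
        have : Fact (Irreducible f) := ⟨hf⟩
        exact mul_right_injective₀ h1
      rw [simple, simple, ← cls_tensor]
      exact cls_mem_simpleSpan _
        (PolyModule.isSemisimple_tensor _ _ (PolyModule.isSemisimple_quot f hf)
          (PolyModule.isSemisimple_quot g hg))
        (PolyModule.injective_tensor _ _ (hinj f hf hf0) (hinj g hg hg0)))

theorem coe_unipotentSubring :
    (unipotentSubring k : Set (PolyRepRing k)) = unipotentSpan k := rfl

theorem coe_simpleSubring [PerfectField k] :
    (simpleSubring k : Set (PolyRepRing k)) = simpleSpan k := rfl

/-! ### Linear independence of the cyclic modules `k[X]/(f^s)` -/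

theorem finrank_submodule_prod {V W : Type*} [AddCommGroup V] [AddCommGroup W] [Module k V]
    [Module k W] [Module.Finite k V] [Module.Finite k W] (p : Submodule k V) (q : Submodule k W) :
    Module.finrank k (p.prod q) = Module.finrank k p + Module.finrank k q := by
  let e : p.prod q ≃ₗ[k] p × q :=
    { toFun := fun x => (⟨x.1.1, x.2.1⟩, ⟨x.1.2, x.2.2⟩)
      invFun := fun x => ⟨(x.1.1, x.2.1), x.1.2, x.2.2⟩
      map_add' := fun _ _ => rfl
      map_smul' := fun _ _ => rfl }
  rw [e.finrank_eq, Module.finrank_prod]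

/-- The additive invariant `[V] ↦ rank of q(X) on V`. -/
noncomputable def rankHom (q : k[X]) : PolyRepRing k →+ ℤ :=
  GrothendieckRing.liftAdd
    { toFun := Quotient.lift
        (fun V : PolyModule k => (Module.finrank k (LinearMap.range (aeval V.op q)) : ℤ))
        fun V W ⟨e, he⟩ => by
          have h : (LinearMap.range (aeval V.op q)).map e.toLinearMap =
              LinearMap.range (aeval W.op q) := by
            ext w
            simp only [Submodule.mem_map, LinearMap.mem_range, exists_exists_eq_and]
            constructor
            · rintro ⟨v, rfl⟩
              exact ⟨e v, (PolyModule.aeval_op_comm e.toLinearMap he q v).symm⟩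
            · rintro ⟨w, rfl⟩
              refine ⟨e.symm w, ?_⟩
              rw [PolyModule.aeval_op_comm e.toLinearMap he q]
              simp
          rw [← h]
          exact congrArg Nat.cast (LinearEquiv.finrank_eq (e.submoduleMap _))
      map_zero' := by
        change ((Module.finrank k (LinearMap.range (aeval (PolyModule.zero k).op q)) : ℕ) : ℤ) = 0
        rw [Module.finrank_zero_of_subsingleton, Nat.cast_zero]
      map_add' := by
        rintro ⟨V⟩ ⟨W⟩
        change ((Module.finrank k (LinearMap.range (aeval (PolyModule.sum V W).op q)) : ℕ) : ℤ) =
          (Module.finrank k (LinearMap.range (aeval V.op q)) : ℤ) +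
            (Module.finrank k (LinearMap.range (aeval W.op q)) : ℤ)
        have h : aeval (PolyModule.sum V W).op q = (aeval V.op q).prodMap (aeval W.op q) := by
          have := aeval_algHom_apply (LinearMap.prodMapAlgHom k V.carrier W.carrier)
            (V.op, W.op) q
          rw [aeval_prod] at this
          exact this
        rw [h, LinearMap.range_prodMap, finrank_submodule_prod, Nat.cast_add] }

theorem rankHom_cls (q : k[X]) (V : PolyModule k) :
    rankHom q (cls V) = (Module.finrank k (LinearMap.range (aeval V.op q)) : ℤ) :=
  GrothendieckRing.liftAdd_of _ _

theorem rankHom_quot (q f : k[X]) (hf : f ≠ 0) :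
    rankHom q (cls (PolyModule.quot f hf)) = (Module.finrank k (LinearMap.range
      (LinearMap.mulLeft k (AdjoinRoot.mk f q))) : ℤ) := by
  rw [rankHom_cls, PolyModule.aeval_op_quot]

theorem rankHom_quot_of_dvd {q f : k[X]} (hf : f ≠ 0) (h : f ∣ q) :
    rankHom q (cls (PolyModule.quot f hf)) = 0 := by
  rw [rankHom_quot, AdjoinRoot.mk_eq_zero.mpr h,
    (LinearMap.mulLeft_zero_eq_zero k (AdjoinRoot f)), LinearMap.range_zero, finrank_bot,
    Nat.cast_zero]

theorem rankHom_quot_of_isCoprime {q f : k[X]} (hf : f ≠ 0) (h : IsCoprime q f) :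
    rankHom q (cls (PolyModule.quot f hf)) = f.natDegree := by
  have hu : LinearMap.range (LinearMap.mulLeft k (AdjoinRoot.mk f q)) = ⊤ := by
    obtain ⟨a, b, hab⟩ := h
    rw [LinearMap.range_eq_top]
    intro w
    refine ⟨AdjoinRoot.mk f a * w, ?_⟩
    have h1 := congrArg (AdjoinRoot.mk f) hab
    rw [map_add, map_mul, map_mul, AdjoinRoot.mk_self, mul_zero, add_zero, map_one] at h1
    rw [LinearMap.mulLeft_apply, ← mul_assoc, mul_comm (AdjoinRoot.mk f q), h1, one_mul]
  rw [rankHom_quot, hu, finrank_top, PolyModule.finrank_quot f hf]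

theorem rankHom_quot_pos {q f : k[X]} (hf : f ≠ 0) (h : ¬ f ∣ q) :
    0 < rankHom q (cls (PolyModule.quot f hf)) := by
  have fin : Module.Finite k (AdjoinRoot f) := (AdjoinRoot.powerBasis hf).finite
  rw [rankHom_quot, Nat.cast_pos, Module.finrank_pos_iff, Submodule.nontrivial_iff_ne_bot,
    ne_eq, LinearMap.range_eq_bot]
  intro h0
  refine h (AdjoinRoot.mk_eq_zero.mp ?_)
  simpa using LinearMap.congr_fun h0 1

/-- The pairs `(s, f)` with `s ≥ 1` and `f` monic irreducible with `f(0) ≠ 0`, which index the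
indecomposable invertible modules `k[X]/(f^s)`. -/
abbrev PrimaryIndex (k : Type u) [Field k] : Type u :=
  {p : ℕ × k[X] // 0 < p.1 ∧ Irreducible p.2 ∧ p.2.Monic ∧ p.2.eval 0 ≠ 0}

/-- The class `[k[X]/(f^s)]`. -/
noncomputable def primary (p : PrimaryIndex k) : PolyRepRing k :=
  cls (PolyModule.quot (p.1.2 ^ p.1.1) (pow_ne_zero _ p.2.2.1.ne_zero))

theorem injective_primary (p : PrimaryIndex k) : Function.Injective
    (PolyModule.quot (p.1.2 ^ p.1.1) (pow_ne_zero _ p.2.2.1.ne_zero)).op := by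
  have h : IsCoprime X (p.1.2 ^ p.1.1) := by
    refine IsCoprime.pow_right ((irreducible_X.coprime_iff_not_dvd).mpr fun h => p.2.2.2.2 ?_)
    rw [← coeff_zero_eq_eval_zero]
    exact X_dvd_iff.mp h
  obtain ⟨a, b, hab⟩ := h
  have h1 := congrArg (AdjoinRoot.mk (p.1.2 ^ p.1.1)) hab
  rw [map_add, map_mul, map_mul, AdjoinRoot.mk_self, mul_zero, add_zero, map_one,
    AdjoinRoot.mk_X] at h1
  exact fun v w hvw => (IsUnit.of_mul_eq_one_right _ h1).mul_left_cancel hvw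

/-- The functional `rank f^(t-1) - rank f^t` is zero on `k[X]/(g^s)` for `g ≠ f` as well as for
`g = f` and `s < t`, and positive on `k[X]/(f^t)`. -/
theorem linearIndependent_primary : LinearIndependent ℤ (primary (k := k)) := by
  classical
  rw [linearIndependent_iff]
  intro l hl
  by_contra hne
  obtain ⟨p0, hp0⟩ := Finsupp.support_nonempty_iff.mpr hne
  obtain ⟨p, hp, hmax⟩ := Finset.exists_max_image (l.support.filter fun p => p.1.2 = p0.1.2)
    (fun p => p.1.1) ⟨p0, by simp [hp0]⟩
  rw [Finset.mem_filter] at hp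
  let f := p.1.2
  let t := p.1.1
  have ht : 0 < t := p.2.1
  have hf : Irreducible f := p.2.2.1
  let D : PolyRepRing k →+ ℤ := rankHom (f ^ (t - 1)) - rankHom (f ^ t)
  have h1 : ∀ b ∈ l.support, b ≠ p → l b • D (primary b) = 0 := by
    intro b hb hbp
    have hD : D (primary b) = 0 := by
      change rankHom _ _ - rankHom _ _ = 0
      by_cases hbf : b.1.2 = f
      · have hle : b.1.1 ≤ t := hmax b (Finset.mem_filter.mpr ⟨hb, hbf.trans hp.2⟩)
        have hlt : b.1.1 < t := lt_of_le_of_ne hle fun h => hbp (Subtype.ext (Prod.ext h hbf))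
        rw [primary, rankHom_quot_of_dvd, rankHom_quot_of_dvd, sub_zero]
        · rw [hbf]
          exact pow_dvd_pow _ hle
        · rw [hbf]
          exact pow_dvd_pow _ (by omega)
      · have hc : IsCoprime f b.1.2 := by
          rw [hf.coprime_iff_not_dvd]
          intro hd
          exact hbf (eq_of_monic_of_associated p.2.2.2.1 b.2.2.2.1
            ((hf.dvd_irreducible_iff_associated b.2.2.1).mp hd)).symm
        rw [primary, rankHom_quot_of_isCoprime _ hc.pow, rankHom_quot_of_isCoprime _ hc.pow,
          sub_self]
    rw [hD, smul_zero]
  have h2 : 0 < D (primary p) := by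
    change 0 < rankHom _ _ - rankHom _ _
    rw [primary, rankHom_quot_of_dvd _ dvd_rfl, sub_zero]
    refine rankHom_quot_pos _ fun hd => ?_
    have := (pow_dvd_pow_iff hf.ne_zero hf.not_isUnit).mp hd
    omega
  have h3 := congrArg D hl
  rw [Finsupp.linearCombination_apply, map_finsuppSum, map_zero, Finsupp.sum] at h3
  simp only [map_zsmul] at h3
  rw [Finset.sum_eq_single p h1 (fun h => absurd hp.1 h), smul_eq_mul, mul_eq_zero] at h3
  exact (Finsupp.mem_support_iff.mp hp.1) (h3.resolve_right h2.ne')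

theorem cls_mem_span_primary (V : PolyModule k) (hV : Function.Injective V.op) :
    cls V ∈ Submodule.span ℤ (Set.range (primary (k := k))) := by
  have h0 := PolyModule.minpoly_eval_zero_ne_zero _ hV
  refine GrothendieckRing.of_mem_of_closure _ ?_
    (PolyModule.isoClass_mem_closure V _ (minpoly.aeval k _))
  rintro _ ⟨p, hp, e, hm, he, hdvd, rfl⟩
  refine Submodule.subset_span ⟨⟨(e, p), he, hp, hm, fun hp0 => h0 ?_⟩, rfl⟩
  obtain ⟨c, hc⟩ := hdvd
  rw [hc, eval_mul, eval_pow, hp0, zero_pow he.ne', zero_mul]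

/-! ### The multiplication map `R' ⊗ R̄ → R` -/

variable [PerfectField k]

/-- The multiplication map `R' ⊗ R̄ → R`. -/
noncomputable def mulMap (k : Type u) [Field k] [PerfectField k] :
    unipotentSubring k ⊗[ℤ] simpleSubring k →ₐ[ℤ] PolyRepRing k :=
  Algebra.TensorProduct.productMap (unipotentSubring k).subtype.toIntAlgHom
    (simpleSubring k).subtype.toIntAlgHom

theorem mulMap_tmul (a : unipotentSubring k) (b : simpleSubring k) :
    mulMap k (a ⊗ₜ b) = a * b := by
  simp [mulMap]

theorem dim_mulMap (x : unipotentSubring k ⊗[ℤ] simpleSubring k) :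
    dim k (mulMap k x) = tensorDim (dim k) (unipotentSubring k) (simpleSubring k) x := by
  induction x using TensorProduct.induction_on with
  | zero => simp only [map_zero]
  | tmul a b => rw [mulMap_tmul, tensorDim_tmul, map_mul]
  | add a b ha hb => simp only [map_add, ha, hb]

theorem unipotent_mul_simple (f : k[X]) (hf : Irreducible f) (h0 : f.eval 0 ≠ 0) (s : ℕ) :
    unipotent k s * simple f hf =
      cls (PolyModule.quot (f ^ s) (pow_ne_zero s hf.ne_zero)) := by
  rw [unipotent, simple, ← cls_tensor]
  exact (cls_eq (PolyModule.unipotent_tensor_simple f hf h0 s)).symm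

/-- The element `[k[X]/(X-1)^s] ⊗ [k[X]/(f)]` of `R' ⊗ R̄`. -/
noncomputable def primaryTensor (p : PrimaryIndex k) :
    unipotentSubring k ⊗[ℤ] simpleSubring k :=
  (⟨unipotent k p.1.1, Submodule.subset_span ⟨p.1.1, p.2.1, rfl⟩⟩ : unipotentSubring k) ⊗ₜ
    (⟨simple p.1.2 p.2.2.1, Submodule.subset_span ⟨p.1.2, p.2.2.1, p.2.2.2.2, rfl⟩⟩ :
      simpleSubring k)

theorem mulMap_primaryTensor (p : PrimaryIndex k) : mulMap k (primaryTensor p) = primary p := by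
  rw [primaryTensor, mulMap_tmul]
  exact unipotent_mul_simple _ p.2.2.1 p.2.2.2.2 _

theorem span_primaryTensor : Submodule.span ℤ (Set.range (primaryTensor (k := k))) = ⊤ := by
  rw [eq_top_iff]
  rintro x -
  induction x using TensorProduct.induction_on with
  | zero => exact Submodule.zero_mem _
  | add x y hx hy => exact Submodule.add_mem _ hx hy
  | tmul a b =>
    obtain ⟨a, ha⟩ := a
    obtain ⟨b, hb⟩ := b
    induction ha using Submodule.span_induction with
    | zero =>
      have : (⟨0, Submodule.zero_mem _⟩ : unipotentSubring k) = 0 := rfl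
      rw [this, TensorProduct.zero_tmul]
      exact Submodule.zero_mem _
    | add a a' ha ha' h h' =>
      have : (⟨a + a', Submodule.add_mem _ ha ha'⟩ : unipotentSubring k) = ⟨a, ha⟩ + ⟨a', ha'⟩ := rfl
      rw [this, TensorProduct.add_tmul]
      exact Submodule.add_mem _ h h'
    | smul c a ha h =>
      have : (⟨c • a, Submodule.smul_mem _ c ha⟩ : unipotentSubring k) = c • ⟨a, ha⟩ := rfl
      rw [this, ← TensorProduct.smul_tmul']
      exact Submodule.smul_mem _ c h
    | mem a ha =>
      obtain ⟨s, hs, rfl⟩ := ha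
      induction hb using Submodule.span_induction with
      | zero =>
        have : (⟨0, Submodule.zero_mem _⟩ : simpleSubring k) = 0 := rfl
        rw [this, TensorProduct.tmul_zero]
        exact Submodule.zero_mem _
      | add a a' ha ha' h h' =>
        have : (⟨a + a', Submodule.add_mem _ ha ha'⟩ : simpleSubring k) = ⟨a, ha⟩ + ⟨a', ha'⟩ := rfl
        rw [this, TensorProduct.tmul_add]
        exact Submodule.add_mem _ h h'
      | smul c a ha h =>
        have : (⟨c • a, Submodule.smul_mem _ c ha⟩ : simpleSubring k) = c • ⟨a, ha⟩ := rfl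
        rw [this, TensorProduct.tmul_smul]
        exact Submodule.smul_mem _ c h
      | mem b hb =>
        obtain ⟨f, hf, hf0, rfl⟩ := hb
        classical
        have hass : Associated f (normalize f) := (normalize_associated f).symm
        have hirr : Irreducible (normalize f) := hass.irreducible hf
        have h0 : (normalize f).eval 0 ≠ 0 := fun h => hf0 (by
          obtain ⟨c, hc⟩ := hass.dvd'
          rw [hc, eval_mul, h, zero_mul])
        refine Submodule.subset_span ⟨⟨(s, normalize f), hs, hirr, monic_normalize hf.ne_zero, h0⟩, ?_⟩
        have heq : simple (normalize f) hirr = simple f hf :=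
          congrArg GrothendieckRing.of (PolyModule.quot_congr_associated _ _ hass.symm)
        simp only [primaryTensor, heq]

theorem mulMap_finsupp_sum (l : PrimaryIndex k →₀ ℤ) :
    mulMap k (l.sum fun p c => c • primaryTensor p) = l.sum fun p c => c • primary p := by
  rw [map_finsuppSum]
  simp only [map_zsmul, mulMap_primaryTensor]

theorem exists_eq_sum_primaryTensor (x : unipotentSubring k ⊗[ℤ] simpleSubring k) :
    ∃ l : PrimaryIndex k →₀ ℤ, (l.sum fun p c => c • primaryTensor p) = x := by
  have hmem : x ∈ Submodule.span ℤ (Set.range (primaryTensor (k := k))) := by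
    rw [span_primaryTensor]
    trivial
  exact Finsupp.mem_span_range_iff_exists_finsupp.mp hmem

theorem mulMap_injective : Function.Injective (mulMap k) := by
  rw [injective_iff_map_eq_zero]
  intro x hx
  obtain ⟨l, rfl⟩ := exists_eq_sum_primaryTensor x
  have h : Finsupp.linearCombination ℤ (primary (k := k)) l = 0 := by
    rw [← hx, mulMap_finsupp_sum, Finsupp.linearCombination_apply]
  rw [linearIndependent_iff.mp linearIndependent_primary l h]
  exact Finsupp.sum_zero_index

theorem mem_range_mulMap_iff (r : PolyRepRing k) :
    (∃ x, mulMap k x = r) ↔ r ∈ Submodule.span ℤ (Set.range (primary (k := k))) := by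
  rw [Finsupp.mem_span_range_iff_exists_finsupp]
  constructor
  · rintro ⟨x, rfl⟩
    obtain ⟨l, rfl⟩ := exists_eq_sum_primaryTensor x
    exact ⟨l, (mulMap_finsupp_sum l).symm⟩
  · rintro ⟨l, rfl⟩
    exact ⟨_, mulMap_finsupp_sum l⟩

end PolyRepRing

/-! ### Representations of quivers -/

namespace QuiverRep

variable {k : Type u} [Field k] {Q : Type*} [Quiver Q]

theorem isoClass_eq {V W : QuiverRep k Q} (h : Iso V W) : V.isoClass = W.isoClass :=
  Quotient.sound h

theorem iso_of_isoClass_eq {V W : QuiverRep k Q} (h : V.isoClass = W.isoClass) : Iso V W :=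
  Quotient.exact h

/-- A family of linear maps is a morphism of representations if it commutes with the arrows. -/
def IsHom {V W : QuiverRep k Q} (f : ∀ x, V.obj x →ₗ[k] W.obj x) : Prop :=
  ∀ (x y : Q) (a : x ⟶ y) (v : V.obj x), f y (V.map a v) = W.map a (f x v)

/-- All arrows act as bijections. -/
def IsInvertible (V : QuiverRep k Q) : Prop :=
  ∀ (x y : Q) (a : x ⟶ y), Function.Bijective (V.map a)

/-- No composite `U → P → U` with `U` invertible is nonzero. In particular `P` has no nonzero
invertible direct summand. -/
def AvoidsInvertible (P : QuiverRep k Q) : Prop :=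
  ∀ (U : QuiverRep k Q), U.IsInvertible → ∀ (ι : ∀ x, U.obj x →ₗ[k] P.obj x)
    (π : ∀ x, P.obj x →ₗ[k] U.obj x), IsHom ι → IsHom π → ∀ x v, π x (ι x v) = 0

theorem AvoidsInvertible.of_iso {P P' : QuiverRep k Q} (h : Iso P P') (hP : P.AvoidsInvertible) :
    P'.AvoidsInvertible := by
  obtain ⟨e, he⟩ := h
  intro U hU ι π hι hπ x v
  have := hP U hU (fun x => (e x).symm.toLinearMap ∘ₗ ι x) (fun x => π x ∘ₗ (e x).toLinearMap)
    (fun x y a v => by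
      apply (e y).injective
      simp [he, hι x y a])
    (fun x y a v => by simp [he, hπ x y a]) x v
  simpa using this

theorem AvoidsInvertible.sum {P P' : QuiverRep k Q} (hP : P.AvoidsInvertible)
    (hP' : P'.AvoidsInvertible) : (P.sum P').AvoidsInvertible := by
  intro U hU ι π hι hπ x v
  have h1 := hP U hU (fun x => LinearMap.fst k _ _ ∘ₗ ι x) (fun x => π x ∘ₗ LinearMap.inl k _ _)
    (fun x y a v => by
      have := congrArg Prod.fst (hι x y a v)
      exact this)
    (fun x y a v => by
      have := hπ x y a (v, 0)
      simpa using this) x v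
  have h2 := hP' U hU (fun x => LinearMap.snd k _ _ ∘ₗ ι x) (fun x => π x ∘ₗ LinearMap.inr k _ _)
    (fun x y a v => by
      have := congrArg Prod.snd (hι x y a v)
      exact this)
    (fun x y a v => by
      have := hπ x y a (0, v)
      simpa using this) x v
  have h3 : ι x v = ((ι x v).1, 0) + (0, (ι x v).2) := by simp
  rw [h3, map_add]
  simp only [LinearMap.coe_comp, Function.comp_apply, LinearMap.fst_apply, LinearMap.snd_apply,
    LinearMap.inl_apply, LinearMap.inr_apply] at h1 h2
  rw [h1, h2, add_zero]

theorem avoidsInvertible_zero : (zero k Q).AvoidsInvertible := by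
  intro U hU ι π hι hπ x v
  have : ι x v = 0 := rfl
  rw [this, map_zero]

/-- Invertible summands are unique up to isomorphism: in `U ⊕ P ≅ U' ⊕ P'` the composites
`U → P' → U` and `U' → P → U'` vanish, so the components `U → U'` and `U' → U` are inverse to each
other. -/
theorem iso_of_sum_iso {U U' P P' : QuiverRep k Q} (hU : U.IsInvertible) (hU' : U'.IsInvertible)
    (hP : P.AvoidsInvertible) (hP' : P'.AvoidsInvertible) (h : Iso (U.sum P) (U'.sum P')) :
    Iso U U' := by
  obtain ⟨e, he⟩ := h
  have he' : ∀ (x y : Q) (a : x ⟶ y) (v : (U'.sum P').obj x),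
      (e y).symm ((U'.sum P').map a v) = (U.sum P).map a ((e x).symm v) := fun x y a v => by
    apply (e y).injective
    rw [he, LinearEquiv.apply_symm_apply, LinearEquiv.apply_symm_apply]
  have inl_map (x y : Q) (a : x ⟶ y) (v : U.obj x) :
      ((U.map a v, 0) : (U.sum P).obj y) = (U.sum P).map a (v, 0) :=
    Prod.ext rfl (map_zero (P.map a)).symm
  have inr_map (x y : Q) (a : x ⟶ y) (v : P.obj x) :
      ((0, P.map a v) : (U.sum P).obj y) = (U.sum P).map a (0, v) :=
    Prod.ext (map_zero (U.map a)).symm rfl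
  have inl_map' (x y : Q) (a : x ⟶ y) (v : U'.obj x) :
      ((U'.map a v, 0) : (U'.sum P').obj y) = (U'.sum P').map a (v, 0) :=
    Prod.ext rfl (map_zero (P'.map a)).symm
  have inr_map' (x y : Q) (a : x ⟶ y) (v : P'.obj x) :
      ((0, P'.map a v) : (U'.sum P').obj y) = (U'.sum P').map a (0, v) :=
    Prod.ext (map_zero (U'.map a)).symm rfl
  have h1 : ∀ x v, ((e x).symm (0, (e x (v, 0)).2)).1 = 0 := fun x v =>
    hP' U hU (fun x => LinearMap.snd k _ _ ∘ₗ (e x).toLinearMap ∘ₗ LinearMap.inl k _ _)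
      (fun x => LinearMap.fst k _ _ ∘ₗ (e x).symm.toLinearMap ∘ₗ LinearMap.inr k _ _)
      (fun x y a v => by
        change (e y (U.map a v, 0)).2 = P'.map a (e x (v, 0)).2
        rw [inl_map, he]
        rfl)
      (fun x y a v => by
        change ((e y).symm (0, P'.map a v)).1 = U.map a ((e x).symm (0, v)).1
        rw [inr_map', he']
        rfl) x v
  have h2 : ∀ x v, (e x (0, ((e x).symm (v, 0)).2)).1 = 0 := fun x v =>
    hP U' hU' (fun x => LinearMap.snd k _ _ ∘ₗ (e x).symm.toLinearMap ∘ₗ LinearMap.inl k _ _)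
      (fun x => LinearMap.fst k _ _ ∘ₗ (e x).toLinearMap ∘ₗ LinearMap.inr k _ _)
      (fun x y a v => by
        change ((e y).symm (U'.map a v, 0)).2 = P.map a ((e x).symm (v, 0)).2
        rw [inl_map', he']
        rfl)
      (fun x y a v => by
        change (e y (0, P.map a v)).1 = U'.map a (e x (0, v)).1
        rw [inr_map, he]
        rfl) x v
  have l1 : ∀ x v, ((e x).symm ((e x (v, 0)).1, 0)).1 = v := fun x v => by
    have h3 : (e x (v, 0)) = ((e x (v, 0)).1, 0) + (0, (e x (v, 0)).2) := by simp
    have h4 := congrArg (fun w => ((e x).symm w).1) h3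
    simp only [map_add, Prod.fst_add, LinearEquiv.symm_apply_apply] at h4
    rw [h1, add_zero] at h4
    exact h4.symm
  have l2 : ∀ x v, (e x (((e x).symm (v, 0)).1, 0)).1 = v := fun x v => by
    have h3 : ((e x).symm (v, 0)) = (((e x).symm (v, 0)).1, 0) + (0, ((e x).symm (v, 0)).2) := by
      simp
    have h4 := congrArg (fun w => (e x w).1) h3
    simp only [map_add, Prod.fst_add, LinearEquiv.apply_symm_apply] at h4
    rw [h2, add_zero] at h4
    exact h4.symm
  refine ⟨fun x => LinearEquiv.ofLinearMap
    (LinearMap.fst k _ _ ∘ₗ (e x).toLinearMap ∘ₗ LinearMap.inl k _ _)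
    (LinearMap.fst k _ _ ∘ₗ (e x).symm.toLinearMap ∘ₗ LinearMap.inl k _ _)
    (LinearMap.ext fun v => l2 x v) (LinearMap.ext fun v => l1 x v), fun x y a v => ?_⟩
  change (e y (U.map a v, 0)).1 = U'.map a (e x (v, 0)).1
  rw [inl_map, he]
  rfl

/-- A morphism `ψ : S → V` with a left inverse up to isomorphism splits off `S` from `V`. -/
theorem exists_iso_sum_of_retract {S V : QuiverRep k Q} (ψ : ∀ x, S.obj x →ₗ[k] V.obj x)
    (π : ∀ x, V.obj x →ₗ[k] S.obj x) (hψ : IsHom ψ) (hπ : IsHom π)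
    (hinj : ∀ x, Function.Injective (π x ∘ₗ ψ x)) :
    ∃ W : QuiverRep k Q, Iso V (S.sum W) := by
  let W : QuiverRep k Q :=
    { obj := fun x => LinearMap.ker (π x)
      map := fun {x y} a => (V.map a).restrict fun v hv => by
        rw [LinearMap.mem_ker] at hv ⊢
        rw [hπ, hv, map_zero] }
  refine ⟨W, ?_⟩
  suffices Iso (S.sum W) V from (isoSetoid k Q).symm this
  refine ⟨fun x => LinearEquiv.ofBijective ((ψ x).coprod (LinearMap.ker (π x)).subtype) ⟨?_, ?_⟩,
    fun x y a v => ?_⟩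
  · rw [injective_iff_map_eq_zero]
    rintro ⟨s, w⟩ h
    rw [LinearMap.coprod_apply, Submodule.subtype_apply] at h
    have h1 : (π x ∘ₗ ψ x) s = 0 := by
      have := congrArg (π x) h
      rw [map_add, w.2, add_zero, map_zero] at this
      exact this
    have hs : s = 0 := hinj x (h1.trans (map_zero _).symm)
    subst hs
    rw [map_zero, zero_add] at h
    exact Prod.ext rfl (Subtype.ext h)
  · intro v
    obtain ⟨s, hs⟩ := (LinearMap.injective_iff_surjective.mp (hinj x)) (π x v)
    refine ⟨(s, ⟨v - ψ x s, ?_⟩), ?_⟩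
    · rw [LinearMap.mem_ker, map_sub, sub_eq_zero]
      exact hs.symm
    · simp
  · obtain ⟨s, w⟩ := v
    change ψ y (S.map a s) + V.map a w = V.map a (ψ x s + w)
    rw [map_add, hψ]

end QuiverRep

/-! ### Invertible representations -/

namespace TypeATilde

variable {n : ℕ} (o : ZMod (n + 1) → Bool) {k : Type u} [Field k]

/-- The vertex at position `t` of the universal cover. -/
def vtx (t : ℤ) : TypeATilde n o := ⟨(t : ZMod (n + 1))⟩

variable {o}

theorem vtx_eq_iff {s t : ℤ} : vtx o s = vtx o t ↔ (s : ZMod (n + 1)) = t := by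
  simp [vtx]

theorem vtx_nat_add_one : vtx o ((n : ℤ) + 1) = vtx o 0 := by
  rw [vtx_eq_iff]
  push_cast
  exact_mod_cast ZMod.natCast_self (n + 1)

theorem cast_ne_of_lt {t : ℕ} (ht : t < n) : ((t : ℤ) : ZMod (n + 1)) ≠ (n : ZMod (n + 1)) := by
  intro h
  have h' : ((t : ℕ) : ZMod (n + 1)) = (n : ZMod (n + 1)) := by exact_mod_cast h
  have := (ZMod.natCast_eq_natCast_iff' t n (n + 1)).mp h'
  rw [Nat.mod_eq_of_lt (by omega), Nat.mod_eq_of_lt (by omega)] at this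
  omega

/-- The arrow from position `t` to position `t + 1`. -/
def fwd {t : ℤ} (h : o t = true) : vtx o t ⟶ vtx o (t + 1) :=
  ⟨(t : ZMod (n + 1)), by simp [tail, h, vtx], by simp [head, h, vtx]⟩

/-- The arrow from position `t + 1` to position `t`. -/
def bwd {t : ℤ} (h : o t = false) : vtx o (t + 1) ⟶ vtx o t :=
  ⟨(t : ZMod (n + 1)), by simp [tail, h, vtx], by simp [head, h, vtx]⟩

/-- Every arrow is the image of one of the arrows between positions `t` and `t + 1`, `t ≤ n`. -/
theorem hom_cases {motive : ∀ x y : TypeATilde n o, (x ⟶ y) → Prop}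
    (h1 : ∀ (t : ℕ) (h : o (t : ℤ) = true), t ≤ n → motive _ _ (fwd h))
    (h2 : ∀ (t : ℕ) (h : o (t : ℤ) = false), t ≤ n → motive _ _ (bwd h))
    (x y : TypeATilde n o) (a : x ⟶ y) : motive x y a := by
  obtain ⟨x⟩ := x
  obtain ⟨y⟩ := y
  obtain ⟨m, hx, hy⟩ := a
  obtain ⟨t, ht, rfl⟩ : ∃ t : ℕ, t ≤ n ∧ ((t : ℤ) : ZMod (n + 1)) = m :=
    ⟨m.val, Nat.lt_succ_iff.mp (ZMod.val_lt m), by simp⟩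
  cases ho : o (t : ℤ) with
  | true =>
    have e1 : x = ((t : ℤ) : ZMod (n + 1)) := by
      rw [← show tail o _ = x from hx]
      simp only [tail, ho, if_true]
    have e2 : y = (((t : ℤ) + 1 : ℤ) : ZMod (n + 1)) := by
      rw [← show head o _ = y from hy]
      simp only [head, ho, if_true]
      push_cast
      rfl
    subst e1 e2
    exact h1 t ho ht
  | false =>
    have e1 : x = (((t : ℤ) + 1 : ℤ) : ZMod (n + 1)) := by
      rw [← show tail o _ = x from hx]
      simp only [tail, ho, Bool.false_eq_true, if_false]
      push_cast
      rfl
    have e2 : y = ((t : ℤ) : ZMod (n + 1)) := by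
      rw [← show head o _ = y from hy]
      simp only [head, ho, Bool.false_eq_true, if_false]
    subst e1 e2
    exact h2 t ho ht

variable (o) in
/-- The representation with the space of `A` at every vertex, on which `α_n` acts as `X` and all
other arrows act as the identity. For `A = k[X]/(f^s)` it is the band `B_f(s)` by definition. -/
noncomputable abbrev ofPoly (A : PolyModule k) : QuiverRep k (TypeATilde n o) where
  obj _ := A.carrier
  map a := if a.1 = (n : ZMod (n + 1)) then A.op else LinearMap.id

theorem ofPoly_congr {A B : PolyModule k} (h : PolyModule.Iso A B) :
    QuiverRep.Iso (ofPoly o A) (ofPoly o B) := by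
  obtain ⟨e, he⟩ := h
  refine ⟨fun _ => e, fun x y a v => ?_⟩
  change e ((if _ then _ else _ : A.carrier →ₗ[k] A.carrier) v) =
    (if _ then _ else _ : B.carrier →ₗ[k] B.carrier) (e v)
  split_ifs
  · exact he v
  · rfl

/-- Conversely an isomorphism of representations restricts, at the tail of `α_n`, to an isomorphism
of modules. -/
theorem iso_of_ofPoly_iso {A B : PolyModule k} (h : QuiverRep.Iso (ofPoly o A) (ofPoly o B)) :
    PolyModule.Iso A B := by
  obtain ⟨e, he⟩ := h
  -- Along the arrows `α_0, …, α_{n-1}` the components of `e` agree.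
  have key : ∀ t : ℕ, t ≤ n → ∀ v : A.carrier, e (vtx o t) v = e (vtx o 0) v := by
    intro t
    induction t with
    | zero => exact fun _ _ => rfl
    | succ t ih =>
      intro ht v
      have hne := cast_ne_of_lt (n := n) (t := t) (by omega)
      rw [← ih (by omega)]
      cases ho : o (t : ℤ) with
      | true =>
        have := he _ _ (fwd ho) v
        simp only [fwd, hne, if_false, LinearMap.id_apply] at this
        exact this
      | false =>
        have := he _ _ (bwd ho) v
        simp only [bwd, hne, if_false, LinearMap.id_apply] at this
        exact this.symm
  have h0 : ∀ v : A.carrier, e (vtx o ((n : ℤ) + 1)) v = e (vtx o 0) v := by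
    rw [vtx_nat_add_one]
    exact fun _ => rfl
  refine ⟨e (vtx o 0), fun v => ?_⟩
  cases ho : o (n : ℤ) with
  | true =>
    have := he _ _ (fwd ho) v
    simp only [fwd, Int.cast_natCast, if_true] at this
    rw [h0, key n le_rfl] at this
    exact this
  | false =>
    have := he _ _ (bwd ho) v
    simp only [bwd, Int.cast_natCast, if_true] at this
    rw [h0, key n le_rfl] at this
    exact this

theorem isInvertible_ofPoly {A : PolyModule k} (hA : Function.Injective A.op) :
    (ofPoly o A).IsInvertible := by
  intro x y a
  change Function.Bijective (if _ then _ else _ : A.carrier →ₗ[k] A.carrier)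
  split_ifs
  · exact ⟨hA, LinearMap.injective_iff_surjective.mp hA⟩
  · exact Function.bijective_id

variable (o) in
/-- `ofPoly` as a homomorphism of semirings of isomorphism classes. -/
noncomputable def ofPolyIso (k : Type u) [Field k] :
    PolyModule.IsoClass k →+* QuiverRep.IsoClass k (TypeATilde n o) where
  toFun := Quotient.map (ofPoly o) fun _ _ h => ofPoly_congr h
  map_zero' := Quotient.sound ⟨fun _ => LinearEquiv.refl k _, fun _ _ _ _ => rfl⟩
  map_one' := Quotient.sound ⟨fun _ => LinearEquiv.refl k _, fun x y a v => by
    change (if _ then _ else _ : k →ₗ[k] k) v = v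
    split_ifs <;> rfl⟩
  map_add' := by
    rintro ⟨A⟩ ⟨B⟩
    refine Quotient.sound ⟨fun _ => LinearEquiv.refl k _, fun x y a v => ?_⟩
    change (if _ then _ else _ : (A.carrier × B.carrier) →ₗ[k] (A.carrier × B.carrier)) v =
      ((if _ then _ else _ : A.carrier →ₗ[k] A.carrier).prodMap
        (if _ then _ else _ : B.carrier →ₗ[k] B.carrier)) v
    split_ifs <;> rfl
  map_mul' := by
    rintro ⟨A⟩ ⟨B⟩
    refine Quotient.sound ⟨fun _ => LinearEquiv.refl k _, fun x y a v => ?_⟩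
    change (if _ then _ else _ : (A.carrier ⊗[k] B.carrier) →ₗ[k] (A.carrier ⊗[k] B.carrier)) v =
      (TensorProduct.map (if _ then _ else _ : A.carrier →ₗ[k] A.carrier)
        (if _ then _ else _ : B.carrier →ₗ[k] B.carrier)) v
    split_ifs
    · rfl
    · rw [TensorProduct.map_id]

variable (o) in
/-- The ring homomorphism `R → R(Q)` induced by `ofPoly`. -/
noncomputable def ofPolyHom (k : Type u) [Field k] :
    PolyRepRing k →+* QuiverRepRing k (TypeATilde n o) :=
  GrothendieckRing.lift
    { toFun := fun c => GrothendieckRing.of (ofPolyIso o k c)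
      map_zero' := by simp
      map_one' := by rw [map_one, GrothendieckRing.of_one]
      map_add' := fun a b => by simp
      map_mul' := fun a b => by rw [map_mul, GrothendieckRing.of_mul] }

theorem ofPolyHom_cls (A : PolyModule k) :
    ofPolyHom o k (PolyRepRing.cls A) = QuiverRepRing.cls (ofPoly o A) :=
  GrothendieckRing.lift_of _ _

/-- Identification of the spaces at two equal vertices. -/
def castEquiv (V : QuiverRep k (TypeATilde n o)) {x y : TypeATilde n o} (h : x = y) :
    V.obj x ≃ₗ[k] V.obj y := h ▸ LinearEquiv.refl k _

@[simp] theorem castEquiv_rfl (V : QuiverRep k (TypeATilde n o)) {x : TypeATilde n o}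
    (h : x = x) (v : V.obj x) : castEquiv V h v = v := rfl

@[simp] theorem castEquiv_trans (V : QuiverRep k (TypeATilde n o)) {x y z : TypeATilde n o}
    (h : x = y) (h' : y = z) (v : V.obj x) :
    castEquiv V h' (castEquiv V h v) = castEquiv V (h.trans h') v := by
  subst h h'
  rfl

theorem castEquiv_map (V : QuiverRep k (TypeATilde n o)) {x y x' y' : TypeATilde n o}
    (h : x = x') (h' : y = y') (a : x ⟶ y) (a' : x' ⟶ y') (ha : a.1 = a'.1) (v : V.obj x) :
    castEquiv V h' (V.map a v) = V.map a' (castEquiv V h v) := by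
  subst h h'
  obtain rfl : a = a' := Subtype.ext ha
  rfl

/-- In an invertible representation, the identification of the space at position `0` with the
space at position `t` along the arrows in between. -/
noncomputable def transport (U : QuiverRep k (TypeATilde n o)) (hU : U.IsInvertible) :
    ∀ t : ℕ, U.obj (vtx o 0) ≃ₗ[k] U.obj (vtx o t)
  | 0 => LinearEquiv.refl k _
  | t + 1 => (transport U hU t).trans
      (if h : o (t : ℤ) = true then LinearEquiv.ofBijective (U.map (fwd h)) (hU _ _ _)
      else (LinearEquiv.ofBijective (U.map (bwd (Bool.eq_false_iff.mpr h))) (hU _ _ _)).symm)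

theorem transport_fwd (U : QuiverRep k (TypeATilde n o)) (hU : U.IsInvertible) {t : ℕ}
    (h : o (t : ℤ) = true) (v : U.obj (vtx o 0)) :
    transport U hU (t + 1) v = U.map (fwd h) (transport U hU t v) := by
  rw [transport, dif_pos h]
  rfl

theorem transport_bwd (U : QuiverRep k (TypeATilde n o)) (hU : U.IsInvertible) {t : ℕ}
    (h : o (t : ℤ) = false) (v : U.obj (vtx o 0)) :
    U.map (bwd h) (transport U hU (t + 1) v) = transport U hU t v := by
  have h' : ¬ o (t : ℤ) = true := Bool.eq_false_iff.mp h
  rw [transport, dif_neg h']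
  exact LinearEquiv.apply_symm_apply
    (LinearEquiv.ofBijective (U.map (bwd (Bool.eq_false_iff.mpr h'))) (hU _ _ _)) _

/-- An invertible representation is determined by its monodromy around the cycle. -/
theorem exists_iso_ofPoly (U : QuiverRep k (TypeATilde n o)) (hU : U.IsInvertible) :
    ∃ A : PolyModule k, Function.Injective A.op ∧ QuiverRep.Iso (ofPoly o A) U := by
  let E := transport U hU
  let c := castEquiv U (vtx_nat_add_one (o := o))
  let T : U.obj (vtx o 0) ≃ₗ[k] U.obj (vtx o 0) :=
    if h : o (n : ℤ) = true then
      (E n).trans ((LinearEquiv.ofBijective (U.map (fwd h)) (hU _ _ _)).trans c)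
    else c.symm.trans ((LinearEquiv.ofBijective (U.map (bwd (Bool.eq_false_iff.mpr h)))
      (hU _ _ _)).trans (E n).symm)
  let A : PolyModule k := { carrier := U.obj (vtx o 0), op := T.toLinearMap }
  have hx (x : TypeATilde n o) : vtx o (x.idx.val : ℤ) = x := by
    ext
    simp [vtx]
  let e (x : TypeATilde n o) : U.obj (vtx o 0) ≃ₗ[k] U.obj x :=
    (E x.idx.val).trans (castEquiv U (hx x))
  have he (t : ℕ) (ht : t ≤ n) (v : U.obj (vtx o 0)) : e (vtx o t) v = E t v := by
    have aux (m : ℕ) (hm : m = t) (h : vtx o (m : ℤ) = vtx o (t : ℤ)) :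
        castEquiv U h (E m v) = E t v := by
      subst hm
      rfl
    refine aux _ ?_ _
    simp only [vtx, Int.cast_natCast]
    exact ZMod.val_cast_of_lt (by omega)
  have he' (v : U.obj (vtx o 0)) : e (vtx o ((n : ℤ) + 1)) v = c.symm v := by
    have aux (x : TypeATilde n o) (h : x = vtx o 0) : e x v = (castEquiv U h).symm v := by
      subst h
      exact he 0 (Nat.zero_le n) v
    exact aux _ _
  refine ⟨A, T.injective, e, ?_⟩
  refine hom_cases (fun t h ht => ?_) (fun t h ht => ?_)
  · intro v
    change e (vtx o ((t : ℤ) + 1)) ((if ((t : ℤ) : ZMod (n + 1)) = (n : ZMod (n + 1)) then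
      T.toLinearMap else LinearMap.id) v) = U.map (fwd h) (e (vtx o t) v)
    rcases ht.lt_or_eq with hlt | rfl
    · rw [if_neg (cast_ne_of_lt hlt), he t ht, LinearMap.id_apply]
      exact (he (t + 1) hlt v).trans (transport_fwd U hU h v)
    · rw [if_pos (Int.cast_natCast t), he t le_rfl, he']
      simp only [T, dif_pos h]
      exact c.symm_apply_apply _
  · intro v
    change e (vtx o t) ((if ((t : ℤ) : ZMod (n + 1)) = (n : ZMod (n + 1)) then
      T.toLinearMap else LinearMap.id) v) = U.map (bwd h) (e (vtx o ((t : ℤ) + 1)) v)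
    rcases ht.lt_or_eq with hlt | rfl
    · rw [if_neg (cast_ne_of_lt hlt), he t ht, LinearMap.id_apply]
      exact ((congrArg _ (he (t + 1) hlt v)).trans (transport_bwd U hU h v)).symm
    · rw [if_pos (Int.cast_natCast t), he t le_rfl, he']
      simp only [T, dif_neg (Bool.eq_false_iff.mp h)]
      exact (E t).apply_symm_apply _

/-! ### Graded representations -/

/-- A lift of the representation `P` to the universal cover of the quiver, encoded by the
projections of `P` onto its components of degree `t`. Only finitely many components are nonzero,
the component of degree `t` is concentrated at the vertex below position `t`, and the arrows map
homogeneous components to homogeneous components as they do for strings. -/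
structure Grading (P : QuiverRep k (TypeATilde n o)) where
  /-- the degrees in which `P` may be nonzero -/
  support : Finset ℤ
  /-- the projection onto the component of degree `t` at the vertex `x` -/
  proj : ∀ x : TypeATilde n o, ℤ → P.obj x →ₗ[k] P.obj x
  proj_of_notMem : ∀ x t, t ∉ support → proj x t = 0
  proj_of_ne : ∀ (x : TypeATilde n o) (t : ℤ), (t : ZMod (n + 1)) ≠ x.idx → proj x t = 0
  proj_proj : ∀ x s t v, proj x t (proj x s v) = if t = s then proj x s v else 0
  sum_proj : ∀ x v, ∑ t ∈ support, proj x t v = v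
  map_proj : ∀ (x y : TypeATilde n o) (a : x ⟶ y) (t : ℤ), (t : ZMod (n + 1)) = x.idx →
    ∀ v, P.map a (proj x t v) = proj y (next o a.1 t) (P.map a v)

theorem next_injective (m : ZMod (n + 1)) : Function.Injective (next o m) := by
  intro s t h
  unfold next at h
  split_ifs at h <;> omega

/-- The grading of a string in which `e_t` has degree `t`. -/
noncomputable def stringGrading (o : ZMod (n + 1) → Bool) (k : Type u) [Field k] (i j : ℤ) :
    Grading (string o k i j) where
  support := Finset.Icc i j
  proj x t := Finsupp.linearCombination k fun s : StringIndex n i j x.idx =>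
    if s.1 = t then (Finsupp.single s 1 : StringIndex n i j x.idx →₀ k) else 0
  proj_of_notMem x t ht := by
    refine Finsupp.lhom_ext' fun s => LinearMap.ext_ring ?_
    have : s.1 ≠ t := fun h => ht (by rw [← h, Finset.mem_Icc]; exact s.2.1)
    simp [this]
  proj_of_ne x t ht := by
    refine Finsupp.lhom_ext' fun s => LinearMap.ext_ring ?_
    have : s.1 ≠ t := fun h => ht (by rw [← h]; exact s.2.2)
    simp [this]
  proj_proj x s t v := by
    induction v using Finsupp.induction_linear with
    | zero => simp
    | add v w hv hw =>
      simp only [map_add, hv, hw]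
      split_ifs <;> simp
    | single r c =>
      by_cases h : r.1 = s
      · subst h
        by_cases h' : t = r.1
        · subst h'
          simp
        · simp [h', Ne.symm h']
      · simp [h]
  sum_proj x v := by
    induction v using Finsupp.induction_linear with
    | zero => simp
    | add v w hv hw => simp only [map_add, Finset.sum_add_distrib, hv, hw]
    | single r c =>
      rw [Finset.sum_eq_single r.1]
      · simp
      · intro t _ ht
        simp [ht.symm]
      · intro h
        exact absurd (Finset.mem_Icc.mpr r.2.1) h
  map_proj x y a t ht v := by
    induction v using Finsupp.induction_linear with
    | zero => simp only [map_zero]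
    | add v w hv hw => simp only [map_add, hv, hw]
    | single r c =>
      by_cases h' : r.1 = t
      · subst h'
        by_cases h : i ≤ next o a.1 r ∧ next o a.1 r ≤ j <;> simp [h]
      · have h2 : next o a.1 r ≠ next o a.1 t := fun h3 => h' (next_injective _ h3)
        by_cases h : i ≤ next o a.1 r ∧ next o a.1 r ≤ j <;> simp [h, h', h2]

/-- The tensor product of a graded representation with an arbitrary one is graded. -/
noncomputable def Grading.tensor {P : QuiverRep k (TypeATilde n o)} (G : Grading P)
    (V : QuiverRep k (TypeATilde n o)) : Grading (P.tensor V) where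
  support := G.support
  proj x t := TensorProduct.map (G.proj x t) LinearMap.id
  proj_of_notMem x t ht := by rw [G.proj_of_notMem x t ht, TensorProduct.map_zero_left]
  proj_of_ne x t ht := by rw [G.proj_of_ne x t ht, TensorProduct.map_zero_left]
  proj_proj x s t v := by
    induction v using TensorProduct.induction_on with
    | zero => simp
    | add v w hv hw =>
      simp only [map_add, hv, hw]
      split_ifs <;> simp
    | tmul p v =>
      simp only [TensorProduct.map_tmul, LinearMap.id_apply, G.proj_proj]
      split_ifs <;> simp
  sum_proj x v := by
    induction v using TensorProduct.induction_on with
    | zero => simp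
    | add v w hv hw => simp only [map_add, Finset.sum_add_distrib, hv, hw]
    | tmul p v =>
      simp only [TensorProduct.map_tmul, LinearMap.id_apply]
      rw [← TensorProduct.sum_tmul, G.sum_proj]
  map_proj x y a t ht v := by
    induction v using TensorProduct.induction_on with
    | zero => simp only [map_zero]
    | add v w hv hw => simp only [map_add, hv, hw]
    | tmul p v =>
      simp only [TensorProduct.map_tmul, LinearMap.id_apply, G.map_proj x y a t ht]

/-- A composite `U → P → U` through a graded representation is the sum of its homogeneous
components `p_t`. If `U` is invertible, then `p_{t+1}` is conjugate to `p_t`, and as only finitely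
many of them are nonzero, all vanish. -/
theorem Grading.avoidsInvertible {P : QuiverRep k (TypeATilde n o)} (G : Grading P) :
    P.AvoidsInvertible := by
  intro U hU ι π hι hπ
  let p (x : TypeATilde n o) (t : ℤ) : U.obj x →ₗ[k] U.obj x := π x ∘ₗ G.proj x t ∘ₗ ι x
  have hp (x y : TypeATilde n o) (a : x ⟶ y) (t : ℤ) (ht : (t : ZMod (n + 1)) = x.idx) :
      p x t = 0 ↔ p y (next o a.1 t) = 0 := by
    have h1 (v) : U.map a (p x t v) = p y (next o a.1 t) (U.map a v) := by
      change U.map a (π x (G.proj x t (ι x v))) = π y (G.proj y _ (ι y (U.map a v)))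
      rw [← hπ, G.map_proj x y a t ht, hι]
    constructor
    · intro h
      ext w
      obtain ⟨v, rfl⟩ := (hU x y a).2 w
      rw [← h1, h, LinearMap.zero_apply, LinearMap.zero_apply, map_zero]
    · intro h
      ext v
      apply (hU x y a).1
      rw [h1, h, LinearMap.zero_apply, LinearMap.zero_apply, map_zero]
  have hstep (t : ℤ) : p (vtx o t) t = 0 ↔ p (vtx o (t + 1)) (t + 1) = 0 := by
    cases h : o t with
    | true =>
      have := hp _ _ (fwd h) t rfl
      simpa [fwd, next, h] using this
    | false =>
      have := hp _ _ (bwd h) (t + 1) rfl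
      simpa [bwd, next, h] using this.symm
  have hall (t : ℤ) : p (vtx o t) t = 0 := by
    obtain ⟨t0, ht0⟩ := Infinite.exists_notMem_finset G.support
    have h0 : p (vtx o t0) t0 = 0 := by
      simp [p, G.proj_of_notMem _ t0 ht0]
    induction t using Int.inductionOn' (b := t0) with
    | zero => exact h0
    | succ t _ ih => exact (hstep t).mp ih
    | pred t _ ih =>
      refine (hstep (t - 1)).mpr ?_
      rw [sub_add_cancel]
      exact ih
  intro x v
  have h2 : π x (ι x v) = ∑ t ∈ G.support, p x t v := by
    conv_lhs => rw [← G.sum_proj x (ι x v), map_sum]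
    rfl
  rw [h2]
  refine Finset.sum_eq_zero fun t _ => ?_
  by_cases ht : (t : ZMod (n + 1)) = x.idx
  · obtain rfl : vtx o t = x := TypeATilde.ext ht
    rw [hall, LinearMap.zero_apply]
  · simp [p, G.proj_of_ne x t ht]

/-! ### Tensor products of strings with invertible representations -/

/-- The number of times the path from position `0` to position `t` of the universal cover runs
through `α_n`, with the sign for which `X ^ crossing o t` trivializes the monodromy. -/
def crossing (o : ZMod (n + 1) → Bool) (t : ℤ) : ℤ :=
  if o n then -(t / (n + 1 : ℤ)) else t / (n + 1 : ℤ)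

theorem cast_eq_last_iff (t : ℤ) : (t : ZMod (n + 1)) = n ↔ (n + 1 : ℤ) ∣ t + 1 := by
  have h1 : (n : ZMod (n + 1)) = -1 := by
    rw [eq_neg_iff_add_eq_zero]
    exact_mod_cast ZMod.natCast_self (n + 1)
  rw [h1, eq_neg_iff_add_eq_zero]
  have h2 := ZMod.intCast_zmod_eq_zero_iff_dvd (t + 1) (n + 1)
  push_cast at h2
  exact h2

theorem add_one_ediv (t : ℤ) :
    (t + 1) / (n + 1 : ℤ) = t / (n + 1 : ℤ) + if (t : ZMod (n + 1)) = n then 1 else 0 := by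
  have hn : (0 : ℤ) < n + 1 := by omega
  have h0 := Int.mul_ediv_add_emod t (n + 1 : ℤ)
  have h1 := Int.emod_nonneg t hn.ne'
  have h2 := Int.emod_lt_of_pos t hn
  split_ifs with h <;> rw [cast_eq_last_iff] at h
  · have h3 : t % (n + 1 : ℤ) = n := by
      have h4 : (n + 1 : ℤ) ∣ t % (n + 1 : ℤ) + 1 := by
        rw [← h0, add_assoc] at h
        exact (Int.dvd_add_right (dvd_mul_right _ _)).mp h
      have := Int.le_of_dvd (by omega) h4
      omega
    exact ((Int.ediv_emod_unique (r := 0) hn).mpr ⟨by linarith, le_rfl, hn⟩).1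
  · have h3 : t % (n + 1 : ℤ) ≠ n := fun h3 => h (by
      rw [← h0, h3, add_assoc]
      exact dvd_add (dvd_mul_right _ _) dvd_rfl)
    exact ((Int.ediv_emod_unique (r := t % (n + 1 : ℤ) + 1) hn).mpr
      ⟨by linarith, by omega, by omega⟩).1

theorem crossing_next (m : ZMod (n + 1)) (s : ℤ) (hs : (s : ZMod (n + 1)) = tail o m) :
    crossing o (next o m s) = crossing o s - if m = n then 1 else 0 := by
  cases hm : o m with
  | true =>
    have hs' : (s : ZMod (n + 1)) = m := by simpa [tail, hm] using hs
    have h1 := add_one_ediv (n := n) s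
    rw [hs'] at h1
    simp only [next, hm, if_true, crossing, h1]
    by_cases h : m = n
    · subst h
      simp [hm]
      ring
    · simp [h]
  | false =>
    have hs' : ((s - 1 : ℤ) : ZMod (n + 1)) = m := by
      push_cast
      rw [hs]
      simp [tail, hm]
    have h1 := add_one_ediv (n := n) (s - 1)
    rw [hs', sub_add_cancel] at h1
    simp only [next, hm, Bool.false_eq_true, if_false, crossing, h1]
    by_cases h : m = n
    · subst h
      simp [hm]
    · simp [h]

/-- The operator on `P ⊗ A` that acts on `p ⊗ v`, `p` of degree `t`, as `p ⊗ T^(τ t) v`. -/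
noncomputable def Grading.twist {P : QuiverRep k (TypeATilde n o)} (G : Grading P) {A : Type u}
    [AddCommGroup A] [Module k A] (T : A ≃ₗ[k] A) (τ : ℤ → ℤ) (x : TypeATilde n o) :
    P.obj x ⊗[k] A →ₗ[k] P.obj x ⊗[k] A :=
  ∑ t ∈ G.support, TensorProduct.map (G.proj x t) (T ^ τ t).toLinearMap

theorem Grading.twist_tmul {P : QuiverRep k (TypeATilde n o)} (G : Grading P) {A : Type u}
    [AddCommGroup A] [Module k A] (T : A ≃ₗ[k] A) (τ : ℤ → ℤ) (x : TypeATilde n o) (s : ℤ)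
    (p : P.obj x) (v : A) :
    G.twist T τ x (G.proj x s p ⊗ₜ v) = G.proj x s p ⊗ₜ (T ^ τ s) v := by
  rw [twist, LinearMap.sum_apply, Finset.sum_eq_single s]
  · rw [TensorProduct.map_tmul, G.proj_proj, if_pos rfl]
    rfl
  · intro t _ ht
    rw [TensorProduct.map_tmul, G.proj_proj, if_neg ht, TensorProduct.zero_tmul]
  · intro hs
    rw [G.proj_of_notMem x s hs]
    simp

/-- Elements of `P ⊗ A` are sums of tensors `p ⊗ v` with `p` homogeneous. -/
theorem Grading.tmul_induction {P : QuiverRep k (TypeATilde n o)} (G : Grading P) {A : Type u}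
    [AddCommGroup A] [Module k A] (x : TypeATilde n o) {motive : P.obj x ⊗[k] A → Prop}
    (h0 : motive 0) (hadd : ∀ a b, motive a → motive b → motive (a + b))
    (h : ∀ (t : ℤ) (p : P.obj x) (v : A), (t : ZMod (n + 1)) = x.idx →
      motive (G.proj x t p ⊗ₜ v)) (w : P.obj x ⊗[k] A) : motive w := by
  induction w using TensorProduct.induction_on with
  | zero => exact h0
  | add a b ha hb => exact hadd a b ha hb
  | tmul p v =>
    rw [← G.sum_proj x p, TensorProduct.sum_tmul]
    refine Finset.sum_induction _ motive hadd h0 fun t _ => ?_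
    by_cases ht : (t : ZMod (n + 1)) = x.idx
    · exact h t p v ht
    · rw [G.proj_of_ne x t ht, LinearMap.zero_apply, TensorProduct.zero_tmul]
      exact h0

theorem Grading.twist_twist {P : QuiverRep k (TypeATilde n o)} (G : Grading P) {A : Type u}
    [AddCommGroup A] [Module k A] (T : A ≃ₗ[k] A) (τ σ : ℤ → ℤ) (h : ∀ t, σ t + τ t = 0)
    (x : TypeATilde n o) (w : P.obj x ⊗[k] A) : G.twist T σ x (G.twist T τ x w) = w := by
  induction w using G.tmul_induction with
  | h0 => simp only [map_zero]
  | hadd a b ha hb => simp only [map_add, ha, hb]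
  | h t p v ht =>
    rw [twist_tmul, twist_tmul, ← LinearEquiv.mul_apply, ← zpow_add, h, zpow_zero]
    rfl

/-- On the universal cover the monodromy of an invertible representation can be trivialized: the twist
by `A.op ^ crossing o t` in degree `t` is an isomorphism. -/
theorem Grading.tensor_ofPoly_iso {P : QuiverRep k (TypeATilde n o)} (G : Grading P)
    (A : PolyModule k) (hA : Function.Injective A.op) :
    QuiverRep.Iso (P.tensor (ofPoly o A))
      (P.tensor (ofPoly o { carrier := A.carrier, op := LinearMap.id })) := by
  let T : A.carrier ≃ₗ[k] A.carrier :=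
    LinearEquiv.ofBijective A.op ⟨hA, LinearMap.injective_iff_surjective.mp hA⟩
  refine ⟨fun x => LinearEquiv.ofLinearMap (G.twist T (crossing o) x) (G.twist T (-crossing o) x)
    (LinearMap.ext fun w => G.twist_twist T _ _ (fun t => by simp) x w)
    (LinearMap.ext fun w => G.twist_twist T _ _ (fun t => by simp) x w), fun x y a w => ?_⟩
  change G.twist T (crossing o) y (TensorProduct.map (P.map a) ((ofPoly o A).map a) w) =
    TensorProduct.map (P.map a) ((ofPoly o { carrier := A.carrier, op := LinearMap.id }).map a)
      (G.twist T (crossing o) x w)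
  induction w using G.tmul_induction with
  | h0 => simp only [map_zero]
  | hadd a b ha hb => simp only [map_add, ha, hb]
  | h t p v ht =>
    rw [G.twist_tmul, TensorProduct.map_tmul, TensorProduct.map_tmul, G.map_proj x y a t ht,
      G.twist_tmul]
    congr 1
    have hc := crossing_next (o := o) a.1 t (ht.trans a.2.1.symm)
    change (T ^ crossing o (next o a.1 t)) ((if a.1 = (n : ZMod (n + 1)) then A.op
      else LinearMap.id) v) = (if _ then LinearMap.id else LinearMap.id : A.carrier →ₗ[k] A.carrier)
        ((T ^ crossing o t) v)
    rw [hc, ite_self, LinearMap.id_apply]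
    split_ifs
    · have : A.op v = T v := rfl
      rw [this, ← LinearEquiv.mul_apply, zpow_sub_one, inv_mul_cancel_right]
    · rw [sub_zero, LinearMap.id_apply]

/-! ### Families of vectors and functionals along the universal cover -/

theorem int_induction_down {P : ℤ → Prop} {j : ℤ} (h0 : P j) (h : ∀ t < j, P (t + 1) → P t) :
    ∀ i ≤ j, P i := by
  intro i hi
  induction i, hi using Int.leInductionDown with
  | base => exact h0
  | pred t ht ih => exact h (t - 1) (by omega) (by rwa [sub_add_cancel])

/-- The linear relation between the spaces at positions `t` and `t + 1` given by the arrow between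
them. -/
def link (V : QuiverRep k (TypeATilde n o)) (t : ℤ) :
    Submodule k (V.obj (vtx o t) × V.obj (vtx o (t + 1))) where
  carrier := {x | (∀ h : o t = true, V.map (fwd h) x.1 = x.2) ∧
    ∀ h : o t = false, V.map (bwd h) x.2 = x.1}
  zero_mem' := by simp
  add_mem' := by
    rintro x y ⟨hx, hx'⟩ ⟨hy, hy'⟩
    exact ⟨fun h => by simp [hx h, hy h], fun h => by simp [hx' h, hy' h]⟩
  smul_mem' := by
    rintro c x ⟨hx, hx'⟩
    exact ⟨fun h => by simp [hx h], fun h => by simp [hx' h]⟩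

theorem mem_link_of_true {V : QuiverRep k (TypeATilde n o)} {t : ℤ} (ho : o t = true)
    {v : V.obj (vtx o t)} {w : V.obj (vtx o (t + 1))} :
    (v, w) ∈ link V t ↔ V.map (fwd ho) v = w :=
  ⟨fun h => h.1 ho, fun h => ⟨fun _ => h, fun h' => absurd (ho.symm.trans h') (by simp)⟩⟩

theorem mem_link_of_false {V : QuiverRep k (TypeATilde n o)} {t : ℤ} (ho : o t = false)
    {v : V.obj (vtx o t)} {w : V.obj (vtx o (t + 1))} :
    (v, w) ∈ link V t ↔ V.map (bwd ho) w = v :=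
  ⟨fun h => h.2 ho, fun h => ⟨fun h' => absurd (ho.symm.trans h') (by simp), fun _ => h⟩⟩

/-- The families of vectors, one at each position, that are linked between positions `t` and
`t + 1` for all `t` in `I`. -/
def families (V : QuiverRep k (TypeATilde n o)) (I : Set ℤ) :
    Submodule k (∀ t : ℤ, V.obj (vtx o t)) where
  carrier := {v | ∀ t ∈ I, (v t, v (t + 1)) ∈ link V t}
  zero_mem' := fun t _ => (link V t).zero_mem
  add_mem' := fun hx hy t ht => (link V t).add_mem (hx t ht) (hy t ht)
  smul_mem' := fun c _ hx t ht => (link V t).smul_mem c (hx t ht)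

/-- Functionals at positions `t` and `t + 1` that agree along the arrow between them. -/
def CoLink (V : QuiverRep k (TypeATilde n o)) (t : ℤ) (φ : V.obj (vtx o t) →ₗ[k] k)
    (ψ : V.obj (vtx o (t + 1)) →ₗ[k] k) : Prop :=
  (∀ h : o t = true, ψ ∘ₗ V.map (fwd h) = φ) ∧ ∀ h : o t = false, φ ∘ₗ V.map (bwd h) = ψ

theorem update_mem_families {V : QuiverRep k (TypeATilde n o)} {t j : ℤ}
    {v : ∀ t : ℤ, V.obj (vtx o t)} (hv : v ∈ families V (Set.Ico (t + 1) j))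
    {v0 : V.obj (vtx o t)} (h0 : (v0, v (t + 1)) ∈ link V t) :
    Function.update v t v0 ∈ families V (Set.Ico t j) := by
  intro s hs
  rw [Function.update_of_ne (show s + 1 ≠ t by have := hs.1; omega)]
  rcases hs.1.eq_or_lt with rfl | hlt
  · rwa [Function.update_self]
  · rw [Function.update_of_ne hlt.ne']
    exact hv s ⟨by omega, hs.2⟩

/-- The image of a subspace at position `i` under the linear relation from position `i` to
position `j`. -/
def push (V : QuiverRep k (TypeATilde n o)) (i j : ℤ) (F : Submodule k (V.obj (vtx o i))) :
    Submodule k (V.obj (vtx o j)) :=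
  (families V (Set.Ico i j) ⊓ F.comap (LinearMap.proj i)).map (LinearMap.proj j)

theorem mem_push {V : QuiverRep k (TypeATilde n o)} {i j : ℤ} {F : Submodule k (V.obj (vtx o i))}
    {w : V.obj (vtx o j)} :
    w ∈ push V i j F ↔ ∃ v ∈ families V (Set.Ico i j), v i ∈ F ∧ v j = w := by
  simp only [push, Submodule.mem_map, Submodule.mem_inf, Submodule.mem_comap, and_assoc]
  rfl

/-- One step of `exists_functionals`. -/
theorem exists_coLink {V : QuiverRep k (TypeATilde n o)} {t : ℤ}
    (F : Submodule k (V.obj (vtx o t))) (ψ : V.obj (vtx o (t + 1)) →ₗ[k] k)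
    (hψ : ∀ v ∈ F, ∀ w, (v, w) ∈ link V t → ψ w = 0) :
    ∃ φ : V.obj (vtx o t) →ₗ[k] k, CoLink V t φ ψ ∧ ∀ v ∈ F, φ v = 0 := by
  cases ho : o t with
  | true =>
    refine ⟨ψ ∘ₗ V.map (fwd ho), ⟨fun _ => rfl, fun h => ?_⟩, fun v hv => ?_⟩
    · rw [ho] at h
      cases h
    · exact hψ v hv _ ((mem_link_of_true ho).mpr rfl)
  | false =>
    have hmem : ψ ∈ LinearMap.range (F.mkQ ∘ₗ V.map (bwd ho)).dualMap := by
      rw [LinearMap.range_dualMap_eq_dualAnnihilator_ker, Submodule.mem_dualAnnihilator]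
      intro w hw
      rw [LinearMap.mem_ker, LinearMap.comp_apply, Submodule.mkQ_apply,
        Submodule.Quotient.mk_eq_zero] at hw
      exact hψ _ hw w ((mem_link_of_false ho).mpr rfl)
    obtain ⟨φ, hφ⟩ := hmem
    refine ⟨φ ∘ₗ F.mkQ, ⟨fun h => ?_, fun _ => hφ⟩, fun v hv => ?_⟩
    · rw [ho] at h
      cases h
    · rw [LinearMap.comp_apply, Submodule.mkQ_apply, (Submodule.Quotient.mk_eq_zero F).mpr hv,
        map_zero]

/-- Duality: a functional that vanishes on the image of `F` under the relation from position `i` to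
position `j` extends to a linked family of functionals whose member at `i` vanishes on `F`. -/
theorem exists_functionals {V : QuiverRep k (TypeATilde n o)} {j : ℤ}
    (ψ : V.obj (vtx o j) →ₗ[k] k) : ∀ i ≤ j, ∀ F : Submodule k (V.obj (vtx o i)),
    (∀ w ∈ push V i j F, ψ w = 0) →
    ∃ φ : ∀ t : ℤ, V.obj (vtx o t) →ₗ[k] k, φ j = ψ ∧
      (∀ t ∈ Set.Ico i j, CoLink V t (φ t) (φ (t + 1))) ∧ ∀ v ∈ F, φ i v = 0 := by
  refine int_induction_down ?_ ?_
  · intro F hF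
    refine ⟨Function.update 0 j ψ, Function.update_self .., fun t ht => ?_, fun v hv => ?_⟩
    · exact absurd (ht.1.trans_lt ht.2) (lt_irrefl _)
    · rw [Function.update_self]
      refine hF v (mem_push.mpr ⟨Function.update 0 j v, fun t ht => ?_, ?_, Function.update_self ..⟩)
      · exact absurd (ht.1.trans_lt ht.2) (lt_irrefl _)
      · rwa [Function.update_self]
  · intro t ht ih F hF
    let F' : Submodule k (V.obj (vtx o (t + 1))) :=
      (link V t ⊓ F.comap (LinearMap.fst k _ _)).map (LinearMap.snd k _ _)
    have hF' (w) : w ∈ F' ↔ ∃ v ∈ F, (v, w) ∈ link V t := by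
      simp only [F', Submodule.mem_map, Submodule.mem_inf, Submodule.mem_comap]
      constructor
      · rintro ⟨⟨v, w'⟩, ⟨h1, h2⟩, rfl⟩
        exact ⟨v, h2, h1⟩
      · rintro ⟨v, h2, h1⟩
        exact ⟨(v, w), ⟨h1, h2⟩, rfl⟩
    obtain ⟨φ, hφj, hφ, hφF⟩ := ih F' fun w hw => by
      obtain ⟨v, hv, hvF, rfl⟩ := mem_push.mp hw
      obtain ⟨v0, hv0, hlink⟩ := (hF' _).mp hvF
      refine hF _ (mem_push.mpr ⟨Function.update v t v0, update_mem_families hv hlink, ?_, ?_⟩)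
      · rwa [Function.update_self]
      · rw [Function.update_of_ne ht.ne']
    obtain ⟨φ0, hφ0, hφ0F⟩ := exists_coLink F (φ (t + 1)) fun v hv w hw =>
      hφF w ((hF' w).mpr ⟨v, hv, hw⟩)
    refine ⟨Function.update φ t φ0, ?_, fun s hs => ?_, fun v hv => ?_⟩
    · rw [Function.update_of_ne ht.ne', hφj]
    · rw [Function.update_of_ne (show s + 1 ≠ t by have := hs.1; omega)]
      rcases hs.1.eq_or_lt with rfl | hlt
      · rwa [Function.update_self]
      · rw [Function.update_of_ne hlt.ne']
        exact hφ s ⟨by omega, hs.2⟩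
    · rw [Function.update_self]
      exact hφ0F v hv

/-! ### Existence of a string summand -/

/-- A vector at position `j` lies in `endKer V j` if it can be the last vector of a morphism from a
string with right end `j` to `V`: the arrow from position `j` to position `j + 1`, if the arrow
between them has that direction, has to kill it. -/
def endKer (V : QuiverRep k (TypeATilde n o)) (j : ℤ) : Submodule k (V.obj (vtx o j)) where
  carrier := {w | ∀ h : o j = true, V.map (fwd h) w = 0}
  zero_mem' := by simp
  add_mem' := fun hx hy h => by rw [map_add, hx h, hy h, add_zero]
  smul_mem' := fun c x hx h => by rw [map_smul, hx h, smul_zero]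

/-- A functional at position `j` can be the last one of a morphism from `V` to a string with right
end `j` if and only if it vanishes on `endIm V j`. -/
def endIm (V : QuiverRep k (TypeATilde n o)) (j : ℤ) : Submodule k (V.obj (vtx o j)) :=
  ⨆ h : o j = false, LinearMap.range (V.map (bwd h))

theorem endIm_of_true {V : QuiverRep k (TypeATilde n o)} {j : ℤ} (h : o j = true) :
    endIm V j = ⊥ := by
  simp [endIm, h]

theorem endIm_of_false {V : QuiverRep k (TypeATilde n o)} {j : ℤ} (h : o j = false) :
    endIm V j = LinearMap.range (V.map (bwd h)) := by
  simp [endIm, h]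

theorem endIm_le_endKer (V : QuiverRep k (TypeATilde n o)) (j : ℤ) : endIm V j ≤ endKer V j := by
  refine iSup_le fun h w _ h' => ?_
  rw [h] at h'
  cases h'

/-- A morphism from the string `S(p+1,j)` to `V`, a morphism in the other direction, and the
normalization of their pairing, in terms of the images `v t` of the basis vectors and of the
coordinate functionals `φ t`. Here `p` is the position before the left end, so that the arrow next to
the left end joins the positions `p` and `p + 1`. Only the values at the positions of the string
matter. -/
structure StringPair (V : QuiverRep k (TypeATilde n o)) (p j : ℤ) where
  /-- the images of the basis vectors -/
  v : ∀ t : ℤ, V.obj (vtx o t)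
  /-- the coordinate functionals -/
  φ : ∀ t : ℤ, V.obj (vtx o t) →ₗ[k] k
  v_mem : v ∈ families V (Set.Ico (p + 1) j)
  φ_link : ∀ t ∈ Set.Ico (p + 1) j, CoLink V t (φ t) (φ (t + 1))
  v_left : ∀ h : o p = false, V.map (bwd h) (v (p + 1)) = 0
  φ_left : ∀ h : o p = true, φ (p + 1) ∘ₗ V.map (fwd h) = 0
  v_right : v j ∈ endKer V j
  φ_right : ∀ w ∈ endIm V j, φ j w = 0
  pairing : φ j (v j) = 1

/-- If there is no string summand with left end `p + 1` and right end `j`, then the subspaces which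
string morphisms see at position `j` do not jump at `p`. -/
theorem mem_sup_push_of_isEmpty {V : QuiverRep k (TypeATilde n o)} {p j : ℤ} (hpj : p < j)
    (hV : IsEmpty (StringPair V p j)) (F : Submodule k (V.obj (vtx o (p + 1))))
    (hF : ∀ h : o p = true, LinearMap.range (V.map (fwd h)) ≤ F) {v : ∀ t : ℤ, V.obj (vtx o t)}
    (hv : v ∈ families V (Set.Ico (p + 1) j))
    (hleft : ∀ h : o p = false, V.map (bwd h) (v (p + 1)) = 0) (hright : v j ∈ endKer V j) :
    v j ∈ endIm V j ⊔ push V (p + 1) j F := by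
  by_contra hne
  obtain ⟨ψ, hψ, hker⟩ := Submodule.exists_le_ker_of_notMem hne
  obtain ⟨φ, hφj, hφ, hφF⟩ := exists_functionals ((ψ (v j))⁻¹ • ψ) (p + 1) (by omega) F
    fun w hw => by
      have : ψ w = 0 := hker (Submodule.mem_sup_right hw)
      simp [this]
  refine hV.false ⟨v, φ, hv, hφ, hleft, fun h => ?_, hright, fun w hw => ?_, ?_⟩
  · ext u
    exact hφF _ (hF h ⟨u, rfl⟩)
  · have : ψ w = 0 := hker (Submodule.mem_sup_left hw)
    simp [hφj, this]
  · simp [hφj, inv_mul_cancel₀ hψ]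

/-- Without string summands with right end `j`, a vector of `endKer V j` that is reached from zero at
some position `p ≤ j` lies in `endIm V j`. -/
theorem push_zero_le {V : QuiverRep k (TypeATilde n o)} {j : ℤ}
    (hV : ∀ p < j, IsEmpty (StringPair V p j)) :
    ∀ p ≤ j, endKer V j ⊓ push V p j ⊥ ≤ endIm V j := by
  refine int_induction_down ?_ ?_
  · rintro w ⟨-, hw⟩
    obtain ⟨v, -, hv, rfl⟩ := mem_push.mp hw
    rw [(Submodule.mem_bot k).mp hv]
    exact Submodule.zero_mem _
  · rintro p hp ih w ⟨hwB, hw⟩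
    obtain ⟨v, hv, hv0, rfl⟩ := mem_push.mp hw
    rw [Submodule.mem_bot] at hv0
    have hlink := hv p ⟨le_rfl, hp⟩
    rw [hv0] at hlink
    have hv' : v ∈ families V (Set.Ico (p + 1) j) := fun t ht => hv t ⟨by have := ht.1; omega, ht.2⟩
    have key : v j ∈ endIm V j ⊔ push V (p + 1) j ⊥ := by
      cases ho : o p with
      | true =>
        refine Submodule.mem_sup_right (mem_push.mpr ⟨v, hv', ?_, rfl⟩)
        rw [Submodule.mem_bot, ← (mem_link_of_true ho).mp hlink, map_zero]
      | false =>
        exact mem_sup_push_of_isEmpty hp (hV p hp) ⊥ (fun h => absurd (ho.symm.trans h) (by simp)) hv'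
          (fun h => hlink.2 h) hwB
    obtain ⟨a, ha, z, hz, haz⟩ := Submodule.mem_sup.mp key
    have hzB : z ∈ endKer V j := by
      rw [← add_sub_cancel_left a z, haz]
      exact Submodule.sub_mem _ hwB (endIm_le_endKer V j ha)
    rw [← haz]
    exact Submodule.add_mem _ ha (ih ⟨hzB, hz⟩)

/-- Without string summands with right end `j`, every vector of `endKer V j` extends, up to
`endIm V j`, to any position `p ≤ j`. -/
theorem le_sup_push_top {V : QuiverRep k (TypeATilde n o)} {j : ℤ}
    (hV : ∀ p < j, IsEmpty (StringPair V p j)) :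
    ∀ p ≤ j, endKer V j ≤ endIm V j ⊔ push V p j ⊤ := by
  refine int_induction_down ?_ ?_
  · intro w _
    refine Submodule.mem_sup_right (mem_push.mpr ⟨Function.update 0 j w, fun t ht => ?_,
      Submodule.mem_top, Function.update_self ..⟩)
    exact absurd (ht.1.trans_lt ht.2) (lt_irrefl _)
  · intro p hp ih w hw
    obtain ⟨a, ha, e, he, hae⟩ := Submodule.mem_sup.mp (ih hw)
    have heB : e ∈ endKer V j := by
      rw [← add_sub_cancel_left a e, hae]
      exact Submodule.sub_mem _ hw (endIm_le_endKer V j ha)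
    obtain ⟨v, hv, -, rfl⟩ := mem_push.mp he
    rw [← hae]
    refine Submodule.add_mem _ (Submodule.mem_sup_left ha) ?_
    cases ho : o p with
    | true =>
      have h1 := mem_sup_push_of_isEmpty hp (hV p hp) (LinearMap.range (V.map (fwd ho)))
        (fun h => le_rfl) hv (fun h => absurd (ho.symm.trans h) (by simp)) heB
      refine (sup_le_sup_left ?_ _ : _ ≤ endIm V j ⊔ push V p j ⊤) h1
      intro w' hw'
      obtain ⟨v', hv', ⟨u, hu⟩, rfl⟩ := mem_push.mp hw'
      refine mem_push.mpr ⟨Function.update v' p u, update_mem_families hv'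
        ((mem_link_of_true ho).mpr hu), Submodule.mem_top, ?_⟩
      rw [Function.update_of_ne hp.ne']
    | false =>
      refine Submodule.mem_sup_right (mem_push.mpr ⟨Function.update v p (V.map (bwd ho) (v (p + 1))),
        update_mem_families hv ((mem_link_of_false ho).mpr rfl),
        Submodule.mem_top, ?_⟩)
      rw [Function.update_of_ne hp.ne']

theorem castEquiv_family {V : QuiverRep k (TypeATilde n o)} (v : ∀ t : ℤ, V.obj (vtx o t))
    {x : TypeATilde n o} {s t : ℤ} (hst : s = t) (h : vtx o s = x) (h' : vtx o t = x) :
    castEquiv V h (v s) = castEquiv V h' (v t) := by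
  subst hst
  rfl

theorem cast_add_one_eq {s t : ℤ} (h : vtx o s = vtx o t) : vtx o (s + 1) = vtx o (t + 1) := by
  rw [vtx_eq_iff] at h ⊢
  push_cast
  rw [h]

theorem castEquiv_map_fwd {V : QuiverRep k (TypeATilde n o)} {s t : ℤ} (h : vtx o s = vtx o t)
    (hs : o s = true) (ht : o t = true) (v : V.obj (vtx o s)) :
    castEquiv V (cast_add_one_eq h) (V.map (fwd hs) v) = V.map (fwd ht) (castEquiv V h v) :=
  castEquiv_map V h (cast_add_one_eq h) (fwd hs) (fwd ht) (vtx_eq_iff.mp h) v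

theorem castEquiv_map_bwd {V : QuiverRep k (TypeATilde n o)} {s t : ℤ} (h : vtx o s = vtx o t)
    (hs : o s = false) (ht : o t = false) (v : V.obj (vtx o (s + 1))) :
    castEquiv V h (V.map (bwd hs) v) = V.map (bwd ht) (castEquiv V (cast_add_one_eq h) v) :=
  castEquiv_map V (cast_add_one_eq h) h (bwd hs) (bwd ht) (vtx_eq_iff.mp h) v

theorem castEquiv_mem_link {V : QuiverRep k (TypeATilde n o)} {s t : ℤ} (h : vtx o s = vtx o t)
    {a : V.obj (vtx o s)} {b : V.obj (vtx o (s + 1))} (hab : (a, b) ∈ link V s) :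
    (castEquiv V h a, castEquiv V (cast_add_one_eq h) b) ∈ link V t := by
  have hst := vtx_eq_iff.mp h
  refine ⟨fun ht => ?_, fun ht => ?_⟩
  · have hs : o s = true := by rw [hst, ht]
    rw [← castEquiv_map_fwd h hs ht, hab.1 hs]
  · have hs : o s = false := by rw [hst, ht]
    rw [← castEquiv_map_bwd h hs ht, hab.2 hs]

theorem vtx_add_mul (t d : ℤ) : vtx o (t + d * (n + 1)) = vtx o t := by
  rw [vtx_eq_iff]
  have : (n : ZMod (n + 1)) + 1 = 0 := by exact_mod_cast ZMod.natCast_self (n + 1)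
  push_cast
  rw [this, mul_zero, add_zero]

/-- Shift of a family by `d` turns around the cycle. -/
def shift (V : QuiverRep k (TypeATilde n o)) (d : ℤ) (v : ∀ t : ℤ, V.obj (vtx o t)) :
    ∀ t : ℤ, V.obj (vtx o t) :=
  fun t => castEquiv V (vtx_add_mul t d) (v (t + d * (n + 1)))

theorem shift_mem_families {V : QuiverRep k (TypeATilde n o)} {I J : Set ℤ} {d : ℤ}
    {v : ∀ t : ℤ, V.obj (vtx o t)} (hv : v ∈ families V I)
    (hJ : ∀ t ∈ J, t + d * (n + 1) ∈ I) : shift V d v ∈ families V J := by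
  intro t ht
  have h := castEquiv_mem_link (vtx_add_mul t d) (hv _ (hJ t ht))
  have h2 : shift V d v (t + 1) = castEquiv V (cast_add_one_eq (vtx_add_mul t d))
      (v (t + d * (n + 1) + 1)) := castEquiv_family v (by ring) _ _
  rw [h2]
  exact h

theorem exists_relation {W : Type*} [AddCommGroup W] [Module k W] [Module.Finite k W]
    (u : Fin (Module.finrank k W + 1) → W) :
    ∃ c : Fin (Module.finrank k W + 1) → k, ∑ q, c q • u q = 0 ∧ ∃ q, c q ≠ 0 := by
  refine Fintype.not_linearIndependent_iff.mp fun h => ?_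
  have := h.fintype_card_le_finrank
  rw [Fintype.card_fin] at this
  omega

/-- If no string with right end `j` is a summand, then `endKer V j` lies in `endIm V j`. Up to
`endIm V j`, a vector of `endKer V j` extends to a linked family arbitrarily far to the left. Its
members at the positions `j - q (n+1)` lie in one finite-dimensional space. A linear relation between
them gives a combination of shifts of the family that vanishes at a position to the left of `j`, and
`push_zero_le` applies to it. -/
theorem endKer_le_endIm {V : QuiverRep k (TypeATilde n o)} {j : ℤ}
    (hV : ∀ p < j, IsEmpty (StringPair V p j)) : endKer V j ≤ endIm V j := by
  classical
  have hN : (0 : ℤ) < n + 1 := by omega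
  let m := Module.finrank k (V.obj (vtx o j))
  have hvtx (q : ℤ) : vtx o (j - q * (n + 1)) = vtx o j := by
    rw [sub_eq_add_neg, ← neg_mul]
    exact vtx_add_mul j (-q)
  have hq (q : ℤ) (h : 0 ≤ q) : 0 ≤ q * (n + 1 : ℤ) := mul_nonneg h hN.le
  have hqm (q : Fin (m + 1)) : (q : ℤ) * (n + 1 : ℤ) ≤ m * (n + 1) :=
    mul_le_mul_of_nonneg_right (by have := q.2; omega) hN.le
  have hp : j - m * (n + 1 : ℤ) ≤ j := by
    have := hq m (by omega)
    omega
  intro w hw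
  cases ho : o j with
  | true =>
    have h1 := le_sup_push_top hV _ hp hw
    rw [endIm_of_true ho, bot_sup_eq] at h1
    obtain ⟨v, hv, -, rfl⟩ := mem_push.mp h1
    -- The family continues by zero to the right of `j`.
    let v' : ∀ t : ℤ, V.obj (vtx o t) := fun t => if t ≤ j then v t else 0
    have hv' : v' ∈ families V (Set.Ici (j - m * (n + 1 : ℤ))) := by
      intro t ht
      simp only [v']
      rcases lt_trichotomy t j with h | rfl | h
      · rw [if_pos h.le, if_pos (show t + 1 ≤ j by omega)]
        exact hv t ⟨ht, h⟩
      · rw [if_pos le_rfl, if_neg (by omega), mem_link_of_true ho]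
        exact hw ho
      · rw [if_neg (by omega), if_neg (by omega)]
        exact (link V t).zero_mem
    obtain ⟨c, hc, q0, hq0⟩ := exists_relation
      (fun q : Fin (m + 1) => castEquiv V (hvtx q) (v' (j - q * (n + 1))))
    obtain ⟨b, hb, hmax⟩ := Finset.exists_max_image (Finset.univ.filter fun q => c q ≠ 0)
      (fun q => q) ⟨q0, by simp [hq0]⟩
    rw [Finset.mem_filter] at hb
    -- With `b` the largest index in the relation, the shifts with `q < b` are zero at `j`, so the
    -- combination has the value `c b • v j` there.
    let W := ∑ q, c q • shift V ((b : ℤ) - q) v'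
    have hW : W ∈ families V (Set.Ico (j - b * (n + 1 : ℤ)) j) := by
      refine Submodule.sum_mem _ fun q _ => Submodule.smul_mem _ _
        (shift_mem_families hv' fun t ht => ?_)
      have h1 := ht.1
      have h2 := hqm q
      rw [Set.mem_Ici, sub_mul]
      omega
    have hW0 : W (j - b * (n + 1 : ℤ)) = 0 := by
      apply (castEquiv V (hvtx b)).injective
      rw [map_zero, ← hc]
      simp only [W, Finset.sum_apply, Pi.smul_apply, map_sum, map_smul, shift, castEquiv_trans]
      exact Finset.sum_congr rfl fun q _ => congrArg _ (castEquiv_family v' (by ring) _ _)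
    have hWj : W j = c b • v j := by
      simp only [W, Finset.sum_apply, Pi.smul_apply, shift]
      rw [Finset.sum_eq_single b]
      · congr 1
        have h2 : v j = castEquiv V rfl (v' j) := by simp [v']
        rw [h2]
        exact castEquiv_family v' (by ring) _ _
      · intro q _ hqb
        by_cases hcq : c q = 0
        · rw [hcq, zero_smul]
        · have hlt : q < b := lt_of_le_of_ne (hmax q (by simp [hcq])) hqb
          have h3 : ¬ j + ((b : ℤ) - q) * (n + 1) ≤ j := by
            have := mul_pos (show (0 : ℤ) < (b : ℤ) - q by omega) hN
            omega
          simp only [v', if_neg h3, map_zero, smul_zero]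
      · simp
    have hmem : c b • v j ∈ push V (j - b * (n + 1 : ℤ)) j ⊥ :=
      mem_push.mpr ⟨W, hW, (Submodule.mem_bot k).mpr hW0, hWj⟩
    have h2 : v j ∈ push V (j - b * (n + 1 : ℤ)) j ⊥ :=
      (Submodule.smul_mem_iff _ hb.2).mp hmem
    exact push_zero_le hV _ (by have := hq b (by omega); omega) ⟨hw, h2⟩
  | false =>
    have hA (r : ℤ) (hr : 0 < r) (hrm : r ≤ m) {v : ∀ t : ℤ, V.obj (vtx o t)}
        (hv : v ∈ families V (Set.Ico (j - m * (n + 1 : ℤ)) j)) :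
        castEquiv V (hvtx r) (v (j - r * (n + 1))) ∈ endIm V j := by
      have h1 := mul_pos hr hN
      have h2 := mul_le_mul_of_nonneg_right hrm hN.le
      have h3 : o ((j - r * (n + 1) : ℤ) : ZMod (n + 1)) = false := by
        rw [vtx_eq_iff.mp (hvtx r), ho]
      have h4 := (mem_link_of_false h3).mp (hv (j - r * (n + 1)) ⟨by omega, by omega⟩)
      rw [← h4, castEquiv_map_bwd (hvtx r) h3 ho, endIm_of_false ho]
      exact ⟨_, rfl⟩
    refine (sup_le le_rfl ?_ : endIm V j ⊔ push V _ j ⊤ ≤ endIm V j) (le_sup_push_top hV _ hp hw)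
    intro e he
    obtain ⟨v, hv, -, rfl⟩ := mem_push.mp he
    obtain ⟨c, hc, q0, hq0⟩ := exists_relation
      (fun q : Fin (m + 1) => castEquiv V (hvtx q) (v (j - q * (n + 1))))
    obtain ⟨a, ha, hmin⟩ := Finset.exists_min_image (Finset.univ.filter fun q => c q ≠ 0)
      (fun q => q) ⟨q0, by simp [hq0]⟩
    rw [Finset.mem_filter] at ha
    -- With `a` the smallest index in the relation, the shifts with `q > a` only use the family to
    -- the left of `j`, and their values at `j` lie in `endIm V j`.
    let W := ∑ q, c q • shift V ((a : ℤ) - q) v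
    have hW : W ∈ families V (Set.Ico (j - a * (n + 1 : ℤ)) j) := by
      refine Submodule.sum_mem _ fun q _ => ?_
      by_cases hcq : c q = 0
      · rw [hcq, zero_smul]
        exact Submodule.zero_mem _
      · refine Submodule.smul_mem _ _ (shift_mem_families hv fun t ht => ?_)
        have h1 := ht.1
        have h2 := hqm q
        have h3 : a ≤ q := hmin q (by simp [hcq])
        have h4 := mul_nonneg (show (0 : ℤ) ≤ (q : ℤ) - a by omega) hN.le
        have h5 := ht.2
        rw [sub_mul] at h4
        rw [Set.mem_Ico, sub_mul]
        omega
    have hW0 : W (j - a * (n + 1 : ℤ)) = 0 := by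
      apply (castEquiv V (hvtx a)).injective
      rw [map_zero, ← hc]
      simp only [W, Finset.sum_apply, Pi.smul_apply, map_sum, map_smul, shift, castEquiv_trans]
      exact Finset.sum_congr rfl fun q _ => congrArg _ (castEquiv_family v (by ring) _ _)
    have hWj : W j ∈ endIm V j := by
      refine push_zero_le hV _ (by have := hq a (by omega); omega)
        ⟨fun h => absurd (ho.symm.trans h) (by simp), mem_push.mpr ⟨W, hW, ?_, rfl⟩⟩
      exact (Submodule.mem_bot k).mpr hW0
    have hsum : c a • v j = W j - ∑ q ∈ Finset.univ.erase a, c q • shift V ((a : ℤ) - q) v j := by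
      rw [eq_sub_iff_add_eq]
      simp only [W, Finset.sum_apply, Pi.smul_apply]
      rw [← Finset.add_sum_erase _ _ (Finset.mem_univ a)]
      congr 2
      exact castEquiv_family (x := vtx o j) v (by ring) rfl _
    refine (Submodule.smul_mem_iff _ ha.2).mp ?_
    rw [hsum]
    refine Submodule.sub_mem _ hWj (Submodule.sum_mem _ fun q hqa => ?_)
    by_cases hcq : c q = 0
    · rw [hcq, zero_smul]
      exact Submodule.zero_mem _
    · refine Submodule.smul_mem _ _ ?_
      have hlt : a < q := lt_of_le_of_ne (hmin q (by simp [hcq])) (Finset.ne_of_mem_erase hqa).symm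
      have h1 := hA ((q : ℤ) - a) (by omega) (by have := q.2; omega) hv
      rwa [castEquiv_family v (show j - ((q : ℤ) - a) * (n + 1) = j + ((a : ℤ) - q) * (n + 1) by ring)
        _ (vtx_add_mul j _)] at h1

/-- A representation with a non-invertible arrow has a string summand. Otherwise `endKer_le_endIm`
shows that arrows pointing to the right are injective and arrows pointing to the left are surjective,
so the dimension does not decrease from one position to the next. By periodicity it is constant, and
all arrows are bijective. -/
theorem exists_stringPair {V : QuiverRep k (TypeATilde n o)} (hV : ¬ V.IsInvertible) :
    ∃ p j : ℤ, p < j ∧ Nonempty (StringPair V p j) := by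
  by_contra hne
  push Not at hne
  refine hV ?_
  have hle (j : ℤ) : endKer V j ≤ endIm V j := endKer_le_endIm fun p hp => hne p j hp
  have hinj {t : ℤ} (h : o t = true) : Function.Injective (V.map (fwd h)) := by
    rw [injective_iff_map_eq_zero]
    intro v hv
    have := hle t (show v ∈ endKer V t from fun _ => hv)
    rwa [endIm_of_true h, Submodule.mem_bot] at this
  have hsurj {t : ℤ} (h : o t = false) : Function.Surjective (V.map (bwd h)) := by
    intro v
    have := hle t (show v ∈ endKer V t from fun h' => absurd (h.symm.trans h') (by simp))
    rwa [endIm_of_false h] at this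
  let d (t : ℤ) : ℕ := Module.finrank k (V.obj (vtx o t))
  have hmono : Monotone d := monotone_int_of_le_succ fun t => by
    cases h : o t with
    | true => exact LinearMap.finrank_le_finrank_of_injective (hinj h)
    | false => exact LinearMap.finrank_le_finrank_of_surjective (hsurj h)
  have hper (t : ℤ) : d (t + (n + 1)) = d t := by
    have h := vtx_add_mul (o := o) t 1
    rw [one_mul] at h
    exact (castEquiv V h).finrank_eq
  have hconst (t : ℤ) : d t = d (t + 1) :=
    le_antisymm (hmono (by omega)) ((hmono (by omega)).trans_eq (hper t))
  refine hom_cases (fun t h _ => ?_) (fun t h _ => ?_)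
  · exact ⟨hinj h, (LinearMap.injective_iff_surjective_of_finrank_eq_finrank (hconst t)).mp (hinj h)⟩
  · exact ⟨(LinearMap.injective_iff_surjective_of_finrank_eq_finrank (hconst t).symm).mpr (hsurj h),
      hsurj h⟩

/-! ### Splitting off a string -/

theorem vtx_of_add_one {a b : ℤ} (h : vtx o (a + 1) = vtx o (b + 1)) : vtx o a = vtx o b := by
  rw [vtx_eq_iff] at h ⊢
  push_cast at h
  exact add_right_cancel h

theorem arrow_eq_of_true {x y : TypeATilde n o} (a : x ⟶ y) (h : o a.1 = true) : a.1 = x.idx := by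
  have := a.2.1
  rwa [tail, if_pos h] at this

theorem arrow_add_one_of_false {x y : TypeATilde n o} (a : x ⟶ y) (h : o a.1 = false) :
    a.1 + 1 = x.idx := by
  have := a.2.1
  rwa [tail, if_neg (by simp [h])] at this

/-- The coefficient at `e_r` after the action of an arrow, in terms of the position `s` from which the
arrow leads to `r`. -/
theorem string_map_apply {i j : ℤ} {x y : TypeATilde n o} (a : x ⟶ y)
    (f : StringIndex n i j x.idx →₀ k) (r : StringIndex n i j y.idx) (s : ℤ)
    (hs : (s : ZMod (n + 1)) = x.idx) (hr : next o a.1 s = r) :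
    ((string o k i j).map a f : StringIndex n i j y.idx →₀ k) r =
      if h : i ≤ s ∧ s ≤ j then f ⟨s, h, hs⟩ else 0 := by
  induction f using Finsupp.induction_linear with
  | zero => simp
  | add f g hf hg =>
    rw [map_add, Finsupp.add_apply, hf, hg]
    split_ifs <;> simp
  | single t c =>
    rw [Finsupp.linearCombination_single]
    by_cases hts : t.1 = s
    · have h1 : i ≤ s ∧ s ≤ j := hts ▸ t.2.1
      have h2 : next o a.1 t = r := by rw [hts, hr]
      have h3 : i ≤ next o a.1 t ∧ next o a.1 t ≤ j := h2 ▸ r.2.1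
      have h4 : (⟨next o a.1 t, h3, next_cast o a.2 t.2.2⟩ : StringIndex n i j y.idx) = r :=
        Subtype.ext h2
      have h5 : t = ⟨s, h1, hs⟩ := Subtype.ext hts
      rw [dif_pos h3, dif_pos h1, h4, ← h5]
      simp
    · have h2 : next o a.1 t ≠ r := fun h => hts (next_injective a.1 (h.trans hr.symm))
      have h5 : ∀ h, t ≠ ⟨s, h, hs⟩ := fun h h' => hts (congrArg Subtype.val h')
      split_ifs with h3 h1 h1
      · rw [Finsupp.smul_apply, Finsupp.single_eq_of_ne (fun h => h2 (congrArg Subtype.val h).symm),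
          Finsupp.single_eq_of_ne (h5 h1).symm, smul_zero]
      · rw [Finsupp.smul_apply, Finsupp.single_eq_of_ne (fun h => h2 (congrArg Subtype.val h).symm),
          smul_zero]
      · rw [Finsupp.single_eq_of_ne (h5 h1).symm, smul_zero, Finsupp.zero_apply]
      · simp

theorem injective_of_triangular {ι : Type*} (g : (ι →₀ k) →ₗ[k] (ι →₀ k)) (h : ι → ℤ)
    (hd : ∀ s, g (Finsupp.single s 1) s = 1)
    (ht : ∀ s r, s ≠ r → h s ≤ h r → g (Finsupp.single s 1) r = 0) : Function.Injective g := by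
  rw [injective_iff_map_eq_zero]
  intro f hf
  by_contra hne
  obtain ⟨r, hr, hmax⟩ := Finset.exists_max_image f.support h (Finsupp.support_nonempty_iff.mpr hne)
  have h1 : g f r = f r := by
    conv_lhs => rw [← Finsupp.sum_single f, Finsupp.sum, map_sum, Finsupp.finsetSum_apply]
    rw [Finset.sum_eq_single r]
    · rw [← mul_one (f r), ← smul_eq_mul, ← Finsupp.smul_single, map_smul, Finsupp.smul_apply, hd]
    · intro s hs hsr
      rw [← mul_one (f s), ← smul_eq_mul, ← Finsupp.smul_single, map_smul, Finsupp.smul_apply,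
        ht s r hsr (hmax s hs), smul_zero]
    · exact fun h => absurd hr h
  rw [hf, Finsupp.zero_apply] at h1
  exact Finsupp.mem_support_iff.mp hr h1.symm

namespace StringPair

variable {V : QuiverRep k (TypeATilde n o)} {p j : ℤ}

/-- The images of the basis vectors, extended by zero. -/
def vec (P : StringPair V p j) (t : ℤ) : V.obj (vtx o t) :=
  if p + 1 ≤ t ∧ t ≤ j then P.v t else 0

/-- The coordinate functionals, extended by zero. -/
def coord (P : StringPair V p j) (t : ℤ) : V.obj (vtx o t) →ₗ[k] k :=
  if p + 1 ≤ t ∧ t ≤ j then P.φ t else 0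

variable (P : StringPair V p j)

theorem vec_of_not {t : ℤ} (h : ¬ (p + 1 ≤ t ∧ t ≤ j)) : P.vec t = 0 := if_neg h

theorem coord_of_not {t : ℤ} (h : ¬ (p + 1 ≤ t ∧ t ≤ j)) : P.coord t = 0 := if_neg h

theorem map_fwd_vec {t : ℤ} (ht : p + 1 ≤ t ∧ t ≤ j) (h : o t = true) :
    V.map (fwd h) (P.vec t) = P.vec (t + 1) := by
  rw [vec, if_pos ht]
  rcases ht.2.lt_or_eq with hlt | rfl
  · rw [vec, if_pos ⟨by omega, hlt⟩]
    exact (P.v_mem t ⟨ht.1, hlt⟩).1 h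
  · rw [vec_of_not _ (by omega)]
    exact P.v_right h

theorem map_bwd_vec {t : ℤ} (ht : p + 1 ≤ t + 1 ∧ t + 1 ≤ j) (h : o t = false) :
    V.map (bwd h) (P.vec (t + 1)) = P.vec t := by
  rw [vec, if_pos ht]
  rcases (show p ≤ t by omega).lt_or_eq with hlt | rfl
  · rw [vec, if_pos ⟨hlt, by omega⟩]
    exact (P.v_mem t ⟨hlt, by omega⟩).2 h
  · rw [vec_of_not _ (by omega)]
    exact P.v_left h

theorem coord_map_fwd {t : ℤ} (ht : p + 1 ≤ t + 1 ∧ t + 1 ≤ j) (h : o t = true)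
    (u : V.obj (vtx o t)) : P.coord (t + 1) (V.map (fwd h) u) = P.coord t u := by
  rw [coord, if_pos ht]
  rcases (show p ≤ t by omega).lt_or_eq with hlt | rfl
  · rw [coord, if_pos ⟨hlt, by omega⟩]
    exact LinearMap.congr_fun ((P.φ_link t ⟨hlt, by omega⟩).1 h) u
  · rw [coord_of_not _ (by omega)]
    exact LinearMap.congr_fun (P.φ_left h) u

theorem coord_map_bwd {t : ℤ} (ht : p + 1 ≤ t ∧ t ≤ j) (h : o t = false)
    (u : V.obj (vtx o (t + 1))) : P.coord t (V.map (bwd h) u) = P.coord (t + 1) u := by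
  rw [coord, if_pos ht]
  rcases ht.2.lt_or_eq with hlt | rfl
  · rw [coord, if_pos ⟨by omega, hlt⟩]
    exact LinearMap.congr_fun ((P.φ_link t ⟨ht.1, hlt⟩).2 h) u
  · rw [coord_of_not _ (by omega)]
    exact P.φ_right _ (by rw [endIm_of_false h]; exact ⟨u, rfl⟩)

/-- The pairing of `coord b` with `vec a`, for positions `a` and `b` over the same vertex. -/
def pair (P : StringPair V p j) (a b : ℤ) (h : vtx o a = vtx o b) : k :=
  P.coord b (castEquiv V h (P.vec a))

theorem pair_add_one {a b : ℤ} (h : vtx o a = vtx o b) (h' : vtx o (a + 1) = vtx o (b + 1))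
    (h1 : o a = true → (p + 1 ≤ a ∧ a ≤ j) ∧ (p + 1 ≤ b + 1 ∧ b + 1 ≤ j))
    (h2 : o a = false → (p + 1 ≤ a + 1 ∧ a + 1 ≤ j) ∧ (p + 1 ≤ b ∧ b ≤ j)) :
    P.pair (a + 1) (b + 1) h' = P.pair a b h := by
  cases ho : o a with
  | true =>
    have hb : o b = true := by rw [← vtx_eq_iff.mp h, ho]
    rw [pair, pair, ← P.map_fwd_vec (h1 ho).1 ho, castEquiv_map_fwd h ho hb,
      P.coord_map_fwd (h1 ho).2 hb]
  | false =>
    have hb : o b = false := by rw [← vtx_eq_iff.mp h, ho]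
    rw [pair, pair, ← P.map_bwd_vec (h2 ho).1 ho, castEquiv_map_bwd h ho hb,
      P.coord_map_bwd (h2 ho).2 hb]

theorem pair_self : ∀ t ≤ j, p + 1 ≤ t → P.pair t t rfl = 1 := by
  refine int_induction_down (fun h => ?_) fun t ht ih hpt => ?_
  · rw [pair, coord, vec, if_pos ⟨h, le_rfl⟩, if_pos ⟨h, le_rfl⟩]
    exact P.pairing
  · rw [← ih (by omega)]
    exact (P.pair_add_one rfl rfl (fun _ => by omega) (fun _ => by omega)).symm

/-- If the arrow next to the left end points away from the string, then `coord b` vanishes on `vec a` for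
`a < b`: follow both to the left until `vec` is mapped to zero. -/
theorem pair_of_lt (hp : o p = false) (m : ℕ) : ∀ (a b : ℤ) (h : vtx o a = vtx o b), a = p + m →
    a < b → b ≤ j → P.pair a b h = 0 := by
  induction m with
  | zero =>
    intro a b h ha hab hb
    rw [pair, P.vec_of_not (by simp at ha; omega), map_zero, map_zero]
  | succ m ih =>
    intro a b h ha hab hb
    obtain ⟨a, rfl⟩ : ∃ a', a = a' + 1 := ⟨a - 1, by ring⟩
    obtain ⟨b, rfl⟩ : ∃ b', b = b' + 1 := ⟨b - 1, by ring⟩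
    push_cast at ha
    rw [P.pair_add_one (vtx_of_add_one h) h ?_ (fun _ => by omega),
      ih a b (vtx_of_add_one h) (by omega) (by omega) (by omega)]
    intro hoa
    have : a ≠ p := by
      rintro rfl
      rw [hp] at hoa
      cases hoa
    omega

/-- If the arrow next to the left end points towards the string, then `coord b` vanishes on `vec a`
for `b < a`: follow both to the left until `coord` is zero. -/
theorem pair_of_gt (hp : o p = true) (m : ℕ) : ∀ (a b : ℤ) (h : vtx o a = vtx o b), b = p + m →
    b < a → a ≤ j → P.pair a b h = 0 := by
  induction m with
  | zero =>
    intro a b h hb hab ha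
    rw [pair, P.coord_of_not (by simp at hb; omega), LinearMap.zero_apply]
  | succ m ih =>
    intro a b h hb hab ha
    obtain ⟨a, rfl⟩ : ∃ a', a = a' + 1 := ⟨a - 1, by ring⟩
    obtain ⟨b, rfl⟩ : ∃ b', b = b' + 1 := ⟨b - 1, by ring⟩
    push_cast at hb
    rw [P.pair_add_one (vtx_of_add_one h) h (fun _ => by omega) ?_,
      ih a b (vtx_of_add_one h) (by omega) (by omega) (by omega)]
    intro hoa
    have : b ≠ p := by
      rintro rfl
      rw [vtx_eq_iff.mp (vtx_of_add_one h), hp] at hoa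
      cases hoa
    omega

theorem map_vec {x y : TypeATilde n o} (a : x ⟶ y) {s : ℤ} (hs : p + 1 ≤ s ∧ s ≤ j)
    (hx : vtx o s = x) (hy : vtx o (next o a.1 s) = y) :
    V.map a (castEquiv V hx (P.vec s)) = castEquiv V hy (P.vec (next o a.1 s)) := by
  cases ho : o a.1 with
  | true =>
    have hnext : next o a.1 s = s + 1 := by simp [next, ho]
    have has : a.1 = s :=
      (arrow_eq_of_true a ho).trans (congrArg idx (hx.symm))
    have hos : o s = true := by rw [← has, ho]
    have hy' : vtx o (s + 1) = y := by rw [← hnext, hy]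
    rw [castEquiv_family P.vec hnext hy hy', ← P.map_fwd_vec hs hos]
    exact (castEquiv_map V hx hy' (fwd hos) a has.symm _).symm
  | false =>
    obtain ⟨t, rfl⟩ : ∃ t, s = t + 1 := ⟨s - 1, by ring⟩
    have hnext : next o a.1 (t + 1) = t := by simp [next, ho]
    have hat : a.1 = t := by
      have := (arrow_add_one_of_false a ho).trans (congrArg idx (hx.symm))
      simpa [vtx] using this
    have hot : o t = false := by rw [← hat, ho]
    have hy' : vtx o t = y := by rw [← hy, hnext]
    rw [castEquiv_family P.vec hnext hy hy', ← P.map_bwd_vec hs hot]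
    exact (castEquiv_map V hx hy' (bwd hot) a hat.symm _).symm

theorem coord_congr {x : TypeATilde n o} {s t : ℤ} (hst : s = t) (h : x = vtx o s)
    (h' : x = vtx o t) (u : V.obj x) :
    P.coord s (castEquiv V h u) = P.coord t (castEquiv V h' u) := by
  subst hst
  rfl

theorem coord_map {x y : TypeATilde n o} (a : x ⟶ y) {s : ℤ} (hx : x = vtx o s)
    (hy : y = vtx o (next o a.1 s)) (hs : p + 1 ≤ next o a.1 s ∧ next o a.1 s ≤ j) (u : V.obj x) :
    P.coord (next o a.1 s) (castEquiv V hy (V.map a u)) = P.coord s (castEquiv V hx u) := by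
  cases ho : o a.1 with
  | true =>
    have hnext : next o a.1 s = s + 1 := by simp [next, ho]
    have has : a.1 = s :=
      (arrow_eq_of_true a ho).trans (congrArg idx (hx))
    have hos : o s = true := by rw [← has, ho]
    have hy' : y = vtx o (s + 1) := by rw [hy, hnext]
    rw [P.coord_congr hnext hy hy', castEquiv_map V hx hy' a (fwd hos) has]
    rw [hnext] at hs
    exact P.coord_map_fwd hs hos _
  | false =>
    obtain ⟨t, rfl⟩ : ∃ t, s = t + 1 := ⟨s - 1, by ring⟩
    have hnext : next o a.1 (t + 1) = t := by simp [next, ho]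
    have hat : a.1 = t := by
      have := (arrow_add_one_of_false a ho).trans (congrArg idx (hx))
      simpa [vtx] using this
    have hot : o t = false := by rw [← hat, ho]
    have hy' : y = vtx o t := by rw [hy, hnext]
    rw [P.coord_congr hnext hy hy', castEquiv_map V hx hy' a (bwd hot) hat]
    rw [hnext] at hs
    exact P.coord_map_bwd hs hot _

/-- The morphism from the string given by the vectors `vec t`. -/
noncomputable def incl (P : StringPair V p j) (x : TypeATilde n o) :
    (string o k (p + 1) j).obj x →ₗ[k] V.obj x :=
  Finsupp.linearCombination k fun s : StringIndex n (p + 1) j x.idx =>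
    castEquiv V (TypeATilde.ext s.2.2 : vtx o s = x) (P.vec s)

/-- The morphism to the string given by the functionals `coord t`. -/
noncomputable def retr (P : StringPair V p j) (x : TypeATilde n o) :
    V.obj x →ₗ[k] (string o k (p + 1) j).obj x :=
  (Finsupp.linearEquivFunOnFinite k k (StringIndex n (p + 1) j x.idx)).symm.toLinearMap ∘ₗ
    LinearMap.pi fun s => P.coord s ∘ₗ
      (castEquiv V (TypeATilde.ext s.2.2 : vtx o s = x).symm).toLinearMap

theorem retr_apply (x : TypeATilde n o) (u : V.obj x) (s : StringIndex n (p + 1) j x.idx) :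
    (P.retr x u : StringIndex n (p + 1) j x.idx →₀ k) s =
      P.coord s (castEquiv V (TypeATilde.ext s.2.2 : vtx o s = x).symm u) := rfl

theorem isHom_incl : QuiverRep.IsHom P.incl := by
  intro x y a f
  induction f using Finsupp.induction_linear with
  | zero => simp only [map_zero]
  | add f g hf hg => simp only [map_add, hf, hg]
  | single s c =>
    have h1 := P.map_vec a s.2.1 (TypeATilde.ext s.2.2)
      (TypeATilde.ext (next_cast o a.2 s.2.2))
    simp only [incl, Finsupp.linearCombination_single, map_smul, h1]
    congr 1
    split_ifs with h
    · rw [Finsupp.linearCombination_single, one_smul]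
    · rw [map_zero, P.vec_of_not h, map_zero]

theorem isHom_retr : QuiverRep.IsHom P.retr := by
  intro x y a u
  refine Finsupp.ext fun r => ?_
  let s : ℤ := if o a.1 then r - 1 else r + 1
  have hr : next o a.1 s = r := by
    simp only [next, s]
    split_ifs <;> ring
  have hs : (s : ZMod (n + 1)) = x.idx := by
    have h1 : head o a.1 = (r.1 : ZMod (n + 1)) := a.2.2.trans r.2.2.symm
    rw [← a.2.1]
    simp only [head, tail, s] at h1 ⊢
    split_ifs at h1 ⊢ with h
    · push_cast
      rw [← h1]
      ring
    · push_cast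
      rw [← h1]
  have hx : x = vtx o s := (TypeATilde.ext hs : vtx o s = x).symm
  have hy : y = vtx o (next o a.1 s) := by
    rw [hr]
    exact (TypeATilde.ext r.2.2 : vtx o r = y).symm
  rw [string_map_apply a _ r s hs hr, retr_apply, ← P.coord_congr hr hy, P.coord_map a hx hy
    (by rw [hr]; exact r.2.1)]
  split_ifs with h
  · rfl
  · rw [P.coord_of_not h, LinearMap.zero_apply]

/-- The matrix of `retr ∘ incl` has entries `pair s r`; it is unitriangular, in the order of the
positions or its reverse according to the direction of the arrow next to the left end. -/
theorem retr_incl_injective (x : TypeATilde n o) : Function.Injective (P.retr x ∘ₗ P.incl x) := by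
  have key (s r : StringIndex n (p + 1) j x.idx) :
      ((P.retr x ∘ₗ P.incl x) (Finsupp.single s 1) : StringIndex n (p + 1) j x.idx →₀ k) r =
        P.pair s r (vtx_eq_iff.mpr (s.2.2.trans r.2.2.symm)) := by
    rw [LinearMap.comp_apply, retr_apply, incl, Finsupp.linearCombination_single, one_smul,
      castEquiv_trans]
    rfl
  have hdiag (s : StringIndex n (p + 1) j x.idx) :
      ((P.retr x ∘ₗ P.incl x) (Finsupp.single s 1) : StringIndex n (p + 1) j x.idx →₀ k) s = 1 := by
    rw [key]
    exact P.pair_self s s.2.1.2 s.2.1.1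
  cases ho : o p with
  | true =>
    refine injective_of_triangular _ (fun s => -s.1) hdiag fun s r hsr hle => ?_
    have h1 : s.1 ≠ r.1 := fun h => hsr (Subtype.ext h)
    rw [key]
    refine P.pair_of_gt ho (r.1 - p).toNat _ _ _ ?_ (by omega) s.2.1.2
    have := r.2.1.1
    omega
  | false =>
    refine injective_of_triangular _ (fun s => s.1) hdiag fun s r hsr hle => ?_
    have h1 : s.1 ≠ r.1 := fun h => hsr (Subtype.ext h)
    rw [key]
    refine P.pair_of_lt ho (s.1 - p).toNat _ _ _ ?_ (by omega) r.2.1.2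
    have := s.2.1.1
    omega

end StringPair

/-! ### The decomposition of representations -/

variable (o) in
/-- The isomorphism classes of direct sums of strings. -/
noncomputable def stringClasses (k : Type u) [Field k] :
    AddSubmonoid (QuiverRep.IsoClass k (TypeATilde n o)) :=
  AddSubmonoid.closure {c | ∃ i j : ℤ, i ≤ j ∧ c = (string o k i j).isoClass}

/-- Every representation is the direct sum of an invertible one and of strings: as long as an arrow is
not bijective, a string can be split off. -/
theorem exists_decomposition (V : QuiverRep k (TypeATilde n o)) :
    ∃ (A : PolyModule k) (P : QuiverRep k (TypeATilde n o)), Function.Injective A.op ∧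
      P.isoClass ∈ stringClasses o k ∧ QuiverRep.Iso V ((ofPoly o A).sum P) := by
  induction hd : ∑ m : ZMod (n + 1), Module.finrank k (V.obj ⟨m⟩) using Nat.strong_induction_on
    generalizing V with
  | _ d ih =>
    by_cases hV : V.IsInvertible
    · obtain ⟨A, hA, h⟩ := exists_iso_ofPoly V hV
      refine ⟨A, QuiverRep.zero k _, hA, AddSubmonoid.zero_mem _, ?_⟩
      apply QuiverRep.iso_of_isoClass_eq
      change _ = (ofPoly o A).isoClass + 0
      rw [add_zero, QuiverRep.isoClass_eq h]
    · obtain ⟨p, j, hpj, ⟨P⟩⟩ := exists_stringPair hV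
      obtain ⟨W, e⟩ := QuiverRep.exists_iso_sum_of_retract P.incl P.retr P.isHom_incl P.isHom_retr
        P.retr_incl_injective
      have hlt : ∑ m : ZMod (n + 1), Module.finrank k (W.obj ⟨m⟩) < d := by
        rw [← hd]
        obtain ⟨f, -⟩ := e
        have hf (m : ZMod (n + 1)) : Module.finrank k (V.obj ⟨m⟩) =
            Module.finrank k ((string o k (p + 1) j).obj ⟨m⟩) + Module.finrank k (W.obj ⟨m⟩) := by
          rw [(f ⟨m⟩).finrank_eq]
          exact Module.finrank_prod
        refine Finset.sum_lt_sum (fun m _ => by rw [hf]; omega)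
          ⟨((p + 1 : ℤ) : ZMod (n + 1)), Finset.mem_univ _, ?_⟩
        rw [hf]
        have hpos : 0 < Module.finrank k
            ((string o k (p + 1) j).obj ⟨((p + 1 : ℤ) : ZMod (n + 1))⟩) := by
          have : Nonempty (StringIndex n (p + 1) j ((p + 1 : ℤ) : ZMod (n + 1))) :=
            ⟨⟨p + 1, ⟨le_rfl, hpj⟩, rfl⟩⟩
          have : Nontrivial ((string o k (p + 1) j).obj ⟨((p + 1 : ℤ) : ZMod (n + 1))⟩) :=
            Finsupp.instNontrivial
          exact Module.finrank_pos
        omega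
      obtain ⟨A, P', hA, hP', e'⟩ := ih _ hlt W rfl
      have hS : (string o k (p + 1) j).isoClass ∈ stringClasses o k :=
        AddSubmonoid.subset_closure ⟨p + 1, j, hpj, rfl⟩
      refine ⟨A, (string o k (p + 1) j).sum P', hA,
        AddSubmonoid.add_mem (stringClasses o k) hS hP', ?_⟩
      apply QuiverRep.iso_of_isoClass_eq
      rw [QuiverRep.isoClass_eq e]
      change (string o k (p + 1) j).isoClass + W.isoClass =
        (ofPoly o A).isoClass + ((string o k (p + 1) j).isoClass + P'.isoClass)
      rw [QuiverRep.isoClass_eq e']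
      exact add_left_comm (string o k (p + 1) j).isoClass (ofPoly o A).isoClass P'.isoClass

/-! ### The ideal of strings -/

theorem avoidsInvertible_of_mem_stringClasses {P : QuiverRep k (TypeATilde n o)}
    (hP : P.isoClass ∈ stringClasses o k) : P.AvoidsInvertible := by
  have key : ∀ c ∈ stringClasses o k, ∀ P : QuiverRep k (TypeATilde n o), P.isoClass = c →
      P.AvoidsInvertible := by
    intro c hc
    induction hc using AddSubmonoid.closure_induction with
    | mem c hc =>
      rintro P rfl
      obtain ⟨i, j, -, h⟩ := hc
      exact (stringGrading o k i j).avoidsInvertible.of_iso (QuiverRep.iso_of_isoClass_eq h.symm)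
    | zero =>
      intro P hP
      exact QuiverRep.avoidsInvertible_zero.of_iso (QuiverRep.iso_of_isoClass_eq hP.symm)
    | add a b _ _ ha hb =>
      intro P hP
      induction a using Quotient.inductionOn with
      | _ A =>
        induction b using Quotient.inductionOn with
        | _ B => exact ((ha A rfl).sum (hb B rfl)).of_iso (QuiverRep.iso_of_isoClass_eq hP.symm)
  exact key _ hP P rfl

theorem of_mem_stringSpan {c : QuiverRep.IsoClass k (TypeATilde n o)}
    (hc : c ∈ stringClasses o k) : GrothendieckRing.of c ∈ stringSpan o k := by
  refine GrothendieckRing.of_mem_of_closure _ ?_ hc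
  rintro _ ⟨i, j, hij, rfl⟩
  exact Submodule.subset_span ⟨i, j, hij, rfl⟩

/-- A representation that avoids invertible ones is a direct sum of strings. -/
theorem isoClass_mem_stringClasses {V : QuiverRep k (TypeATilde n o)} (hV : V.AvoidsInvertible) :
    V.isoClass ∈ stringClasses o k := by
  obtain ⟨A, P, hA, hP, h⟩ := exists_decomposition V
  have h1 : ∀ a : A.carrier, a = 0 := fun a =>
    (hV.of_iso h) (ofPoly o A) (isInvertible_ofPoly hA) (fun _ => LinearMap.inl k _ _)
      (fun _ => LinearMap.fst k _ _)
      (fun _ _ _ _ => Prod.ext rfl (map_zero (P.map _)).symm) (fun _ _ _ _ => rfl) (vtx o 0) a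
  have : Subsingleton A.carrier := subsingleton_of_forall_eq 0 h1
  have h2 : (ofPoly o A).isoClass = 0 :=
    Quotient.sound ⟨fun _ => (0 : A.carrier ≃ₗ[k] PUnit.{u + 1}), fun _ _ _ _ => rfl⟩
  have h3 : V.isoClass = (ofPoly o A).isoClass + P.isoClass := QuiverRep.isoClass_eq h
  rw [h3, h2, zero_add]
  exact hP

theorem mul_string_mem (x : QuiverRepRing k (TypeATilde n o)) (i j : ℤ) :
    x * QuiverRepRing.cls (string o k i j) ∈ stringSpan o k := by
  obtain ⟨a, b, rfl⟩ := GrothendieckRing.exists_eq_of_sub_of x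
  have key (c : QuiverRep.IsoClass k (TypeATilde n o)) :
      GrothendieckRing.of c * QuiverRepRing.cls (string o k i j) ∈ stringSpan o k := by
    induction c using Quotient.inductionOn with
    | _ V =>
      change QuiverRepRing.cls V * _ ∈ _
      rw [mul_comm, ← QuiverRepRing.cls_tensor]
      exact of_mem_stringSpan (isoClass_mem_stringClasses
        ((stringGrading o k i j).tensor V).avoidsInvertible)
  rw [sub_mul]
  exact Submodule.sub_mem _ (key a) (key b)

variable (o) in
/-- The ideal `I_n` spanned by the strings. -/
noncomputable def stringIdeal (k : Type u) [Field k] : Ideal (QuiverRepRing k (TypeATilde n o)) where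
  carrier := stringSpan o k
  zero_mem' := Submodule.zero_mem _
  add_mem' := Submodule.add_mem _
  smul_mem' x w hw := by
    induction hw using Submodule.span_induction with
    | mem w hw =>
      obtain ⟨i, j, -, rfl⟩ := hw
      exact mul_string_mem x i j
    | zero =>
      rw [smul_zero]
      exact Submodule.zero_mem _
    | add a b _ _ ha hb =>
      rw [smul_add]
      exact Submodule.add_mem _ ha hb
    | smul c a _ ha =>
      rw [smul_comm]
      exact Submodule.smul_mem _ c ha

theorem cls_of_op_eq_id (A : PolyModule k) (hA : A.op = LinearMap.id) :
    PolyRepRing.cls A = (Module.finrank k A.carrier : PolyRepRing k) := by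
  have h : PolyModule.Iso A (PolyModule.pi fun _ : Fin (Module.finrank k A.carrier) =>
      PolyModule.unit k) :=
    ⟨(Module.finBasis k A.carrier).equivFun, fun v => by rw [hA]; rfl⟩
  rw [PolyRepRing.cls_eq h, PolyRepRing.cls, PolyModule.isoClass_pi, map_sum, Finset.sum_const,
    Finset.card_univ, Fintype.card_fin, nsmul_eq_mul]
  exact mul_one _

/-- Invertible classes act on strings through their dimension, as their monodromy can be trivialized
on a string. -/
theorem ofPolyHom_cls_mul_string (A : PolyModule k) (hA : Function.Injective A.op) (i j : ℤ) :
    ofPolyHom o k (PolyRepRing.cls A) * QuiverRepRing.cls (string o k i j) =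
      (PolyRepRing.dim k (PolyRepRing.cls A) : QuiverRepRing k (TypeATilde n o)) *
        QuiverRepRing.cls (string o k i j) := by
  let A₀ : PolyModule k := { carrier := A.carrier, op := LinearMap.id }
  have h1 : QuiverRepRing.cls ((string o k i j).tensor (ofPoly o A)) =
      QuiverRepRing.cls ((string o k i j).tensor (ofPoly o A₀)) :=
    congrArg GrothendieckRing.of
      (QuiverRep.isoClass_eq ((stringGrading o k i j).tensor_ofPoly_iso A hA))
  rw [ofPolyHom_cls, mul_comm, ← QuiverRepRing.cls_tensor, h1, QuiverRepRing.cls_tensor,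
    ← ofPolyHom_cls, cls_of_op_eq_id A₀ rfl, map_natCast, PolyRepRing.dim_cls, mul_comm,
    Int.cast_natCast]

theorem ofPolyHom_mul_mem {x : PolyRepRing k}
    (hx : x ∈ Submodule.span ℤ (Set.range (PolyRepRing.primary (k := k))))
    {w : QuiverRepRing k (TypeATilde n o)} (hw : w ∈ stringSpan o k) :
    ofPolyHom o k x * w = PolyRepRing.dim k x * w := by
  induction hx using Submodule.span_induction with
  | zero => simp
  | add a b _ _ ha hb => simp only [map_add, add_mul, ha, hb, Int.cast_add]
  | smul c a _ ha =>
    rw [zsmul_eq_mul, map_mul, map_mul, map_intCast, map_intCast, mul_assoc, ha, Int.cast_mul,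
      Int.cast_id, mul_assoc]
  | mem x hx =>
    obtain ⟨p, rfl⟩ := hx
    induction hw using Submodule.span_induction with
    | zero => simp
    | add a b _ _ ha hb => simp only [mul_add, ha, hb]
    | smul c a _ ha => simp only [mul_smul_comm, ha]
    | mem w hw =>
      obtain ⟨i, j, -, rfl⟩ := hw
      exact ofPolyHom_cls_mul_string _ (PolyRepRing.injective_primary p) i j

/-! ### The invertible part of a representation -/

theorem cls_eq_of_decomposition {A A' : PolyModule k} {P P' : QuiverRep k (TypeATilde n o)}
    (hA : Function.Injective A.op) (hA' : Function.Injective A'.op)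
    (hP : P.isoClass ∈ stringClasses o k) (hP' : P'.isoClass ∈ stringClasses o k)
    (h : QuiverRep.Iso ((ofPoly o A).sum P) ((ofPoly o A').sum P')) :
    PolyRepRing.cls A = PolyRepRing.cls A' :=
  PolyRepRing.cls_eq (iso_of_ofPoly_iso (QuiverRep.iso_of_sum_iso (isInvertible_ofPoly hA)
    (isInvertible_ofPoly hA') (avoidsInvertible_of_mem_stringClasses hP)
    (avoidsInvertible_of_mem_stringClasses hP') h))

/-- The class of the invertible summand of `V`, as a `k[X]`-module. -/
noncomputable def invertiblePartAux (V : QuiverRep k (TypeATilde n o)) : PolyRepRing k :=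
  PolyRepRing.cls (exists_decomposition V).choose

theorem invertiblePartAux_eq {V : QuiverRep k (TypeATilde n o)} {A : PolyModule k}
    {P : QuiverRep k (TypeATilde n o)} (hA : Function.Injective A.op)
    (hP : P.isoClass ∈ stringClasses o k) (h : QuiverRep.Iso V ((ofPoly o A).sum P)) :
    invertiblePartAux V = PolyRepRing.cls A := by
  obtain ⟨P', hA', hP', h'⟩ := (exists_decomposition V).choose_spec
  exact cls_eq_of_decomposition hA' hA hP' hP
    ((QuiverRep.isoSetoid k _).trans ((QuiverRep.isoSetoid k _).symm h') h)

variable (o) in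
/-- The additive map `R(Q) → R` that sends a representation to its invertible summand. It is a left
inverse of `ofPolyHom` on invertible classes and vanishes on strings. -/
noncomputable def invertiblePart (k : Type u) [Field k] :
    QuiverRepRing k (TypeATilde n o) →+ PolyRepRing k :=
  GrothendieckRing.liftAdd
    { toFun := Quotient.lift invertiblePartAux fun V W h => by
        obtain ⟨A, P, hA, hP, h'⟩ := exists_decomposition W
        rw [invertiblePartAux_eq hA hP h',
          invertiblePartAux_eq hA hP ((QuiverRep.isoSetoid k _).trans h h')]
      map_zero' := by
        refine (invertiblePartAux_eq (A := PolyModule.zero k) (P := QuiverRep.zero k _)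
          (fun _ _ _ => rfl) (AddSubmonoid.zero_mem _) ?_).trans (map_zero GrothendieckRing.of)
        exact ⟨fun _ => (0 : PUnit.{u + 1} ≃ₗ[k] PUnit.{u + 1} × PUnit.{u + 1}),
          fun _ _ _ _ => rfl⟩
      map_add' := by
        rintro ⟨V⟩ ⟨W⟩
        obtain ⟨A, P, hA, hP, h⟩ := exists_decomposition V
        obtain ⟨B, R, hB, hR, h'⟩ := exists_decomposition W
        change invertiblePartAux (V.sum W) = invertiblePartAux V + invertiblePartAux W
        rw [invertiblePartAux_eq hA hP h, invertiblePartAux_eq hB hR h', ← PolyRepRing.cls_sum]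
        refine invertiblePartAux_eq (P := P.sum R) (hA.prodMap hB)
          (AddSubmonoid.add_mem (stringClasses o k) hP hR) (QuiverRep.iso_of_isoClass_eq ?_)
        have h1 : V.isoClass = (ofPoly o A).isoClass + P.isoClass := QuiverRep.isoClass_eq h
        have h2 : W.isoClass = (ofPoly o B).isoClass + R.isoClass := QuiverRep.isoClass_eq h'
        have h3 : (ofPoly o (A.sum B)).isoClass = (ofPoly o A).isoClass + (ofPoly o B).isoClass :=
          map_add (ofPolyIso o k) A.isoClass B.isoClass
        change V.isoClass + W.isoClass =
          (ofPoly o (A.sum B)).isoClass + (P.isoClass + R.isoClass)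
        rw [h1, h2, h3]
        exact add_add_add_comm _ _ _ _ }

theorem invertiblePart_cls (V : QuiverRep k (TypeATilde n o)) :
    invertiblePart o k (QuiverRepRing.cls V) = invertiblePartAux V :=
  GrothendieckRing.liftAdd_of _ _

theorem invertiblePart_ofPolyHom {x : PolyRepRing k}
    (hx : x ∈ Submodule.span ℤ (Set.range (PolyRepRing.primary (k := k)))) :
    invertiblePart o k (ofPolyHom o k x) = x := by
  induction hx using Submodule.span_induction with
  | zero => simp
  | add a b _ _ ha hb => rw [map_add, map_add, ha, hb]
  | smul c a _ ha => rw [map_zsmul, map_zsmul, ha]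
  | mem x hx =>
    obtain ⟨p, rfl⟩ := hx
    rw [PolyRepRing.primary, ofPolyHom_cls, invertiblePart_cls]
    refine invertiblePartAux_eq (P := QuiverRep.zero k _) (PolyRepRing.injective_primary p)
      (AddSubmonoid.zero_mem _) (QuiverRep.iso_of_isoClass_eq ?_)
    exact (add_zero (ofPoly o _).isoClass).symm

theorem invertiblePart_of_mem_stringSpan {w : QuiverRepRing k (TypeATilde n o)}
    (hw : w ∈ stringSpan o k) :
    invertiblePart o k w = 0 := by
  induction hw using Submodule.span_induction with
  | zero => rw [map_zero]
  | add a b _ _ ha hb => rw [map_add, ha, hb, add_zero]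
  | smul c a _ ha => rw [map_zsmul, ha, smul_zero]
  | mem w hw =>
    obtain ⟨i, j, hij, rfl⟩ := hw
    rw [invertiblePart_cls]
    refine (invertiblePartAux_eq (A := PolyModule.zero k) (P := string o k i j)
      (fun _ _ _ => rfl) (AddSubmonoid.subset_closure ⟨i, j, hij, rfl⟩)
      (QuiverRep.iso_of_isoClass_eq ?_)).trans (map_zero GrothendieckRing.of)
    have h : (ofPoly o (PolyModule.zero k)).isoClass = 0 := map_zero (ofPolyIso o k)
    change (string o k i j).isoClass =
      (ofPoly o (PolyModule.zero k)).isoClass + (string o k i j).isoClass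
    rw [h, zero_add]

/-! ### The isomorphism `R' ⊗ R̄ ⊕ I_n ≅ R(Q)` -/

variable [PerfectField k]

variable (o) in
/-- The ring homomorphism `x + w ↦ ofPolyHom (mulMap x) + w`. -/
noncomputable def structureHom (k : Type u) [Field k] [PerfectField k] :
    RingPlusIdeal (tensorDim (PolyRepRing.dim k) (PolyRepRing.unipotentSubring k)
      (PolyRepRing.simpleSubring k)) (stringIdeal o k) →+* QuiverRepRing k (TypeATilde n o) where
  toFun x := ofPolyHom o k (PolyRepRing.mulMap k x.1) + x.2
  map_zero' := by
    change ofPolyHom o k (PolyRepRing.mulMap k 0) + ((0 : stringIdeal o k) : QuiverRepRing k _) = 0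
    simp
  map_one' := by
    change ofPolyHom o k (PolyRepRing.mulMap k 1) + ((0 : stringIdeal o k) : QuiverRepRing k _) = 1
    simp
  map_add' x y := by
    change ofPolyHom o k (PolyRepRing.mulMap k (x.1 + y.1)) +
      ((x.2 + y.2 : stringIdeal o k) : QuiverRepRing k _) = _
    rw [map_add, map_add, Submodule.coe_add]
    abel
  map_mul' x y := by
    change ofPolyHom o k (PolyRepRing.mulMap k (x.1 * y.1)) +
      ((tensorDim _ _ _ x.1 • y.2 + tensorDim _ _ _ y.1 • x.2 +
        (x.2 : QuiverRepRing k (TypeATilde n o)) • y.2 : stringIdeal o k) : QuiverRepRing k _) = _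
    have h1 := ofPolyHom_mul_mem (o := o) ((PolyRepRing.mem_range_mulMap_iff _).mp ⟨x.1, rfl⟩) y.2.2
    have h2 := ofPolyHom_mul_mem (o := o) ((PolyRepRing.mem_range_mulMap_iff _).mp ⟨y.1, rfl⟩) x.2.2
    rw [PolyRepRing.dim_mulMap] at h1 h2
    have h0 (a b : ℤ) (u v : stringIdeal o k) :
        ((a • v + b • u + (u : QuiverRepRing k (TypeATilde n o)) • v : stringIdeal o k) :
          QuiverRepRing k (TypeATilde n o)) = a * v + b * u + u * v := by simp
    rw [h0, map_mul, map_mul, add_mul, mul_add, mul_add, h1,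
      mul_comm (x.2 : QuiverRepRing k _) (ofPolyHom o k _), h2]
    ring

theorem structureHom_mk (x : PolyRepRing.unipotentSubring k ⊗[ℤ] PolyRepRing.simpleSubring k)
    (w : stringIdeal o k) :
    structureHom o k (RingPlusIdeal.mk _ x w) = ofPolyHom o k (PolyRepRing.mulMap k x) + w := rfl

theorem structureHom_bijective : Function.Bijective (structureHom o k) := by
  constructor
  · rw [injective_iff_map_eq_zero]
    rintro ⟨x, w⟩ h
    change ofPolyHom o k (PolyRepRing.mulMap k x) + (w : QuiverRepRing k (TypeATilde n o)) = 0 at h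
    have h1 := congrArg (invertiblePart o k) h
    rw [map_add, invertiblePart_ofPolyHom ((PolyRepRing.mem_range_mulMap_iff _).mp ⟨x, rfl⟩),
      invertiblePart_of_mem_stringSpan w.2, map_zero, add_zero] at h1
    have hx : x = 0 := PolyRepRing.mulMap_injective (h1.trans (map_zero _).symm)
    subst hx
    rw [map_zero, map_zero, zero_add] at h
    exact Prod.ext rfl (Subtype.ext h)
  · intro r
    have key (V : QuiverRep k (TypeATilde n o)) :
        QuiverRepRing.cls V ∈ (structureHom o k).range := by
      obtain ⟨A, P, hA, hP, h⟩ := exists_decomposition V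
      obtain ⟨x, hx⟩ := (PolyRepRing.mem_range_mulMap_iff _).mpr
        (PolyRepRing.cls_mem_span_primary A hA)
      refine ⟨RingPlusIdeal.mk _ x ⟨_, of_mem_stringSpan hP⟩, ?_⟩
      rw [structureHom_mk, hx, ofPolyHom_cls]
      exact (QuiverRepRing.cls_sum (ofPoly o A) P).symm.trans
        (congrArg GrothendieckRing.of (QuiverRep.isoClass_eq h).symm)
    obtain ⟨a, b, rfl⟩ := GrothendieckRing.exists_eq_of_sub_of r
    induction a using Quotient.inductionOn with
    | _ V =>
      induction b using Quotient.inductionOn with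
      | _ W => exact Subring.sub_mem _ (key V) (key W)

variable (o) in
/-- The subring spanned by the bands. -/
noncomputable def bandSubring (k : Type u) [Field k] [PerfectField k] :
    Subring (QuiverRepRing k (TypeATilde n o)) :=
  ((ofPolyHom o k).comp (PolyRepRing.mulMap k).toRingHom).range

theorem mem_bandSubring {r : QuiverRepRing k (TypeATilde n o)} :
    r ∈ bandSubring o k ↔ ∃ x, ofPolyHom o k (PolyRepRing.mulMap k x) = r := Iff.rfl

theorem coe_bandSubring :
    (bandSubring o k : Set (QuiverRepRing k (TypeATilde n o))) = bandSpan o k := by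
  have h : bandSpan o k = (Submodule.span ℤ (Set.range (PolyRepRing.primary (k := k)))).map
      (ofPolyHom o k).toAddMonoidHom.toIntLinearMap := by
    rw [Submodule.map_span, bandSpan]
    congr 1
    ext r
    constructor
    · rintro ⟨f, hf, s, hm, h0, hs, rfl⟩
      exact ⟨_, ⟨⟨(s, f), hs, hf, hm, h0⟩, rfl⟩, ofPolyHom_cls _⟩
    · rintro ⟨_, ⟨⟨⟨s, f⟩, hs, hf, hm, h0⟩, rfl⟩, rfl⟩
      exact ⟨f, hf, s, hm, h0, hs, ofPolyHom_cls _⟩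
  ext r
  rw [SetLike.mem_coe, mem_bandSubring, h, SetLike.mem_coe, Submodule.mem_map]
  constructor
  · rintro ⟨x, rfl⟩
    exact ⟨_, (PolyRepRing.mem_range_mulMap_iff _).mp ⟨x, rfl⟩, rfl⟩
  · rintro ⟨y, hy, rfl⟩
    obtain ⟨x, rfl⟩ := (PolyRepRing.mem_range_mulMap_iff _).mpr hy
    exact ⟨x, rfl⟩

end TypeATilde

theorem mainTheorem8 (k : Type u) [Field k] [PerfectField k] (n : ℕ) (o : ZMod (n + 1) → Bool) :
    ∃ (R' Rbar : Subring (PolyRepRing k))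
      (I : Ideal (QuiverRepRing k (TypeATilde n o)))
      (B : Subring (QuiverRepRing k (TypeATilde n o))),
      (R' : Set (PolyRepRing k)) = PolyRepRing.unipotentSpan k ∧
      (Rbar : Set (PolyRepRing k)) = PolyRepRing.simpleSpan k ∧
      (I : Set (QuiverRepRing k (TypeATilde n o))) = TypeATilde.stringSpan o k ∧
      (B : Set (QuiverRepRing k (TypeATilde n o))) = TypeATilde.bandSpan o k ∧
      ∃ Φ : RingPlusIdeal (tensorDim (PolyRepRing.dim k) R' Rbar) I ≃+*
          QuiverRepRing k (TypeATilde n o),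
        (∀ w : I, Φ (RingPlusIdeal.mk _ 0 w) = w) ∧
        (∀ r, r ∈ B ↔ ∃ x : R' ⊗[ℤ] Rbar, Φ (RingPlusIdeal.mk _ x 0) = r) ∧
        (∀ (f : k[X]) (hf : Irreducible f) (s : ℕ), f.Monic → f.eval 0 ≠ 0 → 0 < s →
          ∀ (a : R') (b : Rbar), (a : PolyRepRing k) = PolyRepRing.unipotent k s →
            (b : PolyRepRing k) = PolyRepRing.simple f hf →
            Φ (RingPlusIdeal.mk _ (a ⊗ₜ[ℤ] b) 0) =
              QuiverRepRing.cls (TypeATilde.band o f hf.ne_zero s)) := by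
  refine ⟨PolyRepRing.unipotentSubring k, PolyRepRing.simpleSubring k, TypeATilde.stringIdeal o k,
    TypeATilde.bandSubring o k, PolyRepRing.coe_unipotentSubring, PolyRepRing.coe_simpleSubring,
    rfl, TypeATilde.coe_bandSubring,
    RingEquiv.ofBijective (TypeATilde.structureHom o k) TypeATilde.structureHom_bijective,
    fun w => ?_, fun r => ?_, fun f hf s _ hf0 _ a b ha hb => ?_⟩
  · rw [RingEquiv.coe_ofBijective, TypeATilde.structureHom_mk, map_zero, map_zero, zero_add]
  · simp only [RingEquiv.coe_ofBijective, TypeATilde.structureHom_mk, ZeroMemClass.coe_zero,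
      add_zero]
    exact TypeATilde.mem_bandSubring
  · rw [RingEquiv.coe_ofBijective, TypeATilde.structureHom_mk, PolyRepRing.mulMap_tmul, ha, hb,
      PolyRepRing.unipotent_mul_simple f hf hf0 s, TypeATilde.ofPolyHom_cls, ZeroMemClass.coe_zero,
      add_zero]
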